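/- An instance of the restricted Max-Min allocation (Santa Claus) problem consists of a set of $m\ge 1$ items, a set of $n\ge 1$ players, a bipartite graph $H$ between items and players in which every item is adjacent to at least one player, and a value $v_i\in\mathbb{Q}_{>0}$ for every item $x_i$. A feasible assignment gives each item to one player adjacent to it. For $t\ge 0$, a $t$-assignment is a feasible assignment in which every player receives items of total value at least $t$. An algorithm is a $\rho$-approximation algorithm if on each instance it outputs a feasible assignment that is a $\rho t$-assignment for every $t\ge 0$ for which a $t$-assignment exists, i.e. whose smallest utility is at least $\rho$ times the optimum. Let $N(p)$ denote the set of items adjacent to the player $p$. The graph $H$ is an inclusion-free convex graph (bipartite permutation graph) if the items can be ordered so that $N(p)$ is consecutive for every player $p$ (adjacency property) and, whenever $N(p)\subseteq N(q)$, the set $N(q)\setminus N(p)$ is consecutive (enclosure property). The ordering is not part of the input. Running time is the number of steps of a random access machine with index cells and rational cells, whose elementary operations are reading and writing a cell at a computed address, addition, subtraction (truncated at $0$ for indices), comparison, and multiplication of a rational by a constant of the program. The input is $m$, $n$, the adjacency matrix of $H$ and the values $v_i$. **Theorem.** (a) For every integer $k\ge 4$ there are an integer $C\ge 0$ with $$C\le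 \left\lceil \frac{\log k}{\log(1+\frac1k)}\right\rceil \quad\text{and}\quad C\le k^{1.4}$$ and a $\left(1-\frac{4}{k+1}\right)$-approximation algorithm for the Max-Min allocation problem on inclusion-free convex graphs with running time $O\big((m+n)\,n\,m^{2(C+1)}\big)$, where the constant in $O(\cdot)$ may depend on $k$. (b) Consequently the problem has a PTAS: for every $\varepsilon>0$ there is a $(1-\varepsilon)$-approximation algorithm for it whose running time is polynomial in $m+n$. -/

import Mathlib

namespace SantaClaus

/-! ### The restricted Max-Min allocation problem -/

/-- An instance with `m` items and `n` players: a bipartite graph (`adj i j` says that item `i` is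
adjacent to player `j`) without items of degree zero, and a positive rational value for each item.
Item `i` is worth `v i` to each player adjacent to it and nothing to the other players. -/
structure Instance (m n : ℕ) where
  adj : Fin m → Fin n → Prop
  v : Fin m → ℚ
  v_pos : ∀ i, 0 < v i
  exists_adj : ∀ i, ∃ j, adj i j

namespace Instance

variable {m n : ℕ} (H : Instance m n)

/-- The neighbourhood of a player. -/
def nbhd (j : Fin n) : Set (Fin m) := {i | H.adj i j}

/-- An assignment gives each item to one player (so the bundles partition the items); it is
feasible if every item goes to a player adjacent to it. -/
def Feasible (A : Fin m → Fin n) : Prop := ∀ i, H.adj i (A i)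

/-- The total value of the bundle of player `j`. -/
def utility (A : Fin m → Fin n) (j : Fin n) : ℚ := ∑ i with A i = j, H.v i

/-- A `t`-assignment: a feasible assignment in which every player receives value at least `t`. -/
def IsTAssignment (t : ℝ) (A : Fin m → Fin n) : Prop :=
  H.Feasible A ∧ ∀ j, t ≤ (H.utility A j : ℝ)

/-- `A` is feasible, and its smallest utility is at least `ρ` times the optimum, that is, at least
`ρ * t` for every `t ≥ 0` for which some `t`-assignment exists. -/
def IsApproxSolution (ρ : ℝ) (A : Fin m → Fin n) : Prop :=
  H.Feasible A ∧
    ∀ t : ℝ, 0 ≤ t → (∃ B, H.IsTAssignment t B) → H.IsTAssignment (ρ * t) A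

end Instance

/-! ### Inclusion-free convex bipartite graphs -/

/-- An ordering of the items is given by the position `pos i` of each item `i`. The items of `S`
are consecutive if every item between two items of `S` is in `S`. -/
def Consecutive {m : ℕ} (pos : Equiv.Perm (Fin m)) (S : Set (Fin m)) : Prop :=
  ∀ x ∈ S, ∀ z ∈ S, ∀ y, pos x < pos y → pos y < pos z → y ∈ S

namespace Instance

variable {m n : ℕ} (H : Instance m n)

/-- The adjacency property of an ordering of the items. -/
def AdjacencyProperty (pos : Equiv.Perm (Fin m)) : Prop :=
  ∀ j, Consecutive pos (H.nbhd j)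

/-- The enclosure property of an ordering of the items. -/
def EnclosureProperty (pos : Equiv.Perm (Fin m)) : Prop :=
  ∀ j j', H.nbhd j ⊆ H.nbhd j' → Consecutive pos (H.nbhd j' \ H.nbhd j)

/-- Inclusion-free convex graphs: some ordering of the items has both properties. -/
def InclusionFreeConvex : Prop :=
  ∃ pos : Equiv.Perm (Fin m), H.AdjacencyProperty pos ∧ H.EnclosureProperty pos

end Instance

/-! ### Random access machines

Programs are structured programs over a random access memory. The memory has cells for natural
numbers (sizes, indices, flags, addresses) and cells for rational numbers (item values), both
addressed by natural numbers computed at run time. The primitive operations are addition,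
(truncated) subtraction and comparison, and multiplication of a rational by a constant of the
program; each takes one step. There is no multiplication of two stored numbers and no rounding, so
that every stored number has bit length linear in the number of steps and the input length. -/

/-- A memory configuration. -/
structure State where
  idx : ℕ → ℕ
  val : ℕ → ℚ

/-- Expressions for natural numbers; `load a` reads the cell with address `a`. -/
inductive IExpr : Type
  | const (c : ℕ)
  | load (a : IExpr)
  | add (a b : IExpr)
  | sub (a b : IExpr)

/-- Expressions for rational numbers; `load a` reads the cell with address `a`. -/
inductive VExpr : Type
  | const (q : ℚ)
  | load (a : IExpr)
  | add (x y : VExpr)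
  | sub (x y : VExpr)
  | smul (q : ℚ) (x : VExpr)

/-- Tests. -/
inductive BExpr : Type
  | ile (a b : IExpr)
  | vle (x y : VExpr)
  | not (b : BExpr)
  | and (b c : BExpr)

/-- Programs. -/
inductive Cmd : Type
  | skip
  | setIdx (a e : IExpr)
  | setVal (a : IExpr) (x : VExpr)
  | seq (p q : Cmd)
  | ite (b : BExpr) (p q : Cmd)
  | loop (b : BExpr) (p : Cmd)

/-- The value of an expression. -/
def IExpr.eval (s : State) : IExpr → ℕ
  | .const c => c
  | .load a => s.idx (a.eval s)
  | .add a b => a.eval s + b.eval s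
  | .sub a b => a.eval s - b.eval s

/-- The number of steps that the evaluation takes. -/
def IExpr.cost : IExpr → ℕ
  | .const _ => 1
  | .load a => a.cost + 1
  | .add a b => a.cost + b.cost + 1
  | .sub a b => a.cost + b.cost + 1

/-- The value of an expression. -/
def VExpr.eval (s : State) : VExpr → ℚ
  | .const q => q
  | .load a => s.val (a.eval s)
  | .add x y => x.eval s + y.eval s
  | .sub x y => x.eval s - y.eval s
  | .smul q x => q * x.eval s

/-- The number of steps that the evaluation takes. -/
def VExpr.cost : VExpr → ℕ
  | .const _ => 1
  | .load a => a.cost + 1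
  | .add x y => x.cost + y.cost + 1
  | .sub x y => x.cost + y.cost + 1
  | .smul _ x => x.cost + 1

/-- The truth value of a test. -/
def BExpr.Holds (s : State) : BExpr → Prop
  | .ile a b => a.eval s ≤ b.eval s
  | .vle x y => x.eval s ≤ y.eval s
  | .not b => ¬ b.Holds s
  | .and b c => b.Holds s ∧ c.Holds s

/-- The number of steps that the evaluation takes. -/
def BExpr.cost : BExpr → ℕ
  | .ile a b => a.cost + b.cost + 1
  | .vle x y => x.cost + y.cost + 1
  | .not b => b.cost + 1
  | .and b c => b.cost + c.cost + 1

/-- `Exec p s T s'`: started in `s`, the program `p` halts in `s'` after exactly `T` steps. -/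
inductive Exec : Cmd → State → ℕ → State → Prop
  | skip (s : State) : Exec .skip s 1 s
  | setIdx (a e : IExpr) (s : State) :
      Exec (.setIdx a e) s (a.cost + e.cost + 1)
        { s with idx := Function.update s.idx (a.eval s) (e.eval s) }
  | setVal (a : IExpr) (x : VExpr) (s : State) :
      Exec (.setVal a x) s (a.cost + x.cost + 1)
        { s with val := Function.update s.val (a.eval s) (x.eval s) }
  | seq {p q : Cmd} {s s' s'' : State} {T T' : ℕ} :
      Exec p s T s' → Exec q s' T' s'' → Exec (.seq p q) s (T + T') s''
  | ite_true {b : BExpr} {p q : Cmd} {s s' : State} {T : ℕ} :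
      b.Holds s → Exec p s T s' → Exec (.ite b p q) s (b.cost + T + 1) s'
  | ite_false {b : BExpr} {p q : Cmd} {s s' : State} {T : ℕ} :
      ¬ b.Holds s → Exec q s T s' → Exec (.ite b p q) s (b.cost + T + 1) s'
  | loop_true {b : BExpr} {p : Cmd} {s s' s'' : State} {T T' : ℕ} :
      b.Holds s → Exec p s T s' → Exec (.loop b p) s' T' s'' →
        Exec (.loop b p) s (b.cost + T + T' + 1) s''
  | loop_false {b : BExpr} {p : Cmd} {s : State} :
      ¬ b.Holds s → Exec (.loop b p) s (b.cost + 1) s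

/-! ### Approximation algorithms -/

open Classical in
/-- The initial memory: `m`, `n` and the adjacency matrix (row by row) in the cells for natural
numbers, the values of the items in the cells for rational numbers, and zero elsewhere. The
ordering of the items is not part of the input. -/
noncomputable def Instance.input {m n : ℕ} (H : Instance m n) : State where
  idx a :=
    if a = 0 then m
    else if a = 1 then n
    else if ∃ i j, H.adj i j ∧ a = 2 + (i : ℕ) * n + (j : ℕ) then 1
    else 0
  val a := if h : a < m then H.v ⟨a, h⟩ else 0

/-- The final memory describes the assignment `A`: cell `i` holds the player who gets item `i`. -/
def State.Outputs {m n : ℕ} (s : State) (A : Fin m → Fin n) : Prop :=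
  ∀ i : Fin m, s.idx i = A i

/-- `p` is a `ρ`-approximation algorithm for the Max-Min allocation problem on (non-empty)
inclusion-free convex graphs, and it takes at most `bound m n` steps on instances with `m` items
and `n` players. -/
def IsApproxAlgorithm (p : Cmd) (ρ : ℝ) (bound : ℕ → ℕ → ℕ) : Prop :=
  ∀ (m n : ℕ), 0 < m → 0 < n → ∀ H : Instance m n, H.InclusionFreeConvex →
    ∃ (T : ℕ) (s : State) (A : Fin m → Fin n),
      Exec p H.input T s ∧ T ≤ bound m n ∧ s.Outputs A ∧ H.IsApproxSolution ρ A

end SantaClaus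

/-! Put l = (k-1)/(k+1) and let E be the least exponent with l^E ≤ 2/(k+1). The algorithm guarantees
the ratio l - l^E, which is at least 1 - 4/(k+1), and C = 2E+1.

Order. In an inclusion-free convex graph the items and the players can be ordered so that two
crossing edges always span a complete bipartite graph (`Instance.strongOrder`). The order is not
given, but breadth first search from the leftmost item of a component recovers it up to twins.
Levels grow along the order, and inside a level a later vertex has fewer neighbours one level below
and more neighbours one level above. Hence level plus a small correction counting these neighbours
is a sorting key (`StrongOrder.of_key`).

Rounding. Let B be a t-assignment. The thresholds t l^E, ..., t l split the items into E+1 value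
classes. Inside each class the items can be redistributed monotonically in the two orders: lay the
items on a line, cut the line into blocks as long as the players' shares, and give each item to the
player in whose block it starts (`exists_monotone`). Crossing edges make the new edges available
(`StrongOrder.cross_between`). Class 0 is balanced by value, and a player loses less than t l^E
there; the other classes are balanced by number, and no player loses an item. In classes 1 to E-1
values agree up to the factor l, and one item of class E is already worth t l. So each player keeps
t (l - l^E) (`le_weight_of_classes`).

Search. For such an assignment the items of an initial segment of players form a prefix of each
class, so they are described by E+1 indices: there are S = (m+1)^(E+1) states
(`GuessMem.exists_state`). A dynamic program over the players maximizes the smallest bundle value.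
The value t is unknown, but only comparisons with the thresholds matter, and these are the same for
suitable item values (or 0). The leftmost item and E such indices form a guess, again one of S
numbers. All guesses are tried, and the best result is kept for each component separately
(`BestInv.update`).

Time. Guesses times pairs of states, times items, players and key values, gives S^3 m n (m+n)^2 up
to a constant. If n ≤ m this is within the bound, since 3E+5 ≤ 4E+4 = 2(C+1). If n > m, no positive
t is attainable, and the search is skipped.

The program is written in a small language with named arrays and counted loops, is verified there,
and is compiled to the machine with a cost bound (`Prog.exec_compile`). -/

section

open Finset

set_option linter.constructorNameAsVariable false

namespace SantaClaus
namespace Ram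

/-! ### A language with named arrays and counted loops -/

/-- Names of the arrays of natural numbers. Scalars are stored at index `0`. The names
`cnt`, `x0` and `x1` reserve the cells that are used for the conversion of input and output. -/
inductive IName
  | cnt | m | x0 | x1 | inp | n | rown | ans | out | b | states | dim | cls0 | rowm | dig | lev
  | levp | key | keyp | cls | asg | asg' | unit | rounds | keys | cur | ok | t | q | x
  | i | j | c | r | u | w | g | k
  deriving DecidableEq

/-- Names of the arrays of rational numbers. -/
inductive VName
  | val | best | total | V | V' | w
  deriving DecidableEq

theorem IName.ctorIdx_injective : Function.Injective IName.ctorIdx := fun a a' h => by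
  rw [← IName.ofNat_ctorIdx a, ← IName.ofNat_ctorIdx a', h]

theorem VName.ctorIdx_injective : Function.Injective VName.ctorIdx := fun a a' h => by
  rw [← VName.ofNat_ctorIdx a, ← VName.ofNat_ctorIdx a', h]

theorem IName.ctorIdx_lt (a : IName) : a.ctorIdx < 64 := by cases a <;> decide

theorem VName.ctorIdx_lt (a : VName) : a.ctorIdx < 64 := by cases a <;> decide

/-- A memory of named arrays. -/
@[ext]
structure Mem where
  I : IName → ℕ → ℕ
  V : VName → ℕ → ℚ

namespace Mem

/-- Write into an array of natural numbers. -/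
def setI (h : Mem) (a : IName) (i x : ℕ) : Mem :=
  { h with I := Function.update h.I a (Function.update (h.I a) i x) }

/-- Write into an array of rational numbers. -/
def setV (h : Mem) (a : VName) (i : ℕ) (x : ℚ) : Mem :=
  { h with V := Function.update h.V a (Function.update (h.V a) i x) }

@[simp] theorem setI_I (h : Mem) (a a' : IName) (i x : ℕ) :
    (h.setI a i x).I a' = if a' = a then Function.update (h.I a) i x else h.I a' := by
  by_cases e : a' = a
  · subst e; simp [setI]
  · simp [setI, e]

@[simp] theorem setI_V (h : Mem) (a : IName) (i x : ℕ) : (h.setI a i x).V = h.V := rfl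

@[simp] theorem setV_V (h : Mem) (a a' : VName) (i : ℕ) (x : ℚ) :
    (h.setV a i x).V a' = if a' = a then Function.update (h.V a) i x else h.V a' := by
  by_cases e : a' = a
  · subst e; simp [setV]
  · simp [setV, e]

@[simp] theorem setV_I (h : Mem) (a : VName) (i : ℕ) (x : ℚ) : (h.setV a i x).I = h.I := rfl

end Mem

/-- Index expressions. -/
inductive IE
  | const (c : ℕ)
  | rd (a : IName) (i : IE)
  | add (x y : IE)
  | sub (x y : IE)

/-- Value expressions. -/
inductive VE
  | const (q : ℚ)
  | rd (a : VName) (i : IE)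
  | add (x y : VE)

/-- Tests. -/
inductive BE
  | ile (x y : IE)
  | vle (x y : VE)
  | not (b : BE)
  | and (b c : BE)

/-- Programs. `loop v b p` runs `p` with the scalar `v` going from `0` to the value of the
scalar `b`. -/
inductive Prog
  | setI (a : IName) (i x : IE)
  | setV (a : VName) (i : IE) (x : VE)
  | skip
  | seq (p q : Prog)
  | ite (b : BE) (p q : Prog)
  | loop (v b : IName) (p : Prog)

@[simp] def IE.eval (h : Mem) : IE → ℕ
  | .const c => c
  | .rd a i => h.I a (i.eval h)
  | .add x y => x.eval h + y.eval h
  | .sub x y => x.eval h - y.eval h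

@[simp] def VE.eval (h : Mem) : VE → ℚ
  | .const c => c
  | .rd a i => h.V a (i.eval h)
  | .add x y => x.eval h + y.eval h

@[simp] def BE.Holds (h : Mem) : BE → Prop
  | .ile x y => x.eval h ≤ y.eval h
  | .vle x y => x.eval h ≤ y.eval h
  | .not b => ¬ b.Holds h
  | .and b c => b.Holds h ∧ c.Holds h

/-- The memory after `k` rounds of a loop with counter `v`. -/
def iter (v : IName) (f : Mem → Mem) (h : Mem) : ℕ → Mem
  | 0 => h.setI v 0 0
  | r + 1 => (f (iter v f h r)).setI v 0 (r + 1)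

open Classical in
/-- The memory after a program. -/
noncomputable def Prog.eval : Prog → Mem → Mem
  | .setI a i x => fun h => h.setI a (i.eval h) (x.eval h)
  | .setV a i x => fun h => h.setV a (i.eval h) (x.eval h)
  | .skip => fun h => h
  | .seq p q => fun h => q.eval (p.eval h)
  | .ite b p q => fun h => if b.Holds h then p.eval h else q.eval h
  | .loop v b p => fun h => iter v p.eval h (h.I b 0)

/-- The index arrays that a program may change. -/
@[simp] def Prog.ModI : Prog → IName → Prop
  | .setI a _ _, d => d = a
  | .setV _ _ _, _ => False
  | .skip, _ => False
  | .seq p q, d => p.ModI d ∨ q.ModI d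
  | .ite _ p q, d => p.ModI d ∨ q.ModI d
  | .loop v _ p, d => d = v ∨ p.ModI d

/-- The value arrays that a program may change. -/
@[simp] def Prog.ModV : Prog → VName → Prop
  | .setI _ _ _, _ => False
  | .setV a _ _, d => d = a
  | .skip, _ => False
  | .seq p q, d => p.ModV d ∨ q.ModV d
  | .ite _ p q, d => p.ModV d ∨ q.ModV d
  | .loop _ _ p, d => p.ModV d

/-- The scalars that bound loops. -/
@[simp] def Prog.Bounds : Prog → IName → Prop
  | .setI _ _ _, _ => False
  | .setV _ _ _, _ => False
  | .skip, _ => False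
  | .seq p q, d => p.Bounds d ∨ q.Bounds d
  | .ite _ p q, d => p.Bounds d ∨ q.Bounds d
  | .loop _ b p, d => d = b ∨ p.Bounds d

/-- Loop counters are not changed by loop bodies. -/
@[simp] def Prog.WF : Prog → Prop
  | .seq p q => p.WF ∧ q.WF
  | .ite _ p q => p.WF ∧ q.WF
  | .loop v _ p => ¬ p.ModI v ∧ p.WF
  | _ => True

/-- `ModI` over-approximates syntactically what is written, so for concrete programs the hypothesis
is settled by `simp`. Almost all data is carried through the program by this frame rule. -/
theorem Prog.eval_I {p : Prog} {d : IName} (hd : ¬ p.ModI d) (h : Mem) :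
    (p.eval h).I d = h.I d := by
  induction p generalizing h with
  | setI a i x => simp_all [Prog.eval]
  | setV a i x => simp [Prog.eval]
  | skip => rfl
  | seq p q hp hq => simp_all [Prog.eval]
  | ite b p q hp hq => simp only [Prog.eval]; split_ifs <;> simp_all
  | loop v b p hp =>
    simp only [Prog.eval]
    induction h.I b 0 with
    | zero => simp_all [iter]
    | succ r ih => simp_all [iter]

theorem Prog.eval_V {p : Prog} {d : VName} (hd : ¬ p.ModV d) (h : Mem) :
    (p.eval h).V d = h.V d := by
  induction p generalizing h with
  | setI a i x => simp [Prog.eval]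
  | setV a i x => simp_all [Prog.eval]
  | skip => rfl
  | seq p q hp hq => simp_all [Prog.eval]
  | ite b p q hp hq => simp only [Prog.eval]; split_ifs <;> simp_all
  | loop v b p hp =>
    simp only [Prog.eval]
    induction h.I b 0 with
    | zero => simp_all [iter]
    | succ r ih => simp_all [iter]

/-- The memories `h` and `g` agree on all arrays that `p` does not change. -/
structure Same (p : Prog) (h g : Mem) : Prop where
  I : ∀ {a}, ¬ p.ModI a → g.I a = h.I a
  V : ∀ {a}, ¬ p.ModV a → g.V a = h.V a

theorem Prog.same (p : Prog) (h : Mem) : Same p h (p.eval h) :=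
  ⟨fun ha => p.eval_I ha h, fun ha => p.eval_V ha h⟩

/-- The invariant rule for loops. -/
theorem Prog.loop_inv {v b : IName} {p : Prog} {h : Mem} (Inv : ℕ → Mem → Prop)
    (h0 : Inv 0 (h.setI v 0 0))
    (hs : ∀ r < h.I b 0, ∀ g, g.I v 0 = r → Same (.loop v b p) h g → Inv r g →
      Inv (r + 1) ((p.eval g).setI v 0 (r + 1))) :
    Inv (h.I b 0) ((Prog.loop v b p).eval h) := by
  simp only [Prog.eval]
  -- The counter and the frame are carried along, so that the invariants supplied later need not
  -- mention them.
  have key : ∀ k, k ≤ h.I b 0 → Inv k (iter v p.eval h k) ∧ (iter v p.eval h k).I v 0 = k ∧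
      Same (.loop v b p) h (iter v p.eval h k) := by
    intro k
    induction k with
    | zero =>
      refine fun _ => ⟨h0, by simp [iter], ⟨fun ha => ?_, fun ha => ?_⟩⟩
      · simp_all [iter]
      · simp [iter]
    | succ r ih =>
      intro hr
      obtain ⟨h1, h2, h3⟩ := ih (by omega)
      refine ⟨hs r (by omega) _ h2 h3 h1, by simp [iter], ⟨fun ha => ?_, fun ha => ?_⟩⟩
      · have := h3.I ha
        simp only [Prog.ModI, not_or] at ha
        simp [iter, ha.1, Prog.eval_I ha.2, this]
      · have := h3.V ha
        simp only [Prog.ModV] at ha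
        simp [iter, Prog.eval_V ha, this]
  exact (key _ le_rfl).1

/-! ### Compilation -/

/-- Multiplication by a constant. -/
def mulc (e : IExpr) : ℕ → IExpr
  | 0 => .const 0
  | k + 1 => .add (mulc e k) e

theorem mulc_eval (e : IExpr) (k : ℕ) (s : State) : (mulc e k).eval s = k * e.eval s := by
  induction k with
  | zero => simp [mulc, IExpr.eval]
  | succ k ih => simp [mulc, IExpr.eval, ih]; ring

/-- The memory cell of an array entry. -/
def addr (e : IExpr) (a : ℕ) : IExpr := .add (mulc e 64) (.const a)

theorem addr_eval (e : IExpr) (a : ℕ) (s : State) : (addr e a).eval s = 64 * e.eval s + a := by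
  simp [addr, IExpr.eval, mulc_eval]

def IE.compile : IE → IExpr
  | .const c => .const c
  | .rd a i => .load (addr i.compile a.ctorIdx)
  | .add x y => .add x.compile y.compile
  | .sub x y => .sub x.compile y.compile

def VE.compile : VE → VExpr
  | .const c => .const c
  | .rd a i => .load (addr i.compile a.ctorIdx)
  | .add x y => .add x.compile y.compile

def BE.compile : BE → BExpr
  | .ile x y => .ile x.compile y.compile
  | .vle x y => .vle x.compile y.compile
  | .not b => .not b.compile
  | .and b c => .and b.compile c.compile

/-- The cell of a scalar. -/
def cell (v : IName) : IExpr := .const v.ctorIdx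

/-- The test of a compiled loop. -/
def loopTest (v b : IName) : BExpr := .not (.ile (.load (cell b)) (.load (cell v)))

/-- The increment of a compiled loop. -/
def loopIncr (v : IName) : Cmd := .setIdx (cell v) (.add (.load (cell v)) (.const 1))

def Prog.compile : Prog → Cmd
  | .setI a i x => .setIdx (addr i.compile a.ctorIdx) x.compile
  | .setV a i x => .setVal (addr i.compile a.ctorIdx) x.compile
  | .skip => .skip
  | .seq p q => .seq p.compile q.compile
  | .ite b p q => .ite b.compile p.compile q.compile
  | .loop v b p =>
      .seq (.setIdx (cell v) (.const 0)) (.loop (loopTest v b) (.seq p.compile (loopIncr v)))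

/-- A bound for the number of steps of a compiled program, given the values of the scalars that
bound the loops. -/
def Prog.bnd (β : IName → ℕ) : Prog → ℕ
  | .setI a i x => (addr i.compile a.ctorIdx).cost + x.compile.cost + 1
  | .setV a i x => (addr i.compile a.ctorIdx).cost + x.compile.cost + 1
  | .skip => 1
  | .seq p q => p.bnd β + q.bnd β
  | .ite b p q => b.compile.cost + (p.bnd β + q.bnd β) + 1
  | .loop _ b p => β b * (p.bnd β + 20) + 20

/-- The named arrays stored in the memory. -/
def dec (s : State) : Mem where
  I a i := s.idx (64 * i + a.ctorIdx)
  V a i := s.val (64 * i + a.ctorIdx)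

theorem IE.compile_eval (e : IE) (s : State) : e.compile.eval s = e.eval (dec s) := by
  induction e with
  | const c => rfl
  | rd a i ih => simp [IE.compile, IExpr.eval, addr_eval, ih, dec]
  | add x y hx hy => simp [IE.compile, IExpr.eval, hx, hy]
  | sub x y hx hy => simp [IE.compile, IExpr.eval, hx, hy]

theorem VE.compile_eval (e : VE) (s : State) : e.compile.eval s = e.eval (dec s) := by
  induction e with
  | const c => rfl
  | rd a i => simp [VE.compile, VExpr.eval, addr_eval, IE.compile_eval, dec]
  | add x y hx hy => simp [VE.compile, VExpr.eval, hx, hy]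

theorem BE.compile_holds (e : BE) (s : State) : e.compile.Holds s ↔ e.Holds (dec s) := by
  induction e with
  | ile x y => simp [BE.compile, BExpr.Holds, IE.compile_eval]
  | vle x y => simp [BE.compile, BExpr.Holds, VE.compile_eval]
  | not b hb => simp [BE.compile, BExpr.Holds, hb]
  | and b c hb hc => simp [BE.compile, BExpr.Holds, hb, hc]

/-- Array `a` occupies the cells congruent to `a.ctorIdx` modulo 64. Distinct names have distinct
residues, so a write to one array leaves the others alone. -/
theorem dec_setIdx (s : State) (a : IName) (i x : ℕ) :
    dec { s with idx := Function.update s.idx (64 * i + a.ctorIdx) x } = (dec s).setI a i x := by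
  ext d l
  · have ha := a.ctorIdx_lt
    have hd := d.ctorIdx_lt
    by_cases e : d = a
    · subst e
      simp [dec, Function.update_apply]
    · have : d.ctorIdx ≠ a.ctorIdx := fun h => e (IName.ctorIdx_injective h)
      simp only [dec, Function.update_apply, Mem.setI_I, e, if_false]
      rw [if_neg (by omega)]
  · rfl

theorem dec_setVal (s : State) (a : VName) (i : ℕ) (x : ℚ) :
    dec { s with val := Function.update s.val (64 * i + a.ctorIdx) x } = (dec s).setV a i x := by
  ext d l
  · rfl
  · have ha := a.ctorIdx_lt
    have hd := d.ctorIdx_lt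
    by_cases e : d = a
    · subst e
      simp [dec, Function.update_apply]
    · have : d.ctorIdx ≠ a.ctorIdx := fun h => e (VName.ctorIdx_injective h)
      simp only [dec, Function.update_apply, Mem.setV_V, e, if_false]
      rw [if_neg (by omega)]

theorem exec_setScalar (s : State) (v : IName) (e : IExpr) :
    ∃ s', Exec (.setIdx (cell v) e) s (e.cost + 2) s' ∧ dec s' = (dec s).setI v 0 (e.eval s) := by
  have e1 := Exec.setIdx (cell v) e s
  have e2 : (cell v).cost + e.cost + 1 = e.cost + 2 := by simp [cell, IExpr.cost]; ring
  rw [e2] at e1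
  refine ⟨_, e1, ?_⟩
  rw [← dec_setIdx]
  simp [cell, IExpr.eval]

/-- The compiled program simulates the program in the given number of steps, if the loop bounds
are not changed. -/
theorem Prog.exec_compile (β : IName → ℕ) (p : Prog) (hwf : p.WF)
    (hb : ∀ a, p.Bounds a → ¬ p.ModI a) (s : State)
    (hβ : ∀ a, p.Bounds a → (dec s).I a 0 = β a) :
    ∃ T s', Exec p.compile s T s' ∧ T ≤ p.bnd β ∧ dec s' = p.eval (dec s) := by
  induction p generalizing s with
  | setI a i x =>
    refine ⟨_, _, Exec.setIdx _ _ s, le_rfl, ?_⟩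
    simp only [addr_eval, IE.compile_eval, dec_setIdx, Prog.eval]
  | setV a i x =>
    refine ⟨_, _, Exec.setVal _ _ s, le_rfl, ?_⟩
    simp only [addr_eval, IE.compile_eval, VE.compile_eval, dec_setVal, Prog.eval]
  | skip => exact ⟨_, _, Exec.skip s, le_rfl, rfl⟩
  | seq p q hp hq =>
    simp only [Bounds, ModI, WF, not_or] at hwf hb hβ
    obtain ⟨T, s', e, hT, hs'⟩ := hp hwf.1 (fun a ha => (hb a (.inl ha)).1) s
      (fun a ha => hβ a (.inl ha))
    obtain ⟨T', s'', e', hT', hs''⟩ := hq hwf.2 (fun a ha => (hb a (.inr ha)).2) s'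
      (fun a ha => by rw [hs', Prog.eval_I (hb a (.inr ha)).1, hβ a (.inr ha)])
    exact ⟨_, _, Exec.seq e e', by simp only [bnd]; omega, by simp [hs'', hs', Prog.eval]⟩
  | ite b p q hp hq =>
    simp only [Bounds, ModI, WF, not_or] at hwf hb hβ
    by_cases hh : b.Holds (dec s)
    · obtain ⟨T, s', e, hT, hs'⟩ := hp hwf.1 (fun a ha => (hb a (.inl ha)).1) s
        (fun a ha => hβ a (.inl ha))
      exact ⟨_, _, Exec.ite_true ((b.compile_holds s).2 hh) e, by simp only [bnd]; omega,
        by simp [Prog.eval, hs', hh]⟩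
    · obtain ⟨T, s', e, hT, hs'⟩ := hq hwf.2 (fun a ha => (hb a (.inr ha)).2) s
        (fun a ha => hβ a (.inr ha))
      exact ⟨_, _, Exec.ite_false (fun h => hh ((b.compile_holds s).1 h)) e,
        by simp only [bnd]; omega, by simp [Prog.eval, hs', hh]⟩
  | loop v b p hp =>
    simp only [Bounds, ModI, WF, not_or] at hwf hb hβ
    have hvb := hb b (.inl rfl)
    have hbb : (dec s).I b 0 = β b := hβ b (.inl rfl)
    obtain ⟨s0, e0, hs0⟩ := exec_setScalar s v (.const 0)
    -- `k` counts the remaining rounds. The compiled test reads the bound anew in each round; it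
    -- still has its initial value because neither the counter nor the body writes to it.
    have main : ∀ k r, r + k = β b → ∀ s1, dec s1 = iter v p.eval (dec s) r →
        ∃ T s', Exec (.loop (loopTest v b) (.seq p.compile (loopIncr v))) s1 T s' ∧
          T ≤ k * (p.bnd β + 20) + 10 ∧ dec s' = iter v p.eval (dec s) (β b) := by
      have hI : ∀ r, ∀ a, a ≠ v → ¬ p.ModI a → (iter v p.eval (dec s) r).I a = (dec s).I a := by
        intro r a ha ha'
        induction r with
        | zero => simp [iter, ha]
        | succ r ih => simp [iter, ha, Prog.eval_I ha', ih]
      have hv : ∀ r, (iter v p.eval (dec s) r).I v 0 = r := by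
        intro r
        cases r <;> simp [iter]
      have htest : ∀ r s1, dec s1 = iter v p.eval (dec s) r →
          ((loopTest v b).Holds s1 ↔ r < β b) := by
        intro r s1 h1
        have e1 : s1.idx v.ctorIdx = r := by
          have : (dec s1).I v 0 = r := by rw [h1, hv]
          simpa [dec] using this
        have e2 : s1.idx b.ctorIdx = β b := by
          have := congrArg (fun h => h.I b 0) h1
          simp only [hI r b hvb.1 hvb.2, hbb] at this
          simpa [dec] using this
        simp [loopTest, BExpr.Holds, IExpr.eval, cell, e1, e2]
      intro k
      induction k with
      | zero =>
        intro r hr s1 h1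
        refine ⟨_, s1, Exec.loop_false (by rw [htest r s1 h1]; omega), ?_, ?_⟩
        · simp [loopTest, BExpr.cost, IExpr.cost, cell]
        · rw [h1]; congr 1
      | succ k ih =>
        intro r hr s1 h1
        obtain ⟨T, s2, e2, hT, h2⟩ := hp hwf.2 (fun a ha => (hb a (.inr ha)).2) s1
          (fun a ha => by
            rw [h1, hI r a (hb a (.inr ha)).1 (hb a (.inr ha)).2]; exact hβ a (.inr ha))
        obtain ⟨s3, e3, h3⟩ := exec_setScalar s2 v (.add (.load (cell v)) (.const 1))
        have h3' : dec s3 = iter v p.eval (dec s) (r + 1) := by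
          have : s2.idx v.ctorIdx = r := by
            have h4 : (dec s2).I v 0 = r := by rw [h2, Prog.eval_I hwf.1, h1, hv]
            simpa [dec] using h4
          rw [h3, h2, h1]
          simp [iter, IExpr.eval, cell, this]
        obtain ⟨T', s4, e4, hT', h4⟩ := ih (r + 1) (by omega) s3 h3'
        refine ⟨_, s4, Exec.loop_true ((htest r s1 h1).2 (by omega)) (Exec.seq e2 e3) e4, ?_, h4⟩
        simp only [loopTest, BExpr.cost, IExpr.cost, cell]
        rw [add_mul]
        omega
    obtain ⟨T, s', e, hT, hs'⟩ := main (β b) 0 (by omega) s0 (by rw [hs0]; simp [iter, IExpr.eval])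
    refine ⟨_, s', Exec.seq e0 e, ?_, ?_⟩
    · simp only [IExpr.cost, bnd]; omega
    · simp only [hs', Prog.eval, hbb]

/-! ### The program -/

@[simp] theorem Prog.eval_setI (a : IName) (i x : IE) (h : Mem) :
    (Prog.setI a i x).eval h = h.setI a (i.eval h) (x.eval h) := rfl

@[simp] theorem Prog.eval_setV (a : VName) (i : IE) (x : VE) (h : Mem) :
    (Prog.setV a i x).eval h = h.setV a (i.eval h) (x.eval h) := rfl

@[simp] theorem Prog.eval_skip (h : Mem) : Prog.skip.eval h = h := rfl

@[simp] theorem Prog.eval_seq (p q : Prog) (h : Mem) :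
    (Prog.seq p q).eval h = q.eval (p.eval h) := rfl

theorem Prog.eval_ite_pos {b : BE} {p q : Prog} {h : Mem} (hb : b.Holds h) :
    (Prog.ite b p q).eval h = p.eval h := by simp [Prog.eval, hb]

theorem Prog.eval_ite_neg {b : BE} {p q : Prog} {h : Mem} (hb : ¬ b.Holds h) :
    (Prog.ite b p q).eval h = q.eval h := by simp [Prog.eval, hb]

/-- The value of a scalar. -/
abbrev sc (a : IName) : IE := .rd a (.const 0)

/-- Sequential composition. -/
infixr:60 " ;; " => Prog.seq

/-- Multiplication of an expression by a constant. -/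
def IE.mul (e : IE) : ℕ → IE
  | 0 => .const 0
  | k + 1 => .add (e.mul k) e

@[simp] theorem IE.eval_mul (e : IE) (k : ℕ) (h : Mem) : (e.mul k).eval h = k * e.eval h := by
  induction k with
  | zero => simp [IE.mul]
  | succ k ih => simp [IE.mul, ih]; ring

/-- Item `i` is adjacent to player `j`. -/
def adjTest : BE := .ile (.const 1) (.rd .inp (.add (.rd .rown (sc .i)) (sc .j)))

/-- Equality test. -/
def eqTest (x y : IE) : BE := .and (.ile x y) (.ile y x)

@[simp] theorem eqTest_holds (x y : IE) (h : Mem) :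
    (eqTest x y).Holds h ↔ x.eval h = y.eval h := by
  simp [eqTest, le_antisymm_iff]

/-- Sizes and constants; `E` is the number of value thresholds. -/
def scalarsProg (E : ℕ) : Prog :=
  .setI .m (.const 0) (.rd .inp (.const 0)) ;;
  .setI .n (.const 0) (.rd .inp (.const 1)) ;;
  .setI .b (.const 0) (.add (sc .m) (.const 1)) ;;
  .setI .dim (.const 0) (.const (E + 1)) ;;
  .setI .cls0 (.const 0) (.const E) ;;
  .setI .unit (.const 0)
    (.add (.add (sc .m) (sc .m)) (.add (.add (sc .n) (sc .n)) (.const 1))) ;;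
  .setI .rounds (.const 0) (.add (.add (sc .m) (sc .n)) (.const 1))

/-- The positions of the rows of the adjacency matrix. -/
def rownProg : Prog :=
  .setI .t (.const 0) (.const 2) ;;
  .loop .i .m (.setI .rown (sc .i) (sc .t) ;; .setI .t (.const 0) (.add (sc .t) (sc .n)))

/-- Some feasible assignment, and the total value of the items. -/
def defaultProg : Prog :=
  .setV .val (sc .m) (.const 0) ;;
  .setV .total (.const 0) (.const 0) ;;
  .loop .i .m (
    .setV .best (sc .i) (.const 0) ;;
    .setV .total (.const 0) (.add (.rd .total (.const 0)) (.rd .val (sc .i))) ;;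
    .loop .j .n (.ite adjTest (.setI .ans (sc .i) (sc .j)) .skip))

/-- The number of states. It is zero if there are more players than items. -/
def statesProg : Prog :=
  .setI .states (.const 0) (.const 1) ;;
  .loop .c .dim (
    .setI .t (.const 0) (.const 0) ;;
    .loop .r .b (.setI .t (.const 0) (.add (sc .t) (sc .states))) ;;
    .setI .states (.const 0) (sc .t)) ;;
  .ite (.ile (sc .n) (sc .m)) .skip (.setI .states (.const 0) (.const 0))

/-- An upper bound for the keys. -/
def keyBoundProg : Prog :=
  .setI .keys (.const 0) (sc .unit) ;;
  .loop .r .rounds (.setI .keys (.const 0) (.add (sc .keys) (sc .unit)))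

/-- Multiples of the number of items. -/
def rowmProg : Prog :=
  .setI .t (.const 0) (.const 0) ;;
  .loop .u .states (.setI .rowm (sc .u) (sc .t) ;; .setI .t (.const 0) (.add (sc .t) (sc .m)))

/-- The position of a digit of a state. -/
abbrev digAt (E : ℕ) (u : IE) (c : IE) : IE := .rd .dig (.add (u.mul (E + 1)) c)

/-- The digits of all states. -/
def digProg (E : ℕ) : Prog :=
  .loop .u .states (
    .setI .x (.const 0) (sc .u) ;;
    .loop .c .dim (
      .setI .q (.const 0) (.const 0) ;;
      .loop .r .states (.ite (.ile (sc .b) (sc .x))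
        (.setI .x (.const 0) (.sub (sc .x) (sc .b)) ;;
          .setI .q (.const 0) (.add (sc .q) (.const 1))) .skip) ;;
      .setI .dig (.add ((sc .u).mul (E + 1)) (sc .c)) (sc .x) ;;
      .setI .x (.const 0) (sc .q)))

/-- One round of breadth first search. -/
def bfsRound : Prog :=
  .loop .i .m (.loop .j .n (.ite adjTest
    (.ite (.and (eqTest (.rd .lev (sc .i)) (sc .cur)) (eqTest (.rd .levp (sc .j)) (.const 0)))
        (.setI .levp (sc .j) (.add (sc .cur) (sc .unit))) .skip ;;
      .ite (.and (eqTest (.rd .levp (sc .j)) (sc .cur)) (eqTest (.rd .lev (sc .i)) (.const 0)))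
        (.setI .lev (sc .i) (.add (sc .cur) (sc .unit))) .skip)
    .skip))

/-- Breadth first search from the item that is the first digit of `g`. -/
def bfsProg (E : ℕ) : Prog :=
  .loop .i .b (.setI .lev (sc .i) (.const 0)) ;;
  .loop .j .n (.setI .levp (sc .j) (.const 0)) ;;
  .setI .lev (digAt E (sc .g) (.const 0)) (sc .unit) ;;
  .setI .cur (.const 0) (sc .unit) ;;
  .loop .r .rounds (bfsRound ;; .setI .cur (.const 0) (.add (sc .cur) (sc .unit)))

/-- The keys that sort the items. -/
def itemKeyProg : Prog :=
  .loop .i .m (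
    .setI .t (.const 0) (.rd .lev (sc .i)) ;;
    .loop .j .n (.ite adjTest
      (.ite (.ile (.rd .levp (sc .j)) (.rd .lev (sc .i))) .skip
        (.setI .t (.const 0) (.add (sc .t) (.const 2))))
      (.setI .t (.const 0) (.add (sc .t) (.const 1)))) ;;
    .setI .key (sc .i) (sc .t)) ;;
  .setI .key (sc .m) (.const 0)

/-- The keys that sort the players. -/
def playerKeyProg : Prog :=
  .loop .j .n (
    .setI .t (.const 0) (.rd .levp (sc .j)) ;;
    .loop .i .m (.ite adjTest
      (.ite (.ile (.rd .lev (sc .i)) (.rd .levp (sc .j))) .skip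
        (.setI .t (.const 0) (.add (sc .t) (.const 2))))
      (.setI .t (.const 0) (.add (sc .t) (.const 1)))) ;;
    .setI .keyp (sc .j) (sc .t))

/-- The value classes of the items; the thresholds are given by the digits of `g`. -/
def classProg (E : ℕ) : Prog :=
  .loop .i .m (
    .setI .cls (sc .i) (.const 0) ;;
    .loop .c .cls0 (.ite
      (.vle (.rd .val (sc .i))
        (.rd .val (digAt E (sc .g) (.add (sc .c) (.const 1))))) .skip
      (.setI .cls (sc .i) (.add (.rd .cls (sc .i)) (.const 1)))))

/-- Item `i` belongs to the set of items described by the state `u`. -/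
def memTest (E : ℕ) (u : IName) : BE :=
  .and (.ile (.const 1) (.rd .lev (sc .i)))
    (.not (.and
      (.ile (.rd .key (digAt E (sc u) (.rd .cls (sc .i)))) (.rd .key (sc .i)))
      (.not (.and
        (.ile (.rd .key (sc .i)) (.rd .key (digAt E (sc u) (.rd .cls (sc .i)))))
        (.ile (sc .i) (digAt E (sc u) (.rd .cls (sc .i))))))))

/-- Item `i` is in the set of `u` and not in the set of `w`. -/
def newTest (E : ℕ) : BE := .and (memTest E .u) (.not (memTest E .w))

/-- The start of the dynamic program. -/
def startProg : Prog :=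
  .loop .u .states (
    .setV .V (sc .u) (.rd .total (.const 0)) ;;
    .loop .i .m (.setI .asg (.add (.rd .rowm (sc .u)) (sc .i)) (.rd .ans (sc .i))))

/-- Can player `j` get the items that are in the set of `u` and not in the set of `w`, and what is
their value? -/
def bundleProg (E : ℕ) : Prog :=
  .setI .ok (.const 0) (.const 1) ;;
  .setV .w (.const 0) (.const 0) ;;
  .loop .i .m (
    .ite (newTest E)
      (.setV .w (.const 0) (.add (.rd .w (.const 0)) (.rd .val (sc .i))) ;;
        .ite adjTest .skip (.setI .ok (.const 0) (.const 0)))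
      (.ite (.and (memTest E .w) (.not (memTest E .u))) (.setI .ok (.const 0) (.const 0)) .skip))

/-- The row of `u` after the transition from `w`. -/
def rowProg (E : ℕ) : Prog :=
  .loop .i .m (.ite (newTest E)
    (.setI .asg' (.add (.rd .rowm (sc .u)) (sc .i)) (sc .j))
    (.setI .asg' (.add (.rd .rowm (sc .u)) (sc .i)) (.rd .asg (.add (.rd .rowm (sc .w)) (sc .i)))))

/-- The transition from `w` to `u`. -/
def transitionProg (E : ℕ) : Prog :=
  bundleProg E ;;
  .ite (.vle (.rd .w (.const 0)) (.rd .V (sc .w))) .skip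
    (.setV .w (.const 0) (.rd .V (sc .w))) ;;
  .ite (.and (.ile (.const 1) (sc .ok)) (.not (.vle (.rd .w (.const 0)) (.rd .V' (sc .u)))))
    (.setV .V' (sc .u) (.rd .w (.const 0)) ;; rowProg E) .skip

/-- All transitions to `u`. -/
def stateProg (E : ℕ) : Prog :=
  .setV .V' (sc .u) (.const 0) ;;
  .loop .i .m (.setI .asg' (.add (.rd .rowm (sc .u)) (sc .i))
    (.rd .asg (.add (.rd .rowm (sc .u)) (sc .i)))) ;;
  .loop .w .states (transitionProg E)

/-- The new table becomes the current table. -/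
def copyProg : Prog :=
  .loop .u .states (
    .setV .V (sc .u) (.rd .V' (sc .u)) ;;
    .loop .i .m (.setI .asg (.add (.rd .rowm (sc .u)) (sc .i))
      (.rd .asg' (.add (.rd .rowm (sc .u)) (sc .i)))))

/-- One player. -/
def playerProg (E : ℕ) : Prog := .loop .u .states (stateProg E) ;; copyProg

/-- All players, sorted by their keys. -/
def dpProg (E : ℕ) : Prog :=
  .loop .k .keys (.loop .j .n (
    .ite (.and (eqTest (.rd .keyp (sc .j)) (sc .k)) (.ile (.const 1) (.rd .levp (sc .j))))
      (playerProg E) .skip))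

/-- Update of the best assignment. -/
def updateProg : Prog :=
  .loop .u .states (.loop .i .m (
    .ite (.and (.ile (.const 1) (.rd .lev (sc .i)))
        (.not (.vle (.rd .V (sc .u)) (.rd .best (sc .i)))))
      (.setV .best (sc .i) (.rd .V (sc .u)) ;;
        .setI .ans (sc .i) (.rd .asg (.add (.rd .rowm (sc .u)) (sc .i)))) .skip))

/-- Everything that is done for one guess `g`. -/
def guessProg (E : ℕ) : Prog :=
  bfsProg E ;; itemKeyProg ;; playerKeyProg ;; classProg E ;; startProg ;; dpProg E ;; updateProg

/-- The first tables. -/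
def setupProg : Prog := rownProg ;; defaultProg ;; statesProg ;; keyBoundProg

/-- The main part. -/
def mainProg (E : ℕ) : Prog := rowmProg ;; digProg E ;; .loop .g .states (guessProg E)

/-- The result is moved to a place where it can be read while the first cells are overwritten. -/
def outProg : Prog := .loop .i .m (.setI .out (.add (sc .m) (sc .i)) (.rd .ans (sc .i)))

/-! ### Tables -/

/-- Stored numbers cannot be multiplied, so the row offsets are accumulated by addition. The 2 skips
the cells that hold `m` and `n`. -/
theorem rownProg_spec (h : Mem) :
    ∀ i < h.I .m 0, (rownProg.eval h).I .rown i = 2 + i * h.I .n 0 := by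
  have := Prog.loop_inv (v := .i) (b := .m)
    (p := .setI .rown (sc .i) (sc .t) ;; .setI .t (.const 0) (.add (sc .t) (sc .n)))
    (h := h.setI .t 0 2)
    (fun r g => g.I .t 0 = 2 + r * h.I .n 0 ∧ ∀ i < r, g.I .rown i = 2 + i * h.I .n 0)
    (by simp) (by
      rintro r - g hr hs ⟨h1, h2⟩
      have hn : g.I .n 0 = h.I .n 0 := by rw [hs.I (by simp)]; simp
      refine ⟨by simp [h1, hn]; ring, fun i hi => ?_⟩
      simp only [Prog.eval_seq, Prog.eval_setI, Mem.setI_I, IE.eval, reduceCtorEq, if_false,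
        if_true, hr, h1, Function.update_apply]
      split_ifs with e
      · rw [e]
      · exact h2 i (by omega))
  simpa [rownProg] using this.2

/-- Adjacency as read from the memory. -/
def AdjM (h : Mem) (i j : ℕ) : Prop := 1 ≤ h.I .inp (h.I .rown i + j)

theorem adjTest_holds (h : Mem) : adjTest.Holds h ↔ AdjM h (h.I .i 0) (h.I .j 0) := by
  simp [adjTest, AdjM]

theorem AdjM_congr {g h : Mem} (h1 : g.I .inp = h.I .inp) (h2 : g.I .rown = h.I .rown) (i j : ℕ) :
    AdjM g i j ↔ AdjM h i j := by
  simp [AdjM, h1, h2]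

/-- The inner loop of the computation of the default assignment. -/
def defaultRow : Prog := .loop .j .n (.ite adjTest (.setI .ans (sc .i) (sc .j)) .skip)

theorem defaultRow_spec (h : Mem) :
    (∀ l, l ≠ h.I .i 0 → (defaultRow.eval h).I .ans l = h.I .ans l) ∧
    ((∃ j < h.I .n 0, AdjM h (h.I .i 0) j) → (defaultRow.eval h).I .ans (h.I .i 0) < h.I .n 0 ∧
      AdjM h (h.I .i 0) ((defaultRow.eval h).I .ans (h.I .i 0))) := by
  refine Prog.loop_inv (v := .j) (b := .n)
    (p := .ite adjTest (.setI .ans (sc .i) (sc .j)) .skip) (h := h)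
    (fun r g => (∀ l, l ≠ h.I .i 0 → g.I .ans l = h.I .ans l) ∧
      ((∃ j < r, AdjM h (h.I .i 0) j) → g.I .ans (h.I .i 0) < h.I .n 0 ∧
        AdjM h (h.I .i 0) (g.I .ans (h.I .i 0))))
    (by simp) ?_
  rintro r hr g hj hs ⟨h1, h2⟩
  have hi : g.I .i 0 = h.I .i 0 := by rw [hs.I (by simp)]
  have ha : AdjM g (g.I .i 0) (g.I .j 0) ↔ AdjM h (h.I .i 0) r := by
    rw [AdjM_congr (hs.I (by simp)) (hs.I (by simp)), hi, hj]
  by_cases hadj : AdjM h (h.I .i 0) r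
  · rw [Prog.eval_ite_pos (by rw [adjTest_holds, ha]; exact hadj)]
    refine ⟨fun l hl => ?_, fun _ => ?_⟩
    · simp [hi, hl, h1 l hl]
    · simp [hi, hj, hr, hadj]
  · rw [Prog.eval_ite_neg (by rw [adjTest_holds, ha]; exact hadj)]
    refine ⟨fun l hl => ?_, fun ⟨j, hjr, hja⟩ => ?_⟩
    · simp [h1 l hl]
    · have : j ≠ r := by rintro rfl; exact hadj hja
      simpa using h2 ⟨j, by omega, hja⟩

/-- The extra value 0 at index `m` is a sentinel: used as a threshold, it lies below the value of
every item. -/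
theorem defaultProg_spec (h : Mem) :
    let g := defaultProg.eval h
    (∀ i < h.I .m 0, g.V .val i = h.V .val i) ∧ g.V .val (h.I .m 0) = 0 ∧
    (∀ i < h.I .m 0, g.V .best i = 0) ∧ g.V .total 0 = ∑ i ∈ range (h.I .m 0), h.V .val i ∧
    (∀ i < h.I .m 0, (∃ j < h.I .n 0, AdjM h i j) → g.I .ans i < h.I .n 0 ∧
      AdjM h i (g.I .ans i)) := by
  have := Prog.loop_inv (v := .i) (b := .m)
    (p := .setV .best (sc .i) (.const 0) ;;
      .setV .total (.const 0) (.add (.rd .total (.const 0)) (.rd .val (sc .i))) ;; defaultRow)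
    (h := (h.setV .val (h.I .m 0) 0).setV .total 0 0)
    (fun r g => (∀ i < r, g.V .best i = 0) ∧ g.V .total 0 = ∑ i ∈ range r, h.V .val i ∧
      (∀ i < r, (∃ j < h.I .n 0, AdjM h i j) → g.I .ans i < h.I .n 0 ∧ AdjM h i (g.I .ans i)))
    (by simp) (by
      rintro r hr g hj hs ⟨h1, h2, h3⟩
      set g1 := (Prog.setV .best (sc .i) (.const 0) ;;
        .setV .total (.const 0) (.add (.rd .total (.const 0)) (.rd .val (sc .i)))).eval g with hg1
      have hI : g1.I = g.I := by simp [hg1]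
      have hval : g.V .val r = h.V .val r := by
        rw [hs.V (by simp [defaultRow])]
        simp at hr
        simp [hr.ne]
      have hadj : ∀ i j, AdjM g1 i j ↔ AdjM h i j := fun i j => by
        rw [AdjM_congr]
        · rw [hI, hs.I (by simp [defaultRow])]; simp
        · rw [hI, hs.I (by simp [defaultRow])]; simp
      have hn : g1.I .n 0 = h.I .n 0 := by
        rw [hI, hs.I (by simp [defaultRow])]; simp
      have hir : g1.I .i 0 = r := by rw [hI, hj]
      have hsp := defaultRow_spec g1
      simp only [hadj, hn, hir] at hsp
      have e1 : (Prog.setV .best (sc .i) (.const 0) ;;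
        .setV .total (.const 0) (.add (.rd .total (.const 0)) (.rd .val (sc .i))) ;;
          defaultRow).eval g = defaultRow.eval g1 := rfl
      have hV1 : (defaultRow.eval g1).V .best = g1.V .best :=
        Prog.eval_V (by simp [defaultRow]) _
      have hV2 : (defaultRow.eval g1).V .total = g1.V .total :=
        Prog.eval_V (by simp [defaultRow]) _
      rw [e1]
      refine ⟨fun i hi => ?_, ?_, fun i hi hex => ?_⟩
      · simp only [Mem.setI_V, hV1]
        simp only [hg1, Prog.eval_seq, Prog.eval_setV, Mem.setV_V, reduceCtorEq, if_false, if_true,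
          IE.eval, VE.eval, hj, Function.update_apply]
        split_ifs with e
        · rfl
        · exact h1 i (by omega)
      · simp only [Mem.setI_V, hV2]
        simp [hg1, h2, hj, hval, Finset.sum_range_succ]
      · simp only [Mem.setI_I, reduceCtorEq, if_false]
        by_cases e : i = r
        · subst e; exact hsp.2 hex
        · rw [hsp.1 i e, hI]
          exact h3 i (by omega) hex)
  obtain ⟨h1, h2, h3⟩ := this
  have hv := (Prog.loop .i .m (Prog.setV .best (sc .i) (.const 0) ;;
      .setV .total (.const 0) (.add (.rd .total (.const 0)) (.rd .val (sc .i))) ;;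
        defaultRow)).eval_V (d := .val) (by simp [defaultRow])
      ((h.setV .val (h.I .m 0) 0).setV .total 0 0)
  refine ⟨fun i hi => ?_, ?_, ?_, ?_, ?_⟩
  · have := congrFun hv i
    simpa [defaultProg, defaultRow, hi.ne] using this
  · have := congrFun hv (h.I .m 0)
    simpa [defaultProg, defaultRow] using this
  · simpa [defaultProg, defaultRow] using h1
  · simpa [defaultProg, defaultRow] using h2
  · simpa [defaultProg, defaultRow] using h3

/-- The power is built by repeated addition. With more players than items the optimum is 0, and
having no states makes the main part trivial. -/
theorem statesProg_spec (h : Mem) :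
    (statesProg.eval h).I .states 0 =
      if h.I .n 0 ≤ h.I .m 0 then h.I .b 0 ^ h.I .dim 0 else 0 := by
  have inner : ∀ g : Mem, ((Prog.loop .r .b
      (.setI .t (.const 0) (.add (sc .t) (sc .states)))).eval g).I .t 0 =
      g.I .t 0 + g.I .b 0 * g.I .states 0 := fun g => by
    refine Prog.loop_inv (v := .r) (b := .b)
      (p := .setI .t (.const 0) (.add (sc .t) (sc .states))) (h := g)
      (fun r f => f.I .t 0 = g.I .t 0 + r * g.I .states 0) (by simp) ?_
    rintro r - f - hs h1
    have : f.I .states 0 = g.I .states 0 := by rw [hs.I (by simp)]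
    simp [h1, this]; ring
  have outer := Prog.loop_inv (v := .c) (b := .dim)
    (p := .setI .t (.const 0) (.const 0) ;;
    .loop .r .b (.setI .t (.const 0) (.add (sc .t) (sc .states))) ;;
    .setI .states (.const 0) (sc .t)) (h := h.setI .states 0 1)
    (fun r g => g.I .states 0 = h.I .b 0 ^ r) (by simp) (by
      rintro r - g - hs h1
      have hb : g.I .b 0 = h.I .b 0 := by rw [hs.I (by simp)]; simp
      simp only [Prog.eval_seq, Prog.eval_setI, Mem.setI_I, reduceCtorEq, if_false, if_true,
        IE.eval, inner, Function.update_self, hb, h1]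
      ring)
  set f := (Prog.loop .c .dim
    (.setI .t (.const 0) (.const 0) ;;
    .loop .r .b (.setI .t (.const 0) (.add (sc .t) (sc .states))) ;;
    .setI .states (.const 0) (sc .t))).eval (h.setI .states 0 1) with hf
  have hfn : f.I .n 0 = h.I .n 0 := by rw [hf, Prog.eval_I (by simp)]; simp
  have hfm : f.I .m 0 = h.I .m 0 := by rw [hf, Prog.eval_I (by simp)]; simp
  have e : statesProg.eval h = (Prog.ite (.ile (sc .n) (sc .m)) .skip
    (.setI .states (.const 0) (.const 0))).eval f := rfl
  rw [e]
  split_ifs with hnm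
  · rw [Prog.eval_ite_pos (by simpa [hfn, hfm] using hnm)]
    simpa using outer
  · rw [Prog.eval_ite_neg (by simpa [hfn, hfm] using hnm)]
    simp

theorem keyBoundProg_spec (h : Mem) :
    (keyBoundProg.eval h).I .keys 0 = h.I .unit 0 * (h.I .rounds 0 + 1) := by
  have := Prog.loop_inv (v := .r) (b := .rounds)
    (p := .setI .keys (.const 0) (.add (sc .keys) (sc .unit)))
    (h := h.setI .keys 0 (h.I .unit 0))
    (fun r g => g.I .keys 0 = h.I .unit 0 * (r + 1))
    (by simp) (by
      rintro r - g hr hs h1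
      have hn : g.I .unit 0 = h.I .unit 0 := by rw [hs.I (by simp)]; simp
      simp [h1, hn]; ring)
  simpa [keyBoundProg] using this

theorem rowmProg_spec (h : Mem) :
    ∀ u < h.I .states 0, (rowmProg.eval h).I .rowm u = u * h.I .m 0 := by
  have := Prog.loop_inv (v := .u) (b := .states)
    (p := .setI .rowm (sc .u) (sc .t) ;; .setI .t (.const 0) (.add (sc .t) (sc .m)))
    (h := h.setI .t 0 0)
    (fun r g => g.I .t 0 = r * h.I .m 0 ∧ ∀ u < r, g.I .rowm u = u * h.I .m 0)
    (by simp) (by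
      rintro r - g hr hs ⟨h1, h2⟩
      have hn : g.I .m 0 = h.I .m 0 := by rw [hs.I (by simp)]; simp
      refine ⟨by simp [h1, hn]; ring, fun i hi => ?_⟩
      simp only [Prog.eval_seq, Prog.eval_setI, Mem.setI_I, IE.eval, reduceCtorEq, if_false,
        if_true, hr, h1, Function.update_apply]
      split_ifs with e
      · rw [e]
      · exact h2 i (by omega))
  simpa [rowmProg] using this.2

/-- Division with remainder by repeated subtraction. -/
def divProg : Prog :=
  .loop .r .states (.ite (.ile (sc .b) (sc .x))
        (.setI .x (.const 0) (.sub (sc .x) (sc .b)) ;;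
          .setI .q (.const 0) (.add (sc .q) (.const 1))) .skip)

/-- After `r` rounds either the remainder is already small or `x` has dropped by at least `r`. So
`states` rounds suffice for every `x ≤ states`. -/
theorem divProg_spec (h : Mem) (hb : 0 < h.I .b 0) (hx : h.I .x 0 ≤ h.I .states 0)
    (hq : h.I .q 0 = 0) :
    (divProg.eval h).I .x 0 = h.I .x 0 % h.I .b 0 ∧
      (divProg.eval h).I .q 0 = h.I .x 0 / h.I .b 0 := by
  have := Prog.loop_inv (v := .r) (b := .states)
    (p := .ite (.ile (sc .b) (sc .x))
        (.setI .x (.const 0) (.sub (sc .x) (sc .b)) ;;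
          .setI .q (.const 0) (.add (sc .q) (.const 1))) .skip)
    (h := h)
    (fun r g => g.I .x 0 + h.I .b 0 * g.I .q 0 = h.I .x 0 ∧
      (g.I .x 0 < h.I .b 0 ∨ g.I .x 0 + r ≤ h.I .x 0))
    (by simp [hq]) (by
      rintro r - g hr hs ⟨h1, h2⟩
      have hb' : g.I .b 0 = h.I .b 0 := by rw [hs.I (by simp)]
      by_cases hh : h.I .b 0 ≤ g.I .x 0
      · rw [Prog.eval_ite_pos (by simpa [hb'] using hh)]
        simp only [Prog.eval_seq, Prog.eval_setI, Mem.setI_I, IE.eval, reduceCtorEq, if_false,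
          if_true, hb', Function.update_self, mul_add]
        omega
      · rw [Prog.eval_ite_neg (by simpa [hb'] using hh)]
        simp only [Prog.eval_skip, Mem.setI_I, reduceCtorEq, if_false]
        exact ⟨h1, .inl (by omega)⟩)
  obtain ⟨h1, h2⟩ := this
  change (divProg.eval h).I .x 0 + h.I .b 0 * (divProg.eval h).I .q 0 = h.I .x 0 at h1
  change (divProg.eval h).I .x 0 < h.I .b 0 ∨ (divProg.eval h).I .x 0 + _ ≤ h.I .x 0 at h2
  have h3 : (divProg.eval h).I .x 0 < h.I .b 0 := by omega
  rw [← h1]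
  constructor
  · rw [Nat.add_mul_mod_self_left, Nat.mod_eq_of_lt h3]
  · rw [Nat.add_mul_div_left _ _ hb, Nat.div_eq_of_lt h3, zero_add]

/-- The digits of one state. -/
def digRow (E : ℕ) : Prog :=
  .loop .c .dim (
      .setI .q (.const 0) (.const 0) ;;
      divProg ;;
      .setI .dig (.add ((sc .u).mul (E + 1)) (sc .c)) (sc .x) ;;
      .setI .x (.const 0) (sc .q))

/-- The whole array `dig` is described, because the rows written for other states have to survive.
-/
theorem digRow_spec (E : ℕ) (h : Mem) (hb : 0 < h.I .b 0) (hx : h.I .x 0 ≤ h.I .states 0)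
    (hE : h.I .dim 0 = E + 1) :
    ∀ l, ((digRow E).eval h).I .dig l =
      if (E + 1) * h.I .u 0 ≤ l ∧ l < (E + 1) * h.I .u 0 + (E + 1) then
        h.I .x 0 / h.I .b 0 ^ (l - (E + 1) * h.I .u 0) % h.I .b 0 else h.I .dig l := by
  have := Prog.loop_inv (v := .c) (b := .dim)
    (p := .setI .q (.const 0) (.const 0) ;;
      divProg ;;
      .setI .dig (.add ((sc .u).mul (E + 1)) (sc .c)) (sc .x) ;;
      .setI .x (.const 0) (sc .q))
    (h := h)
    (fun r g => g.I .x 0 = h.I .x 0 / h.I .b 0 ^ r ∧ ∀ l, g.I .dig l =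
      if (E + 1) * h.I .u 0 ≤ l ∧ l < (E + 1) * h.I .u 0 + r then
        h.I .x 0 / h.I .b 0 ^ (l - (E + 1) * h.I .u 0) % h.I .b 0 else h.I .dig l)
    (by
      refine ⟨by simp, fun l => ?_⟩
      rw [if_neg (by omega)]; simp) (by
      rintro r - g hr hs ⟨h1, h2⟩
      have hb' : g.I .b 0 = h.I .b 0 := by rw [hs.I (by simp [divProg])]
      have hs' : g.I .states 0 = h.I .states 0 := by rw [hs.I (by simp [divProg])]
      have hu' : g.I .u 0 = h.I .u 0 := by rw [hs.I (by simp [divProg])]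
      have hd := divProg_spec (g.setI .q 0 0) (by simpa [hb'] using hb)
        (by simpa [hs', h1] using (Nat.div_le_self _ _).trans hx) (by simp)
      simp only [Mem.setI_I, reduceCtorEq, if_false, hb', h1] at hd
      have hf : ∀ a, ¬ divProg.ModI a → (divProg.eval (g.setI .q 0 0)).I a = (g.setI .q 0 0).I a :=
        fun a ha => Prog.eval_I ha _
      have hfu := congrFun (hf .u (by simp [divProg])) 0
      have hfc := congrFun (hf .c (by simp [divProg])) 0
      have hfd := fun l => congrFun (hf .dig (by simp [divProg])) l
      simp only [Mem.setI_I, reduceCtorEq, if_false, hu', hr, h2] at hfu hfc hfd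
      refine ⟨?_, fun l => ?_⟩
      · simp only [Prog.eval_seq, Prog.eval_setI, Mem.setI_I, IE.eval, reduceCtorEq, if_false,
          if_true, Function.update_self, hd.2]
        rw [Nat.div_div_eq_div_mul, pow_succ]
      · simp only [Prog.eval_seq, Prog.eval_setI, Mem.setI_I, IE.eval, reduceCtorEq, if_false,
          if_true, Function.update_apply, IE.eval_mul, hd.1, hfu, hfc, hfd]
        by_cases e : l = (E + 1) * h.I .u 0 + r
        · rw [if_pos e, if_pos (by omega)]
          congr 3
          omega
        · rw [if_neg e]
          by_cases e' : (E + 1) * h.I .u 0 ≤ l ∧ l < (E + 1) * h.I .u 0 + r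
          · rw [if_pos e', if_pos (by omega)]
          · rw [if_neg e', if_neg (by omega)])
  have h2 := this.2
  rw [hE] at h2
  exact h2

theorem digProg_spec (E : ℕ) (h : Mem) (hb : 0 < h.I .b 0) (hE : h.I .dim 0 = E + 1) :
    ∀ u < h.I .states 0, ∀ c < E + 1,
      ((digProg E).eval h).I .dig ((E + 1) * u + c) = u / h.I .b 0 ^ c % h.I .b 0 := by
  refine Prog.loop_inv (v := .u) (b := .states)
    (p := .setI .x (.const 0) (sc .u) ;; digRow E)
    (h := h)
    (fun r g => ∀ u < r, ∀ c < E + 1, g.I .dig ((E + 1) * u + c) = u / h.I .b 0 ^ c % h.I .b 0)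
    (by simp) ?_
  intro r hr g hu hs hI u hur c hc
  have hsp := digRow_spec E (g.setI .x 0 r)
    (by rw [Mem.setI_I, if_neg (by simp), hs.I (by simp [digRow, divProg])]; exact hb)
    (by
      have : g.I .states 0 = h.I .states 0 := by rw [hs.I (by simp [digRow, divProg])]
      simpa [this] using hr.le)
    (by
      have : g.I .dim 0 = h.I .dim 0 := by rw [hs.I (by simp [digRow, divProg])]
      simpa [this] using hE)
    ((E + 1) * u + c)
  have hb' : g.I .b 0 = h.I .b 0 := by rw [hs.I (by simp [digRow, divProg])]
  simp only [Mem.setI_I, reduceCtorEq, if_false, if_true, Function.update_self, hu, hb'] at hsp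
  simp only [Prog.eval_seq, Prog.eval_setI, Mem.setI_I, IE.eval, reduceCtorEq, if_false, hu, hsp]
  by_cases e : u = r
  · subst e
    rw [if_pos (by omega)]
    congr 3
    omega
  · have : u < r := by omega
    have h2 := Nat.mul_le_mul_left (E + 1) (show u + 1 ≤ r from this)
    rw [mul_add] at h2
    rw [if_neg (by omega), hI u this c hc]

end Ram
/-! ### Levels of a breadth first search -/

/-- `L` assigns to the vertices their levels in a breadth first search: the root has level `B`,
levels grow in steps of `B`, and vertices that are not reached have level `0`. -/
structure Levels {V : Type*} (B : ℕ) (G : V → V → Prop) (root : V → Prop) (L : V → ℕ) : Prop where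
  root_eq : ∀ v, root v → L v = B
  pred : ∀ v, L v ≠ 0 → ¬ root v → ∃ w, G v w ∧ L w ≠ 0 ∧ L w + B = L v
  adj : ∀ v w, G v w → L v ≠ 0 → L w ≠ 0 ∧ L w ≤ L v + B

/-- The search is in the round of level `c`. -/
structure PartialLevels {V : Type*} (B : ℕ) (G : V → V → Prop) (root : V → Prop) (c : ℕ)
    (L : V → ℕ) : Prop where
  root_eq : ∀ v, root v → L v = B
  pred : ∀ v, L v ≠ 0 → ¬ root v → ∃ w, G v w ∧ L w ≠ 0 ∧ L w + B = L v
  adj : ∀ v w, G v w → L v ≠ 0 → L v < c → L w ≠ 0 ∧ L w ≤ L v + B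
  le : ∀ v, L v ≤ c ∨ L v = c + B

namespace PartialLevels

variable {V : Type*} {B c : ℕ} {G : V → V → Prop} {root : V → Prop} {L : V → ℕ}

/-- The field `adj` concerns only levels below `c`, so a new vertex of level `c + B` has no
obligations yet. A vertex of level 0 is not a root, not the predecessor of a reached vertex, and not
a neighbour of a finished one, so changing it disturbs nothing. -/
theorem update [DecidableEq V] (h : PartialLevels B G root c L) (hB : 0 < B)
    (hc : 0 < c) {v w : V} (hwv : G w v) (hv : L v = c) (hw : L w = 0) : PartialLevels B G root c (Function.update L w (c + B)) := by
  have hvw : v ≠ w := by rintro rfl; omega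
  constructor
  · intro u hu
    by_cases e : u = w
    · subst e; have := h.root_eq u hu; omega
    · simp [e, h.root_eq u hu]
  · intro u hu hr
    by_cases e : u = w
    · subst e
      exact ⟨v, hwv, by simp [hvw, hv]; omega, by simp [hvw, hv]⟩
    · rw [Function.update_of_ne e] at hu ⊢
      obtain ⟨z, hz, hz0, hz1⟩ := h.pred u hu hr
      have : z ≠ w := by rintro rfl; exact hz0 hw
      exact ⟨z, hz, by rwa [Function.update_of_ne this], by rwa [Function.update_of_ne this]⟩
  · intro u z huz hu huc
    by_cases e : u = w
    · subst e; simp at huc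
    · rw [Function.update_of_ne e] at hu huc ⊢
      obtain ⟨h1, h2⟩ := h.adj u z huz hu huc
      have : z ≠ w := by rintro rfl; exact h1 hw
      rw [Function.update_of_ne this]
      exact ⟨h1, h2⟩
  · intro u
    by_cases e : u = w
    · subst e; simp
    · rw [Function.update_of_ne e]; exact h.le u

theorem next (h : PartialLevels B G root c L)
    (hn : ∀ v w, G v w → L v = c → L w ≠ 0) : PartialLevels B G root (c + B) L := by
  refine ⟨h.root_eq, h.pred, fun v w hvw hv hc => ?_, fun v => ?_⟩
  · rcases lt_trichotomy (L v) c with h1 | h1 | h1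
    · exact h.adj v w hvw hv h1
    · refine ⟨hn v w hvw h1, ?_⟩
      have := h.le w
      omega
    · have := h.le v
      omega
  · have := h.le v
    left
    omega

theorem exists_eq (h : PartialLevels B G root c L) (hB : 0 < B) (v : V) (hv : L v ≠ 0) :
    ∃ k, L v = B * (k + 1) := by
  induction hl : L v using Nat.strong_induction_on generalizing v with
  | _ l ih =>
    by_cases hr : root v
    · exact ⟨0, by rw [← hl, h.root_eq v hr]; simp⟩
    · obtain ⟨w, -, hw0, hw⟩ := h.pred v hv hr
      obtain ⟨k, hk⟩ := ih (L w) (by omega) w hw0 rfl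
      exact ⟨k + 1, by rw [← hl, ← hw, hk]; ring⟩

theorem exists_lower (h : PartialLevels B G root c L) (hB : 0 < B) (k : ℕ) (v : V)
    (hv : L v = B * (k + 1)) : ∀ l ≤ k, ∃ w, L w = B * (l + 1) := by
  induction k generalizing v with
  | zero => intro l hl; exact ⟨v, by rw [hv, Nat.le_zero.1 hl]⟩
  | succ k ih =>
    intro l hl
    rcases hl.lt_or_eq with hl | rfl
    · have hv0 : L v ≠ 0 := by rw [hv]; positivity
      have hr : ¬ root v := fun hr => by
        have := h.root_eq v hr
        rw [hv] at this
        nlinarith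
      obtain ⟨w, -, -, hw⟩ := h.pred v hv0 hr
      refine ih w ?_ l (by omega)
      rw [hv] at hw
      have : B * (k + 1 + 1) = B * (k + 1) + B := by ring
      omega
    · exact ⟨v, hv⟩

/-- All levels below an attained one are attained (`exists_lower`), by different vertices. This is
why a number of rounds slightly above the number of vertices completes the search. -/
theorem le_card [Fintype V] (h : PartialLevels B G root c L) (hB : 0 < B) (v : V) :
    L v ≤ B * Fintype.card V := by
  by_cases hv : L v = 0
  · omega
  obtain ⟨k, hk⟩ := h.exists_eq hB v hv
  choose f hf using fun l : Fin (k + 1) => h.exists_lower hB k v hk l (by omega)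
  have hinj : Function.Injective f := fun l l' hll => by
    have h1 := hf l
    rw [hll, hf l'] at h1
    have := Nat.eq_of_mul_eq_mul_left hB h1
    exact Fin.ext (by omega)
  have := Fintype.card_le_of_injective f hinj
  rw [Fintype.card_fin] at this
  rw [hk]
  exact Nat.mul_le_mul_left B this

theorem levels [Fintype V] (h : PartialLevels B G root c L) (hB : 0 < B)
    (hc : B * Fintype.card V < c) : Levels B G root L :=
  ⟨h.root_eq, h.pred, fun v w hvw hv => h.adj v w hvw hv ((h.le_card hB v).trans_lt hc)⟩

end PartialLevels

/-- A finished search is a partial one at any level that bounds all others, so the facts above carry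
over. -/
theorem Levels.partialLevels {V : Type*} [Fintype V] {B : ℕ} {G : V → V → Prop} {root : V → Prop}
    {L : V → ℕ} (h : Levels B G root L) (c : ℕ) (hc : ∀ v, L v ≤ c) :
    PartialLevels B G root c L :=
  ⟨h.root_eq, h.pred, fun v w hvw hv _ => h.adj v w hvw hv, fun v => .inl (hc v)⟩

theorem Levels.le_card {V : Type*} [Fintype V] {B : ℕ} {G : V → V → Prop} {root : V → Prop}
    {L : V → ℕ} (h : Levels B G root L) (hB : 0 < B) (v : V) : L v ≤ B * Fintype.card V := by
  classical
  exact (h.partialLevels (∑ w, L w) fun w =>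
    Finset.single_le_sum (f := L) (fun _ _ => Nat.zero_le _) (mem_univ w)).le_card hB v

theorem Levels.exists_eq {V : Type*} [Fintype V] {B : ℕ} {G : V → V → Prop} {root : V → Prop}
    {L : V → ℕ} (h : Levels B G root L) (hB : 0 < B) (v : V) (hv : L v ≠ 0) :
    ∃ k, L v = B * (k + 1) := by
  classical
  exact (h.partialLevels (∑ w, L w) fun w =>
    Finset.single_le_sum (f := L) (fun _ _ => Nat.zero_le _) (mem_univ w)).exists_eq hB v hv

/-- The symmetric adjacency relation on items and players. -/
def adjV {m n : ℕ} (adj : ℕ → ℕ → Prop) : Fin m ⊕ Fin n → Fin m ⊕ Fin n → Prop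
  | .inl i, .inr j => adj i j
  | .inr j, .inl i => adj i j
  | _, _ => False

/-- The vertex is the item `x`. -/
def isItem {m n : ℕ} (x : ℕ) : Fin m ⊕ Fin n → Prop
  | .inl i => (i : ℕ) = x
  | .inr _ => False

/-! ### Breadth first search as a program. -/

namespace Ram

/-- The levels in the memory. -/
def levOf (m n : ℕ) (h : Mem) : Fin m ⊕ Fin n → ℕ :=
  Sum.elim (fun i => h.I .lev i) (fun j => h.I .levp j)

theorem levOf_setI_lev {m n : ℕ} (h : Mem) (i : Fin m) (x : ℕ) :
    levOf m n (h.setI .lev i x) = Function.update (levOf m n h) (.inl i) x := by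
  ext v
  rcases v with v | v
  · simp [levOf, Function.update_apply, Fin.ext_iff]
  · simp [levOf]

theorem levOf_setI_levp {m n : ℕ} (h : Mem) (j : Fin n) (x : ℕ) :
    levOf m n (h.setI .levp j x) = Function.update (levOf m n h) (.inr j) x := by
  ext v
  rcases v with v | v
  · simp [levOf]
  · simp [levOf, Function.update_apply, Fin.ext_iff]

theorem levOf_congr {m n : ℕ} {g h : Mem} (h1 : g.I .lev = h.I .lev) (h2 : g.I .levp = h.I .levp) :
    levOf m n g = levOf m n h := by
  simp [levOf, h1, h2]

/-- The first part of the step of breadth first search for one pair. -/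
def bfsStepPlayer : Prog :=
  .ite (.and (eqTest (.rd .lev (sc .i)) (sc .cur)) (eqTest (.rd .levp (sc .j)) (.const 0)))
    (.setI .levp (sc .j) (.add (sc .cur) (sc .unit))) .skip

/-- The second part of the step of breadth first search for one pair. -/
def bfsStepItem : Prog :=
  .ite (.and (eqTest (.rd .levp (sc .j)) (sc .cur)) (eqTest (.rd .lev (sc .i)) (.const 0)))
    (.setI .lev (sc .i) (.add (sc .cur) (sc .unit))) .skip

/-- The step of breadth first search for one pair. -/
def bfsStep : Prog := .ite adjTest (bfsStepPlayer ;; bfsStepItem) .skip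

/-- Only zero levels change, and only to `cur + unit`. The second and third conclusions therefore
keep the pairs settled that were looked at earlier in the round; the fourth settles the current
pair. -/
theorem bfsStep_spec {m n : ℕ} {h : Mem} {root : Fin m ⊕ Fin n → Prop} (i : Fin m) (j : Fin n)
    (hi : h.I .i 0 = i) (hj : h.I .j 0 = j) (hB : 0 < h.I .unit 0) (hc : 0 < h.I .cur 0)
    (hP : PartialLevels (h.I .unit 0) (adjV (AdjM h)) root (h.I .cur 0) (levOf m n h)) :
    PartialLevels (h.I .unit 0) (adjV (AdjM h)) root (h.I .cur 0) (levOf m n (bfsStep.eval h)) ∧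
    (∀ v, levOf m n h v ≠ 0 → levOf m n (bfsStep.eval h) v = levOf m n h v) ∧
    (∀ v, levOf m n (bfsStep.eval h) v = h.I .cur 0 → levOf m n h v = h.I .cur 0) ∧
    (AdjM h i j →
      (levOf m n (bfsStep.eval h) (.inl i) = h.I .cur 0 →
        levOf m n (bfsStep.eval h) (.inr j) ≠ 0) ∧
      (levOf m n (bfsStep.eval h) (.inr j) = h.I .cur 0 →
        levOf m n (bfsStep.eval h) (.inl i) ≠ 0)) := by
  by_cases ha : AdjM h i j
  swap
  · have : bfsStep.eval h = h := by
      rw [bfsStep, Prog.eval_ite_neg (by rw [adjTest_holds, hi, hj]; exact ha), Prog.eval_skip]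
    rw [this]
    exact ⟨hP, fun _ _ => rfl, fun _ h => h, fun h' => absurd h' ha⟩
  have hlevi : h.I .lev i = levOf m n h (.inl i) := rfl
  have hlevj : h.I .levp j = levOf m n h (.inr j) := rfl
  rw [bfsStep, Prog.eval_ite_pos (by rw [adjTest_holds, hi, hj]; exact ha), Prog.eval_seq]
  by_cases h1 : levOf m n h (.inl i) = h.I .cur 0 ∧ levOf m n h (.inr j) = 0
  · rw [bfsStepPlayer, Prog.eval_ite_pos
      (by simpa only [BE.Holds, eqTest_holds, IE.eval, hi, hj, hlevi, hlevj] using h1)]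
    rw [bfsStepItem, Prog.eval_ite_neg]
    · simp only [Prog.eval_setI, Prog.eval_skip, IE.eval, hj, levOf_setI_levp]
      refine ⟨hP.update hB hc (v := .inl i) (w := .inr j) ha h1.1 h1.2,
        fun v hv => ?_, fun v hv => ?_,
        fun _ => ⟨fun _ => by simp; omega, fun h2 => ?_⟩⟩
      · have : v ≠ .inr j := by rintro rfl; exact hv h1.2
        rw [Function.update_of_ne this]
      · by_cases e : v = .inr j
        · subst e; simp at hv; omega
        · rwa [Function.update_of_ne e] at hv
      · simp at h2; omega
    · simp [hi, hj]; omega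
  · rw [bfsStepPlayer, Prog.eval_ite_neg
      (by simpa only [BE.Holds, eqTest_holds, IE.eval, hi, hj, hlevi, hlevj] using h1),
      Prog.eval_skip]
    by_cases h2 : levOf m n h (.inr j) = h.I .cur 0 ∧ levOf m n h (.inl i) = 0
    · rw [bfsStepItem, Prog.eval_ite_pos
        (by simpa only [BE.Holds, eqTest_holds, IE.eval, hi, hj, hlevi, hlevj] using h2)]
      simp only [Prog.eval_setI, IE.eval, hi, levOf_setI_lev]
      refine ⟨hP.update hB hc (v := .inr j) (w := .inl i) ha h2.1 h2.2,
        fun v hv => ?_, fun v hv => ?_,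
        fun _ => ⟨fun h3 => ?_, fun _ => by simp; omega⟩⟩
      · have : v ≠ .inl i := by rintro rfl; exact hv h2.2
        rw [Function.update_of_ne this]
      · by_cases e : v = .inl i
        · subst e; simp at hv; omega
        · rwa [Function.update_of_ne e] at hv
      · simp at h3; omega
    · rw [bfsStepItem, Prog.eval_ite_neg
        (by simpa only [BE.Holds, eqTest_holds, IE.eval, hi, hj, hlevi, hlevj] using h2),
        Prog.eval_skip]
      refine ⟨hP, fun _ _ => rfl, fun _ h => h, fun _ => ⟨fun h3 h4 => h1 ⟨h3, h4⟩,
        fun h3 h4 => h2 ⟨h3, h4⟩⟩⟩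

/-- The invariant of a round: the pairs satisfying `S` have been looked at. -/
def RoundInv (m n : ℕ) (h : Mem) (root : Fin m ⊕ Fin n → Prop) (S : ℕ → ℕ → Prop) (g : Mem) :
    Prop :=
  PartialLevels (h.I .unit 0) (adjV (AdjM h)) root (h.I .cur 0) (levOf m n g) ∧
  ∀ (i : Fin m) (j : Fin n), S i j → AdjM h i j →
    (levOf m n g (.inl i) = h.I .cur 0 → levOf m n g (.inr j) ≠ 0) ∧
    (levOf m n g (.inr j) = h.I .cur 0 → levOf m n g (.inl i) ≠ 0)

theorem bfsRound_spec {m n : ℕ} {h : Mem} {root : Fin m ⊕ Fin n → Prop}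
    (hm : h.I .m 0 = m) (hn : h.I .n 0 = n) (hB : 0 < h.I .unit 0) (hc : 0 < h.I .cur 0)
    (hP : PartialLevels (h.I .unit 0) (adjV (AdjM h)) root (h.I .cur 0) (levOf m n h)) :
    PartialLevels (h.I .unit 0) (adjV (AdjM h)) root (h.I .cur 0 + h.I .unit 0)
      (levOf m n (bfsRound.eval h)) := by
  have key : RoundInv m n h root (fun i _ => i < h.I .m 0) (bfsRound.eval h) := by
    refine Prog.loop_inv (v := .i) (b := .m) (p := .loop .j .n bfsStep) (h := h)
      (fun r g => RoundInv m n h root (fun i _ => i < r) g)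
      ⟨by rwa [levOf_congr (h := h) (by simp) (by simp)], by simp⟩ ?_
    rintro r hr g hgi hs hI
    have hin := Prog.loop_inv (v := .j) (b := .n) (p := bfsStep) (h := g)
      (fun l f => RoundInv m n h root (fun i j => i < r ∨ i = r ∧ j < l) f)
      (by
        refine ⟨by rw [levOf_congr (h := g) (by simp) (by simp)]; exact hI.1,
          fun i j hij ha => ?_⟩
        rw [levOf_congr (h := g) (by simp) (by simp)]
        exact hI.2 i j (by simpa using hij) ha)
      (by
        rintro l hl f hfj hs' ⟨hf1, hf2⟩
        have hgn : g.I .n 0 = n := by rw [hs.I (by simp [bfsStep, bfsStepPlayer, bfsStepItem]), hn]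
        have hfi : f.I .i 0 = r := by
          rw [hs'.I (by simp [bfsStep, bfsStepPlayer, bfsStepItem]), hgi]
        have hfu : f.I .unit 0 = h.I .unit 0 := by
          rw [hs'.I (by simp [bfsStep, bfsStepPlayer, bfsStepItem]),
            hs.I (by simp [bfsStep, bfsStepPlayer, bfsStepItem])]
        have hfc : f.I .cur 0 = h.I .cur 0 := by
          rw [hs'.I (by simp [bfsStep, bfsStepPlayer, bfsStepItem]),
            hs.I (by simp [bfsStep, bfsStepPlayer, bfsStepItem])]
        have hadj : AdjM f = AdjM h := by
          ext i j
          refine AdjM_congr ?_ ?_ i j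
          · rw [hs'.I (by simp [bfsStep, bfsStepPlayer, bfsStepItem]),
              hs.I (by simp [bfsStep, bfsStepPlayer, bfsStepItem])]
          · rw [hs'.I (by simp [bfsStep, bfsStepPlayer, bfsStepItem]),
              hs.I (by simp [bfsStep, bfsStepPlayer, bfsStepItem])]
        obtain ⟨i0, hi0⟩ : ∃ i0 : Fin m, (i0 : ℕ) = r := ⟨⟨r, by omega⟩, rfl⟩
        obtain ⟨j0, hj0⟩ : ∃ j0 : Fin n, (j0 : ℕ) = l := ⟨⟨l, by omega⟩, rfl⟩
        have := bfsStep_spec (root := root) (h := f) i0 j0 (hfi.trans hi0.symm)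
          (hfj.trans hj0.symm)
          (by rwa [hfu]) (by rwa [hfc]) (by rwa [hfu, hfc, hadj])
        rw [hfu, hfc, hadj] at this
        obtain ⟨t1, t2, t3, t4⟩ := this
        have e : levOf m n ((bfsStep.eval f).setI .j 0 (l + 1)) = levOf m n (bfsStep.eval f) :=
          levOf_congr (by simp) (by simp)
        refine ⟨by rwa [e], fun i j hij ha => ?_⟩
        rw [e]
        by_cases hnew : i.val = r ∧ j.val = l
        · obtain rfl : i = i0 := Fin.ext (hnew.1.trans hi0.symm)
          obtain rfl : j = j0 := Fin.ext (hnew.2.trans hj0.symm)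
          exact t4 ha
        · obtain ⟨o1, o2⟩ := hf2 i j (by omega) ha
          refine ⟨fun h3 => ?_, fun h3 => ?_⟩
          · have := o1 (t3 _ h3)
            rwa [t2 _ this]
          · have := o2 (t3 _ h3)
            rwa [t2 _ this])
    obtain ⟨k1, k2⟩ := hin
    have e : levOf m n ((Prog.eval (.loop .j .n bfsStep) g).setI .i 0 (r + 1)) =
        levOf m n (Prog.eval (.loop .j .n bfsStep) g) := levOf_congr (by simp) (by simp)
    refine ⟨by rwa [e], fun i j hij ha => ?_⟩
    rw [e]
    refine k2 i j ?_ ha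
    have hgn : g.I .n 0 = n := by rw [hs.I (by simp [bfsStep, bfsStepPlayer, bfsStepItem]), hn]
    have := j.2
    simp only at hij
    omega
  obtain ⟨k1, k2⟩ := key
  refine k1.next ?_
  rintro (i | j) (i' | j') hvw hv
  · exact hvw.elim
  · exact (k2 i j' (by rw [hm]; exact i.2) hvw).1 hv
  · exact (k2 i' j (by rw [hm]; exact i'.2) hvw).2 hv
  · exact hvw.elim

/-- The first digit of the guess may be `m`, which is no item. Then there is no root, and all levels
of items and players stay 0. -/
theorem bfsProg_spec {m n E : ℕ} {h : Mem}
    (hm : h.I .m 0 = m) (hn : h.I .n 0 = n) (hb : h.I .b 0 = m + 1) (hB : 0 < h.I .unit 0)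
    (hr : h.I .rounds 0 = m + n + 1) :
    Levels (h.I .unit 0) (adjV (AdjM h)) (isItem (h.I .dig ((E + 1) * h.I .g 0)))
      (levOf m n ((bfsProg E).eval h)) := by
  classical
  have clearLev : ∀ g : Mem, ∀ i < g.I .b 0,
      ((Prog.loop .i .b (.setI .lev (sc .i) (.const 0))).eval g).I .lev i = 0 := fun g => by
    refine Prog.loop_inv (v := .i) (b := .b) (p := .setI .lev (sc .i) (.const 0)) (h := g)
      (fun r f => ∀ i < r, f.I .lev i = 0) (by simp) ?_
    intro r _ f hf _ hI i hi
    simp only [Prog.eval_setI, Mem.setI_I, reduceCtorEq, if_false, if_true, IE.eval, hf,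
      Function.update_apply]
    split_ifs with e
    · rfl
    · exact hI i (by omega)
  have clearLevp : ∀ g : Mem, ∀ i < g.I .n 0,
      ((Prog.loop .j .n (.setI .levp (sc .j) (.const 0))).eval g).I .levp i = 0 := fun g => by
    refine Prog.loop_inv (v := .j) (b := .n) (p := .setI .levp (sc .j) (.const 0)) (h := g)
      (fun r f => ∀ i < r, f.I .levp i = 0) (by simp) ?_
    intro r _ f hf _ hI i hi
    simp only [Prog.eval_setI, Mem.setI_I, reduceCtorEq, if_false, if_true, IE.eval, hf,
      Function.update_apply]
    split_ifs with e
    · rfl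
    · exact hI i (by omega)
  set B := h.I .unit 0 with hBdef
  set x := h.I .dig ((E + 1) * h.I .g 0) with hx
  set initProg : Prog := .loop .i .b (.setI .lev (sc .i) (.const 0)) ;;
    .loop .j .n (.setI .levp (sc .j) (.const 0)) ;;
    .setI .lev (digAt E (sc .g) (.const 0)) (sc .unit) ;;
    .setI .cur (.const 0) (sc .unit) with hinit
  set h1 := initProg.eval h with hh1
  have hsame : ∀ a, ¬ initProg.ModI a → h1.I a = h.I a := fun a ha => Prog.eval_I ha _
  have hlev : ∀ v, levOf m n h1 v = if isItem x v then B else 0 := by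
    have hg : ∀ f : Mem, ((Prog.loop .i .b (.setI .lev (sc .i) (.const 0)) ;;
        .loop .j .n (.setI .levp (sc .j) (.const 0))).eval f).I .unit = f.I .unit :=
      fun f => Prog.eval_I (by simp) _
    rintro (i | j)
    · have e1 := clearLev h i (by rw [hb]; have := i.2; omega)
      have e2 : ((Prog.loop .j .n (.setI .levp (sc .j) (.const 0))).eval
        ((Prog.loop .i .b (.setI .lev (sc .i) (.const 0))).eval h)).I .lev =
          ((Prog.loop .i .b (.setI .lev (sc .i) (.const 0))).eval h).I .lev :=
        Prog.eval_I (by simp) _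
      have e3 : ∀ a, a ≠ .i → a ≠ .j → a ≠ .lev → a ≠ .levp →
        ((Prog.loop .j .n (.setI .levp (sc .j) (.const 0))).eval
          ((Prog.loop .i .b (.setI .lev (sc .i) (.const 0))).eval h)).I a = h.I a :=
        fun a h1 h2 h3 h4 => by
          rw [Prog.eval_I (by simp [h2, h4]), Prog.eval_I (by simp [h1, h3])]
      simp only [hh1, hinit, Prog.eval_seq, Prog.eval_setI, levOf, Sum.elim_inl, Mem.setI_I,
        reduceCtorEq, if_false, if_true, IE.eval, IE.eval_mul, isItem, e2, Function.update_apply,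
        e1, e3 .dig (by simp) (by simp) (by simp) (by simp), e3 .g (by simp) (by simp) (by simp)
        (by simp), e3 .unit (by simp) (by simp) (by simp) (by simp), add_zero, hx]
      rfl
    · have e1 := clearLevp ((Prog.loop .i .b (.setI .lev (sc .i) (.const 0))).eval h) j
        (by rw [Prog.eval_I (by simp), hn]; exact j.2)
      simp [hh1, hinit, levOf, isItem, e1]
  have hcur : h1.I .cur 0 = B := by
    have : ((Prog.loop .j .n (.setI .levp (sc .j) (.const 0))).eval
        ((Prog.loop .i .b (.setI .lev (sc .i) (.const 0))).eval h)).I .unit 0 = B := by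
      rw [Prog.eval_I (by simp), Prog.eval_I (by simp)]
    simp [hh1, hinit, this]
  have start : PartialLevels B (adjV (AdjM h)) (isItem x) B (levOf m n h1) := by
    refine ⟨fun v hv => by simp [hlev, hv], fun v hv hr => absurd (by simp [hlev, hr]) hv,
      fun v w _ hv hvB => ?_, fun v => .inl ?_⟩
    · rw [hlev] at hv hvB
      split_ifs at hv hvB
      · omega
      · exact absurd rfl hv
    · rw [hlev]; split_ifs <;> omega
  have main := Prog.loop_inv (v := .r) (b := .rounds)
    (p := bfsRound ;; .setI .cur (.const 0) (.add (sc .cur) (sc .unit))) (h := h1)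
    (fun r g => g.I .cur 0 = B * (r + 1) ∧
      PartialLevels B (adjV (AdjM h)) (isItem x) (B * (r + 1)) (levOf m n g))
    (by
      refine ⟨by simp [hcur], ?_⟩
      rw [levOf_congr (h := h1) (by simp) (by simp)]
      simpa using start)
    (by
      rintro r - g - hs ⟨hg1, hg2⟩
      have hI : ∀ a, ¬ (initProg.ModI a ∨ a = .r ∨ bfsRound.ModI a ∨ a = .cur) →
          g.I a = h.I a := fun a ha => by
        push Not at ha
        rw [hs.I (by simp [ha]), hsame a ha.1]
      have hgu : g.I .unit 0 = B := by rw [hI .unit (by simp [hinit, bfsRound])]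
      have hadj : AdjM g = AdjM h := by
        ext i j
        exact AdjM_congr (hI .inp (by simp [hinit, bfsRound]))
          (hI .rown (by simp [hinit, bfsRound])) i j
      have := bfsRound_spec (m := m) (n := n) (h := g) (root := isItem x)
        (by rw [hI .m (by simp [hinit, bfsRound]), hm])
        (by rw [hI .n (by simp [hinit, bfsRound]), hn])
        (by rwa [hgu]) (by rw [hg1]; positivity) (by rwa [hgu, hg1, hadj])
      have e1 : (bfsRound.eval g).I .cur 0 = B * (r + 1) := by
        rw [Prog.eval_I (by simp [bfsRound]), hg1]
      have e2 : (bfsRound.eval g).I .unit 0 = B := by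
        rw [Prog.eval_I (by simp [bfsRound]), hgu]
      refine ⟨by simp [e1, e2]; ring, ?_⟩
      rw [levOf_congr (h := bfsRound.eval g) (by simp) (by simp)]
      rw [hgu, hg1, hadj] at this
      rw [show B * (r + 1 + 1) = B * (r + 1) + B by ring]
      exact this)
  have hrr : h1.I .rounds 0 = m + n + 1 := by rw [hsame _ (by simp [hinit]), hr]
  rw [hrr] at main
  have e : (bfsProg E).eval h = (Prog.loop .r .rounds
    (bfsRound ;; .setI .cur (.const 0) (.add (sc .cur) (sc .unit)))).eval h1 := rfl
  rw [e]
  -- The search has run through level `B * (m + n + 1)`, while there are only `m + n` vertices.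
  refine main.2.levels hB ?_
  simp only [Fintype.card_sum, Fintype.card_fin]
  nlinarith

/-! ### Keys and classes -/

open Classical in
/-- The contribution of a vertex of level `b` to the key of a vertex of level `a`. -/
noncomputable def keyTerm (adj : Prop) (a b : ℕ) : ℕ := if adj then if b ≤ a then 0 else 2 else 1

/-- The inner loop of the computation of an item key. -/
def itemKeyRow : Prog :=
  .loop .j .n (.ite adjTest
      (.ite (.ile (.rd .levp (sc .j)) (.rd .lev (sc .i))) .skip
        (.setI .t (.const 0) (.add (sc .t) (.const 2))))
      (.setI .t (.const 0) (.add (sc .t) (.const 1))))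

/-- The inner loop of the computation of a player key. -/
def playerKeyRow : Prog :=
  .loop .i .m (.ite adjTest
      (.ite (.ile (.rd .lev (sc .i)) (.rd .levp (sc .j))) .skip
        (.setI .t (.const 0) (.add (sc .t) (.const 2))))
      (.setI .t (.const 0) (.add (sc .t) (.const 1))))

theorem keyStep_spec (h : Mem) (x y : IE) :
    ((Prog.ite adjTest (.ite (.ile y x) .skip (.setI .t (.const 0) (.add (sc .t) (.const 2))))
      (.setI .t (.const 0) (.add (sc .t) (.const 1)))).eval h).I .t 0 =
      h.I .t 0 + keyTerm (AdjM h (h.I .i 0) (h.I .j 0)) (x.eval h) (y.eval h) := by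
  by_cases h1 : AdjM h (h.I .i 0) (h.I .j 0)
  · rw [Prog.eval_ite_pos (by rwa [adjTest_holds])]
    by_cases h2 : y.eval h ≤ x.eval h
    · rw [Prog.eval_ite_pos (by simpa using h2)]
      simp [keyTerm, h1, h2]
    · rw [Prog.eval_ite_neg (by simpa using h2)]
      simp [keyTerm, h1, h2]
  · rw [Prog.eval_ite_neg (by rwa [adjTest_holds])]
    simp [keyTerm, h1]

theorem itemKeyRow_spec (h : Mem) :
    (itemKeyRow.eval h).I .t 0 = h.I .t 0 + ∑ j ∈ range (h.I .n 0),
      keyTerm (AdjM h (h.I .i 0) j) (h.I .lev (h.I .i 0)) (h.I .levp j) := by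
  refine Prog.loop_inv (v := .j) (b := .n) (p := .ite adjTest
      (.ite (.ile (.rd .levp (sc .j)) (.rd .lev (sc .i))) .skip
        (.setI .t (.const 0) (.add (sc .t) (.const 2))))
      (.setI .t (.const 0) (.add (sc .t) (.const 1)))) (h := h)
    (fun r g => g.I .t 0 = h.I .t 0 + ∑ j ∈ range r,
      keyTerm (AdjM h (h.I .i 0) j) (h.I .lev (h.I .i 0)) (h.I .levp j)) (by simp) ?_
  intro r _ g hj hs hI
  rw [Mem.setI_I, if_neg (by simp), keyStep_spec, AdjM_congr (hs.I (by simp)) (hs.I (by simp))]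
  simp only [IE.eval]
  rw [hs.I (a := .i) (by simp), hs.I (a := .lev) (by simp), hs.I (a := .levp) (by simp), hj, hI,
    sum_range_succ, add_assoc]

theorem playerKeyRow_spec (h : Mem) :
    (playerKeyRow.eval h).I .t 0 = h.I .t 0 + ∑ i ∈ range (h.I .m 0),
      keyTerm (AdjM h i (h.I .j 0)) (h.I .levp (h.I .j 0)) (h.I .lev i) := by
  refine Prog.loop_inv (v := .i) (b := .m) (p := .ite adjTest
      (.ite (.ile (.rd .lev (sc .i)) (.rd .levp (sc .j))) .skip
        (.setI .t (.const 0) (.add (sc .t) (.const 2))))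
      (.setI .t (.const 0) (.add (sc .t) (.const 1)))) (h := h)
    (fun r g => g.I .t 0 = h.I .t 0 + ∑ i ∈ range r,
      keyTerm (AdjM h i (h.I .j 0)) (h.I .levp (h.I .j 0)) (h.I .lev i)) (by simp) ?_
  intro r _ g hj hs hI
  rw [Mem.setI_I, if_neg (by simp), keyStep_spec, AdjM_congr (hs.I (by simp)) (hs.I (by simp))]
  simp only [IE.eval]
  rw [hs.I (a := .j) (by simp), hs.I (a := .lev) (by simp), hs.I (a := .levp) (by simp), hj, hI,
    sum_range_succ, add_assoc]

/-- The index `m` again stands for no item. Its key 0 is below the key of every reached item, which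
is at least its level, so the digit `m` describes an empty prefix. -/
theorem itemKeyProg_spec (h : Mem) :
    (itemKeyProg.eval h).I .key (h.I .m 0) = 0 ∧ ∀ i < h.I .m 0,
      (itemKeyProg.eval h).I .key i = h.I .lev i + ∑ j ∈ range (h.I .n 0),
        keyTerm (AdjM h i j) (h.I .lev i) (h.I .levp j) := by
  have := Prog.loop_inv (v := .i) (b := .m) (p :=
    .setI .t (.const 0) (.rd .lev (sc .i)) ;; itemKeyRow ;; .setI .key (sc .i) (sc .t)) (h := h)
    (fun r g => ∀ i < r, g.I .key i = h.I .lev i + ∑ j ∈ range (h.I .n 0),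
        keyTerm (AdjM h i j) (h.I .lev i) (h.I .levp j)) (by simp) (by
      intro r hr g hg hs hI i hi
      have hsp := itemKeyRow_spec (g.setI .t 0 (g.I .lev r))
      simp only [Mem.setI_I, reduceCtorEq, if_false, if_true, Function.update_self, hg] at hsp
      have hadj : ∀ j, AdjM (g.setI .t 0 (g.I .lev r)) r j ↔ AdjM h r j := fun j => by
        refine AdjM_congr ?_ ?_ _ _
        · simp [hs.I (a := .inp) (by simp [itemKeyRow])]
        · simp [hs.I (a := .rown) (by simp [itemKeyRow])]
      have hk : ∀ f : Mem, (itemKeyRow.eval f).I .key = f.I .key :=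
        fun f => Prog.eval_I (by simp [itemKeyRow]) f
      have hi' : ∀ f : Mem, (itemKeyRow.eval f).I .i = f.I .i :=
        fun f => Prog.eval_I (by simp [itemKeyRow]) f
      simp only [hadj] at hsp
      simp only [hs.I (a := .lev) (by simp [itemKeyRow]),
        hs.I (a := .levp) (by simp [itemKeyRow]), hs.I (a := .n) (by simp [itemKeyRow])] at hsp
      simp only [Prog.eval_seq, Prog.eval_setI, Mem.setI_I, IE.eval, reduceCtorEq, if_false,
        if_true, hk, hi', hg, hs.I (a := .lev) (by simp [itemKeyRow]), hsp, Function.update_apply]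
      split_ifs with e
      · rw [e]
      · exact hI i (by omega))
  have hm : ((Prog.loop .i .m (.setI .t (.const 0) (.rd .lev (sc .i)) ;; itemKeyRow ;;
    .setI .key (sc .i) (sc .t))).eval h).I .m = h.I .m := Prog.eval_I (by simp [itemKeyRow]) h
  have e : itemKeyProg = (.loop .i .m (.setI .t (.const 0) (.rd .lev (sc .i)) ;; itemKeyRow ;;
    .setI .key (sc .i) (sc .t))) ;; .setI .key (sc .m) (.const 0) := rfl
  rw [e]
  simp only [Prog.eval_seq, Prog.eval_setI, Mem.setI_I, if_true, IE.eval, hm, Function.update_self,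
    true_and]
  intro i hi
  rw [Function.update_of_ne hi.ne]
  exact this i hi

theorem playerKeyProg_spec (h : Mem) :
    ∀ j < h.I .n 0,
      (playerKeyProg.eval h).I .keyp j = h.I .levp j + ∑ i ∈ range (h.I .m 0),
        keyTerm (AdjM h i j) (h.I .levp j) (h.I .lev i) := by
  refine Prog.loop_inv (v := .j) (b := .n) (p :=
    .setI .t (.const 0) (.rd .levp (sc .j)) ;; playerKeyRow ;; .setI .keyp (sc .j) (sc .t)) (h := h)
    (fun r g => ∀ j < r, g.I .keyp j = h.I .levp j + ∑ i ∈ range (h.I .m 0),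
        keyTerm (AdjM h i j) (h.I .levp j) (h.I .lev i)) (by simp) ?_
  intro r hr g hg hs hI j hj
  have hsp := playerKeyRow_spec (g.setI .t 0 (g.I .levp r))
  simp only [Mem.setI_I, reduceCtorEq, if_false, if_true, Function.update_self, hg] at hsp
  have hadj : ∀ i, AdjM (g.setI .t 0 (g.I .levp r)) i r ↔ AdjM h i r := fun i => by
    refine AdjM_congr ?_ ?_ _ _
    · simp [hs.I (a := .inp) (by simp [playerKeyRow])]
    · simp [hs.I (a := .rown) (by simp [playerKeyRow])]
  have hk : ∀ f : Mem, (playerKeyRow.eval f).I .keyp = f.I .keyp :=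
    fun f => Prog.eval_I (by simp [playerKeyRow]) f
  have hi' : ∀ f : Mem, (playerKeyRow.eval f).I .j = f.I .j :=
    fun f => Prog.eval_I (by simp [playerKeyRow]) f
  simp only [hadj] at hsp
  simp only [hs.I (a := .lev) (by simp [playerKeyRow]),
    hs.I (a := .levp) (by simp [playerKeyRow]), hs.I (a := .m) (by simp [playerKeyRow])] at hsp
  simp only [Prog.eval_seq, Prog.eval_setI, Mem.setI_I, IE.eval, reduceCtorEq, if_false,
    if_true, hk, hi', hg, hs.I (a := .levp) (by simp [playerKeyRow]), hsp, Function.update_apply]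
  split_ifs with e
  · rw [e]
  · exact hI j (by omega)

/-- The inner loop of the computation of a class. -/
def classRow (E : ℕ) : Prog :=
  .loop .c .cls0 (.ite
      (.vle (.rd .val (sc .i))
        (.rd .val (digAt E (sc .g) (.add (sc .c) (.const 1))))) .skip
      (.setI .cls (sc .i) (.add (.rd .cls (sc .i)) (.const 1))))

theorem classRow_spec (E : ℕ) (h : Mem) :
    (∀ l, l ≠ h.I .i 0 → ((classRow E).eval h).I .cls l = h.I .cls l) ∧
    ((classRow E).eval h).I .cls (h.I .i 0) = h.I .cls (h.I .i 0) +
      #{c ∈ range (h.I .cls0 0) | h.V .val (h.I .dig ((E + 1) * h.I .g 0 + (c + 1))) <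
        h.V .val (h.I .i 0)} := by
  refine Prog.loop_inv (v := .c) (b := .cls0) (p := .ite
      (.vle (.rd .val (sc .i))
        (.rd .val (digAt E (sc .g) (.add (sc .c) (.const 1))))) .skip
      (.setI .cls (sc .i) (.add (.rd .cls (sc .i)) (.const 1)))) (h := h)
    (fun r g => (∀ l, l ≠ h.I .i 0 → g.I .cls l = h.I .cls l) ∧
      g.I .cls (h.I .i 0) = h.I .cls (h.I .i 0) +
      #{c ∈ range r | h.V .val (h.I .dig ((E + 1) * h.I .g 0 + (c + 1))) <
        h.V .val (h.I .i 0)}) (by simp) ?_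
  rintro r - g hc hs ⟨h1, h2⟩
  have e1 : g.I .i = h.I .i := hs.I (by simp)
  have e2 : g.I .dig = h.I .dig := hs.I (by simp)
  have e3 : g.V .val = h.V .val := hs.V (by simp)
  have e4 : g.I .g = h.I .g := hs.I (by simp)
  rw [range_add_one, filter_insert]
  by_cases hh : h.V .val (h.I .dig ((E + 1) * h.I .g 0 + (r + 1))) < h.V .val (h.I .i 0)
  · rw [Prog.eval_ite_neg (by simpa [e1, e2, e3, e4, hc] using hh), if_pos hh,
      card_insert_of_notMem (by simp)]
    refine ⟨fun l hl => ?_, ?_⟩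
    · simp [e1, hl, h1 l hl]
    · simp [e1, h2]; ring
  · rw [Prog.eval_ite_pos (by simpa [e1, e2, e3, e4, hc] using hh), if_neg hh]
    exact ⟨fun l hl => by simp [h1 l hl], by simp [h2]⟩

theorem classProg_spec (E : ℕ) (h : Mem) :
    ∀ i < h.I .m 0, ((classProg E).eval h).I .cls i =
      #{c ∈ range (h.I .cls0 0) | h.V .val (h.I .dig ((E + 1) * h.I .g 0 + (c + 1))) <
        h.V .val i} := by
  refine Prog.loop_inv (v := .i) (b := .m)
    (p := .setI .cls (sc .i) (.const 0) ;; classRow E) (h := h)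
    (fun r g => ∀ i < r, g.I .cls i =
      #{c ∈ range (h.I .cls0 0) | h.V .val (h.I .dig ((E + 1) * h.I .g 0 + (c + 1))) <
        h.V .val i}) (by simp) ?_
  intro r hr g hg hs hI i hi
  have hsp := classRow_spec E (g.setI .cls r 0)
  simp only [Mem.setI_I, reduceCtorEq, if_false, if_true, Function.update_self, hg, Mem.setI_V,
    hs.I (a := .cls0) (by simp [classRow]), hs.I (a := .dig) (by simp [classRow]),
    hs.V (a := .val) (by simp [classRow]), hs.I (a := .g) (by simp [classRow])] at hsp
  simp only [Prog.eval_seq, Prog.eval_setI, Mem.setI_I, IE.eval, reduceCtorEq, if_false, hg]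
  by_cases e : i = r
  · rw [e, hsp.2, zero_add]
  · rw [hsp.1 i e, Function.update_of_ne e]
    exact hI i (by omega)

/-! ### The dynamic program -/

/-- Item `i` belongs to the set of the state `u`. -/
def InState (E : ℕ) (h : Mem) (u i : ℕ) : Prop :=
  1 ≤ h.I .lev i ∧
  ¬ (h.I .key (h.I .dig ((E + 1) * u + h.I .cls i)) ≤ h.I .key i ∧
    ¬ (h.I .key i ≤ h.I .key (h.I .dig ((E + 1) * u + h.I .cls i)) ∧
      i ≤ h.I .dig ((E + 1) * u + h.I .cls i)))

/-- With only `≤`, negation and conjunction available, the double negation expresses the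
lexicographic comparison of the pairs (key, index). In each class a state contains the reached items
up to the one named by its digit for that class. -/
theorem memTest_holds (E : ℕ) (a : IName) (h : Mem) :
    (memTest E a).Holds h ↔ InState E h (h.I a 0) (h.I .i 0) := by
  simp [memTest, InState]

theorem newTest_holds (E : ℕ) (h : Mem) :
    (newTest E).Holds h ↔
      InState E h (h.I .u 0) (h.I .i 0) ∧ ¬ InState E h (h.I .w 0) (h.I .i 0) := by
  simp only [newTest, BE.Holds, memTest_holds]

/-- The arrays that the dynamic program only reads. -/
structure SameData (h g : Mem) : Prop where
  lev : g.I .lev = h.I .lev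
  key : g.I .key = h.I .key
  dig : g.I .dig = h.I .dig
  cls : g.I .cls = h.I .cls
  inp : g.I .inp = h.I .inp
  rown : g.I .rown = h.I .rown
  rowm : g.I .rowm = h.I .rowm
  m : g.I .m 0 = h.I .m 0
  states : g.I .states 0 = h.I .states 0
  val : g.V .val = h.V .val

theorem SameData.inState {E : ℕ} {h g : Mem} (hs : SameData h g) : InState E g = InState E h := by
  ext u i
  simp [InState, hs.lev, hs.key, hs.dig, hs.cls]

theorem SameData.adjM {h g : Mem} (hs : SameData h g) : AdjM g = AdjM h := by
  ext i j
  simp [AdjM, hs.inp, hs.rown]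

theorem SameData.trans {h g f : Mem} (hs : SameData h g) (hs' : SameData g f) : SameData h f :=
  ⟨hs'.lev.trans hs.lev, hs'.key.trans hs.key, hs'.dig.trans hs.dig, hs'.cls.trans hs.cls,
    hs'.inp.trans hs.inp, hs'.rown.trans hs.rown, hs'.rowm.trans hs.rowm, hs'.m.trans hs.m,
    hs'.states.trans hs.states, hs'.val.trans hs.val⟩

/-- The program does not change the arrays that the dynamic program only reads. -/
structure KeepsData (p : Prog) : Prop where
  lev : ¬ p.ModI .lev
  key : ¬ p.ModI .key
  dig : ¬ p.ModI .dig
  cls : ¬ p.ModI .cls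
  inp : ¬ p.ModI .inp
  rown : ¬ p.ModI .rown
  rowm : ¬ p.ModI .rowm
  m : ¬ p.ModI .m
  states : ¬ p.ModI .states
  val : ¬ p.ModV .val

theorem Same.data {p : Prog} {h g : Mem} (hs : Same p h g) (hp : KeepsData p) : SameData h g :=
  ⟨hs.I hp.lev, hs.I hp.key, hs.I hp.dig, hs.I hp.cls, hs.I hp.inp, hs.I hp.rown, hs.I hp.rowm,
    by rw [hs.I hp.m], by rw [hs.I hp.states], hs.V hp.val⟩

theorem SameData.setI {h : Mem} {a : IName} {i x : ℕ}
    (hp : KeepsData (.setI a (.const i) (.const x))) :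
    SameData h (h.setI a i x) :=
  ((Prog.setI a (.const i) (.const x)).same h).data hp

theorem SameData.setV {h : Mem} {a : VName} {i : ℕ} {x : ℚ} (ha : a ≠ .val) :
    SameData h (h.setV a i x) :=
  ((Prog.setV a (.const i) (.const x)).same h).data
    ⟨by simp, by simp, by simp, by simp, by simp, by simp, by simp, by simp, by simp,
      by simpa using ha.symm⟩

/-- Player `j` may get the items of the state `u` that are not in the state `w`. -/
def Legal (E : ℕ) (h : Mem) (w u j : ℕ) : Prop :=
  ∀ i < h.I .m 0, (InState E h u i → ¬ InState E h w i → AdjM h i j) ∧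
    (InState E h w i → InState E h u i)

open Classical in
/-- The value of the items of the state `u` that are not in the state `w`. -/
noncomputable def worth (E : ℕ) (h : Mem) (w u : ℕ) : ℚ :=
  ∑ i ∈ range (h.I .m 0), if InState E h u i ∧ ¬ InState E h w i then h.V .val i else 0

theorem SameData.legal {E : ℕ} {h g : Mem} (hs : SameData h g) : Legal E g = Legal E h := by
  ext w u j
  simp only [Legal, hs.inState, hs.adjM, hs.m]

theorem SameData.worth {E : ℕ} {h g : Mem} (hs : SameData h g) : worth E g = worth E h := by
  ext w u
  refine sum_congr (by rw [hs.m]) fun i _ => ?_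
  have e : (InState E g u i ∧ ¬ InState E g w i) ↔ (InState E h u i ∧ ¬ InState E h w i) := by
    rw [hs.inState]
  by_cases c : InState E h u i ∧ ¬ InState E h w i
  · rw [if_pos c, if_pos (e.2 c), hs.val]
  · rw [if_neg c, if_neg (fun h => c (e.1 h))]

theorem bundleProg_keepsData (E : ℕ) : KeepsData (bundleProg E) := by
  constructor <;> simp [bundleProg]

/-- The flag `ok` is lowered by a new item that is not adjacent to the player, and by an item of `w`
that is missing in `u`. -/
theorem bundleProg_spec (E : ℕ) (h : Mem) :
    (1 ≤ ((bundleProg E).eval h).I .ok 0 ↔ Legal E h (h.I .w 0) (h.I .u 0) (h.I .j 0)) ∧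
    ((bundleProg E).eval h).V .w 0 = worth E h (h.I .w 0) (h.I .u 0) := by
  classical
  set W := h.I .w 0
  set U := h.I .u 0
  set J := h.I .j 0
  refine Prog.loop_inv (v := .i) (b := .m) (p :=
    .ite (newTest E)
      (.setV .w (.const 0) (.add (.rd .w (.const 0)) (.rd .val (sc .i))) ;;
        .ite adjTest .skip (.setI .ok (.const 0) (.const 0)))
      (.ite (.and (memTest E .w) (.not (memTest E .u))) (.setI .ok (.const 0) (.const 0)) .skip))
    (h := (h.setI .ok 0 1).setV .w 0 0)
    (fun r g => (1 ≤ g.I .ok 0 ↔ ∀ i < r, (InState E h U i → ¬ InState E h W i → AdjM h i J) ∧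
      (InState E h W i → InState E h U i)) ∧
      g.V .w 0 = ∑ i ∈ range r, if InState E h U i ∧ ¬ InState E h W i then h.V .val i else 0)
    (by simp) ?_
  rintro r - g hi hs ⟨h1, h2⟩
  have hd : SameData h g :=
    ((SameData.setI (by constructor <;> simp)).trans (SameData.setV (by simp))).trans
      (hs.data (by constructor <;> simp))
  have hu : g.I .u 0 = U := by rw [hs.I (by simp)]; simp [U]
  have hw : g.I .w 0 = W := by rw [hs.I (by simp)]; simp [W]
  have hj : g.I .j 0 = J := by rw [hs.I (by simp)]; simp [J]
  have hforall : ∀ P : ℕ → Prop, (∀ i < r + 1, P i) ↔ (∀ i < r, P i) ∧ P r :=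
    fun P => Nat.forall_lt_succ_right
  rw [hforall, ← h1, sum_range_succ, ← h2]
  by_cases t1 : InState E h U r ∧ ¬ InState E h W r
  · rw [Prog.eval_ite_pos (by rwa [newTest_holds, hi, hu, hw, hd.inState]), if_pos t1]
    by_cases t2 : AdjM h r J
    · rw [Prog.eval_seq, Prog.eval_ite_pos]
      · simp [t1, t2, hi, hd.val]
      · rw [adjTest_holds]
        simpa [hi, hj, AdjM, hd.inp, hd.rown] using t2
    · rw [Prog.eval_seq, Prog.eval_ite_neg]
      · simp [t1, t2, hi, hd.val]
      · rw [adjTest_holds]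
        simpa [hi, hj, AdjM, hd.inp, hd.rown] using t2
  · rw [Prog.eval_ite_neg (by rwa [newTest_holds, hi, hu, hw, hd.inState]), if_neg t1]
    by_cases t2 : InState E h W r ∧ ¬ InState E h U r
    · rw [Prog.eval_ite_pos (b := .and _ _)
        (by simpa only [BE.Holds, memTest_holds, hi, hu, hw, hd.inState] using t2)]
      simp [t2]
    · rw [Prog.eval_ite_neg (b := .and _ _)
        (by simpa only [BE.Holds, memTest_holds, hi, hu, hw, hd.inState] using t2)]
      have : (InState E h U r → ¬ InState E h W r → AdjM h r J) ∧
        (InState E h W r → InState E h U r) := by tauto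
      simp only [Prog.eval_skip, Mem.setI_I, reduceCtorEq, if_false, Mem.setI_V, add_zero,
        and_true, and_iff_left this]

open Classical in
theorem rowProg_spec (E : ℕ) (h : Mem) :
    ∀ l, ((rowProg E).eval h).I .asg' l =
      if h.I .rowm (h.I .u 0) ≤ l ∧ l < h.I .rowm (h.I .u 0) + h.I .m 0 then
        if InState E h (h.I .u 0) (l - h.I .rowm (h.I .u 0)) ∧
          ¬ InState E h (h.I .w 0) (l - h.I .rowm (h.I .u 0)) then h.I .j 0
        else h.I .asg (h.I .rowm (h.I .w 0) + (l - h.I .rowm (h.I .u 0)))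
      else h.I .asg' l := by
  refine Prog.loop_inv (v := .i) (b := .m) (p := .ite (newTest E)
    (.setI .asg' (.add (.rd .rowm (sc .u)) (sc .i)) (sc .j))
    (.setI .asg' (.add (.rd .rowm (sc .u)) (sc .i)) (.rd .asg (.add (.rd .rowm (sc .w)) (sc .i)))))
    (h := h) (fun r g => ∀ l, g.I .asg' l =
      if h.I .rowm (h.I .u 0) ≤ l ∧ l < h.I .rowm (h.I .u 0) + r then
        if InState E h (h.I .u 0) (l - h.I .rowm (h.I .u 0)) ∧
          ¬ InState E h (h.I .w 0) (l - h.I .rowm (h.I .u 0)) then h.I .j 0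
        else h.I .asg (h.I .rowm (h.I .w 0) + (l - h.I .rowm (h.I .u 0)))
      else h.I .asg' l) (by
        intro l
        rw [if_neg (by omega)]; simp) ?_
  intro r hr g hi hs hI l
  have hd : SameData h g := hs.data (by constructor <;> simp)
  have hu : g.I .u 0 = h.I .u 0 := by rw [hs.I (by simp)]
  have hw : g.I .w 0 = h.I .w 0 := by rw [hs.I (by simp)]
  have hj : g.I .j 0 = h.I .j 0 := by rw [hs.I (by simp)]
  have ha : g.I .asg = h.I .asg := hs.I (by simp)
  by_cases e : l = h.I .rowm (h.I .u 0) + r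
  · rw [if_pos (by omega), show l - h.I .rowm (h.I .u 0) = r by omega]
    by_cases t : InState E h (h.I .u 0) r ∧ ¬ InState E h (h.I .w 0) r
    · rw [Prog.eval_ite_pos (by rwa [newTest_holds, hi, hu, hw, hd.inState]), if_pos t]
      simp [hi, hu, hj, hd.rowm, e]
    · rw [Prog.eval_ite_neg (by rwa [newTest_holds, hi, hu, hw, hd.inState]), if_neg t]
      simp [hi, hu, hw, ha, hd.rowm, e]
  · have hI' : g.I .asg' l = if h.I .rowm (h.I .u 0) ≤ l ∧ l < h.I .rowm (h.I .u 0) + (r + 1) then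
        if InState E h (h.I .u 0) (l - h.I .rowm (h.I .u 0)) ∧
          ¬ InState E h (h.I .w 0) (l - h.I .rowm (h.I .u 0)) then h.I .j 0
        else h.I .asg (h.I .rowm (h.I .w 0) + (l - h.I .rowm (h.I .u 0)))
      else h.I .asg' l := by
      rw [hI l]
      by_cases e' : h.I .rowm (h.I .u 0) ≤ l ∧ l < h.I .rowm (h.I .u 0) + r
      · have e2 : h.I .rowm (h.I .u 0) ≤ l ∧ l < h.I .rowm (h.I .u 0) + (r + 1) := by omega
        rw [if_pos e', if_pos e2]
      · have e2 : ¬ (h.I .rowm (h.I .u 0) ≤ l ∧ l < h.I .rowm (h.I .u 0) + (r + 1)) := by omega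
        rw [if_neg e', if_neg e2]
    rw [← hI']
    by_cases t : InState E h (h.I .u 0) r ∧ ¬ InState E h (h.I .w 0) r
    · rw [Prog.eval_ite_pos (by rwa [newTest_holds, hi, hu, hw, hd.inState])]
      simp [hi, hu, hd.rowm, e]
    · rw [Prog.eval_ite_neg (by rwa [newTest_holds, hi, hu, hw, hd.inState])]
      simp [hi, hu, hd.rowm, e]

/-- The transition is worth making. -/
def Improves (E : ℕ) (h : Mem) (w u j : ℕ) (x : ℚ) : Prop :=
  Legal E h w u j ∧ x < min (h.V .V w) (worth E h w u)

open Classical in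
-- The scalar `w` is lowered from the worth of the bundle to the minimum with `V w`, the smallest
-- bundle so far; this is the quantity to be maximized.
theorem transitionProg_spec (E : ℕ) (h : Mem) :
    (((transitionProg E).eval h).V .V' =
      if Improves E h (h.I .w 0) (h.I .u 0) (h.I .j 0) (h.V .V' (h.I .u 0)) then
        Function.update (h.V .V') (h.I .u 0)
          (min (h.V .V (h.I .w 0)) (worth E h (h.I .w 0) (h.I .u 0)))
      else h.V .V') ∧
    ∀ l, ((transitionProg E).eval h).I .asg' l =
      if Improves E h (h.I .w 0) (h.I .u 0) (h.I .j 0) (h.V .V' (h.I .u 0)) ∧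
          h.I .rowm (h.I .u 0) ≤ l ∧ l < h.I .rowm (h.I .u 0) + h.I .m 0 then
        if InState E h (h.I .u 0) (l - h.I .rowm (h.I .u 0)) ∧
          ¬ InState E h (h.I .w 0) (l - h.I .rowm (h.I .u 0)) then h.I .j 0
        else h.I .asg (h.I .rowm (h.I .w 0) + (l - h.I .rowm (h.I .u 0)))
      else h.I .asg' l := by
  obtain ⟨b1, b2⟩ := bundleProg_spec E h
  set p : Prog := .ite (.vle (.rd .w (.const 0)) (.rd .V (sc .w))) .skip
    (.setV .w (.const 0) (.rd .V (sc .w))) with hp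
  set g := p.eval ((bundleProg E).eval h) with hg
  have hsame : ∀ a, ¬ (bundleProg E).ModI a → g.I a = h.I a := fun a ha => by
    rw [hg, Prog.eval_I (by simp [hp]), Prog.eval_I ha]
  have hd : SameData h g :=
    ((Prog.same (bundleProg E) h).data (bundleProg_keepsData E)).trans
      ((Prog.same p _).data (by constructor <;> simp [hp]))
  have hV : g.V .V = h.V .V := by
    rw [hg, Prog.eval_V (by simp [hp]), Prog.eval_V (by simp [bundleProg])]
  have hV' : g.V .V' = h.V .V' := by
    rw [hg, Prog.eval_V (by simp [hp]), Prog.eval_V (by simp [bundleProg])]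
  have hok : (1 ≤ g.I .ok 0) ↔ Legal E h (h.I .w 0) (h.I .u 0) (h.I .j 0) := by
    rw [← b1, hg, Prog.eval_I (by simp [hp])]
  have hw : g.V .w 0 = min (h.V .V (h.I .w 0)) (worth E h (h.I .w 0) (h.I .u 0)) := by
    have e1 : ((bundleProg E).eval h).V .V = h.V .V := Prog.eval_V (by simp [bundleProg]) h
    have e2 : ((bundleProg E).eval h).I .w = h.I .w := Prog.eval_I (by simp [bundleProg]) h
    by_cases hle : worth E h (h.I .w 0) (h.I .u 0) ≤ h.V .V (h.I .w 0)
    · rw [hg, hp, Prog.eval_ite_pos (by simpa [b2, e1, e2] using hle), Prog.eval_skip, b2,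
        min_eq_right hle]
    · rw [hg, hp, Prog.eval_ite_neg (by simpa [b2, e1, e2] using hle), Prog.eval_setV]
      simp [e1, e2, min_eq_left (le_of_not_ge hle)]
  have iu : g.I .u = h.I .u := hsame _ (by simp [bundleProg])
  have iw : g.I .w = h.I .w := hsame _ (by simp [bundleProg])
  have ij : g.I .j = h.I .j := hsame _ (by simp [bundleProg])
  have ia : g.I .asg = h.I .asg := hsame _ (by simp [bundleProg])
  have ia' : g.I .asg' = h.I .asg' := hsame _ (by simp [bundleProg])
  have e : (transitionProg E).eval h =
    (Prog.ite (.and (.ile (.const 1) (sc .ok)) (.not (.vle (.rd .w (.const 0)) (.rd .V' (sc .u)))))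
    (.setV .V' (sc .u) (.rd .w (.const 0)) ;; rowProg E) .skip).eval g := rfl
  rw [e]
  by_cases hc : Improves E h (h.I .w 0) (h.I .u 0) (h.I .j 0) (h.V .V' (h.I .u 0))
  · have hc' := hc
    rw [Improves, ← hok, ← hw] at hc'
    rw [Prog.eval_ite_pos (by simpa [hV', iu] using hc'), if_pos hc]
    have hd' : SameData h (g.setV .V' (g.I .u 0) (g.V .w 0)) := hd.trans (SameData.setV (by simp))
    refine ⟨?_, fun l => ?_⟩
    · rw [Prog.eval_seq, Prog.eval_V (by simp [rowProg])]
      simp [hV', iu, hw]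
    · rw [Prog.eval_seq, Prog.eval_setV]
      simp only [IE.eval, VE.eval]
      rw [rowProg_spec, hd'.rowm, hd'.m, hd'.inState]
      simp only [Mem.setV_I, iu, iw, ij, ia, ia', hc, true_and]
  · have hc' := hc
    rw [Improves, ← hok, ← hw] at hc'
    rw [Prog.eval_ite_neg (by simpa [hV', iu] using hc'), if_neg hc, Prog.eval_skip]
    refine ⟨hV', fun l => ?_⟩
    rw [if_neg (fun h => hc h.1), ia']

/-- `x` and `row` are a value and an assignment that are the best ones that can be obtained for
the state `u` by giving items to player `j`, starting from a state below `K`. -/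
def BestEntry (E : ℕ) (h : Mem) (u j K : ℕ) (x : ℚ) (row : ℕ → ℕ) : Prop :=
  0 ≤ x ∧
  ((x = 0 ∧ ∀ i < h.I .m 0, row i = h.I .asg (h.I .rowm u + i)) ∨
    ∃ w < h.I .states 0, Legal E h w u j ∧ x ≤ h.V .V w ∧ x ≤ worth E h w u ∧
      ∀ i < h.I .m 0, (InState E h u i ∧ ¬ InState E h w i → row i = j) ∧
        (¬ (InState E h u i ∧ ¬ InState E h w i) → row i = h.I .asg (h.I .rowm w + i))) ∧
  ∀ w < K, Legal E h w u j → min (h.V .V w) (worth E h w u) ≤ x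

theorem stateProg_spec (E : ℕ) (h : Mem) :
    BestEntry E h (h.I .u 0) (h.I .j 0) (h.I .states 0) (((stateProg E).eval h).V .V' (h.I .u 0))
      (fun i => ((stateProg E).eval h).I .asg' (h.I .rowm (h.I .u 0) + i)) ∧
    (∀ u, u ≠ h.I .u 0 → ((stateProg E).eval h).V .V' u = h.V .V' u) ∧
    (∀ l, ¬ (h.I .rowm (h.I .u 0) ≤ l ∧ l < h.I .rowm (h.I .u 0) + h.I .m 0) →
      ((stateProg E).eval h).I .asg' l = h.I .asg' l) := by
  set U := h.I .u 0 with hU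
  set J := h.I .j 0 with hJ
  set R := h.I .rowm U with hR
  set cp : Prog := .loop .i .m (.setI .asg' (.add (.rd .rowm (sc .u)) (sc .i))
    (.rd .asg (.add (.rd .rowm (sc .u)) (sc .i)))) with hcp
  set h0 := h.setV .V' U 0 with hh0
  set h1 := cp.eval h0 with hh1
  have hd1 : SameData h h1 :=
    (SameData.setV (by simp)).trans ((Prog.same cp h0).data (by constructor <;> simp [hcp]))
  have hcopy : ∀ l, h1.I .asg' l =
      if R ≤ l ∧ l < R + h.I .m 0 then h.I .asg l else h.I .asg' l := by
    refine Prog.loop_inv (v := .i) (b := .m) (p := .setI .asg' (.add (.rd .rowm (sc .u)) (sc .i))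
      (.rd .asg (.add (.rd .rowm (sc .u)) (sc .i)))) (h := h0)
      (fun r g => ∀ l, g.I .asg' l = if R ≤ l ∧ l < R + r then h.I .asg l else h.I .asg' l)
      (fun l => by rw [if_neg (by omega)]; simp [hh0]) ?_
    intro r hr g hi hs hI l
    have e1 : g.I .rowm = h.I .rowm := by rw [hs.I (by simp)]; simp [hh0]
    have e2 : g.I .u = h.I .u := by rw [hs.I (by simp)]; simp [hh0]
    have e3 : g.I .asg = h.I .asg := by rw [hs.I (by simp)]; simp [hh0]
    simp only [Prog.eval_setI, Mem.setI_I, reduceCtorEq, if_false, if_true, IE.eval, e1, e2, e3, hi,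
      Function.update_apply, hI, ← hU, ← hR]
    by_cases e : l = R + r
    · rw [if_pos e, if_pos (by omega), e]
    · rw [if_neg e]
      by_cases e' : R ≤ l ∧ l < R + r
      · rw [if_pos e', if_pos (by omega)]
      · rw [if_neg e', if_neg (by omega)]
  -- The entry starts with value 0 and the old row of `u`, the first alternative in `BestEntry`;
  -- every improvement replaces value and row together.
  have key := Prog.loop_inv (v := .w) (b := .states) (p := transitionProg E) (h := h1)
    (fun K g => BestEntry E h U J K (g.V .V' U) (fun i => g.I .asg' (R + i)) ∧
      (∀ u, u ≠ U → g.V .V' u = h.V .V' u) ∧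
      (∀ l, ¬ (R ≤ l ∧ l < R + h.I .m 0) → g.I .asg' l = h.I .asg' l))
    (by
      have e1 : h1.V .V' = h0.V .V' := Prog.eval_V (by simp [hcp]) h0
      refine ⟨⟨?_, .inl ⟨?_, fun i hi => ?_⟩, by simp⟩, fun u hu => ?_, fun l hl => ?_⟩
      · simp [e1, hh0]
      · simp [e1, hh0]
      · simp only [Mem.setI_I, reduceCtorEq, if_false]
        rw [hcopy, if_pos (by omega)]
      · simp [e1, hh0, hu]
      · simp only [Mem.setI_I, reduceCtorEq, if_false]
        rw [hcopy, if_neg hl])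
    (by
      classical
      rintro r hr g hw hs ⟨⟨g0, g1, g2⟩, g3, g4⟩
      have hd : SameData h g := hd1.trans
        (hs.data (by constructor <;> simp [transitionProg, bundleProg, rowProg]))
      have hnm : ∀ a, ¬ (Prog.loop .w .states (transitionProg E)).ModI a → ¬ cp.ModI a →
          g.I a = h.I a := fun a ha ha' => by
        rw [hs.I ha, hh1, Prog.eval_I ha']; simp [hh0]
      have iu : g.I .u 0 = U := by
        rw [hnm .u (by simp [transitionProg, bundleProg, rowProg]) (by simp [hcp])]
      have ij : g.I .j 0 = J := by
        rw [hnm .j (by simp [transitionProg, bundleProg, rowProg]) (by simp [hcp])]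
      have ia : g.I .asg = h.I .asg :=
        hnm .asg (by simp [transitionProg, bundleProg, rowProg]) (by simp [hcp])
      have iV : g.V .V = h.V .V := by
        rw [hs.V (by simp [transitionProg, bundleProg, rowProg]), hh1, Prog.eval_V (by simp [hcp])]
        simp [hh0]
      have himp : Improves E g = Improves E h := by
        ext w u j x
        simp only [Improves, hd.legal, hd.worth, iV]
      obtain ⟨t1, t2⟩ := transitionProg_spec E g
      rw [himp, iu, ij, iV, hd.worth, hw] at t1
      rw [himp, iu, ij, hd.inState, hd.rowm, hd.m, hw, ia, ← hR] at t2
      have hrN : r < h.I .states 0 := by rwa [← hd1.states]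
      simp only [Mem.setI_V, Mem.setI_I, reduceCtorEq, if_false]
      by_cases hc : Improves E h r U J (g.V .V' U)
      · rw [if_pos hc] at t1
        rw [t1]
        simp only [hc, true_and] at t2
        refine ⟨⟨?_, .inr ⟨r, hrN, hc.1, ?_, ?_, fun i hi => ?_⟩, fun w hwr hl => ?_⟩,
          fun u hu => ?_, fun l hl => ?_⟩
        · rw [Function.update_self]; exact g0.trans hc.2.le
        · rw [Function.update_self]; exact min_le_left _ _
        · rw [Function.update_self]; exact min_le_right _ _
        · simp only [t2]
          rw [if_pos (by omega), show R + i - R = i by omega]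
          exact ⟨fun hh => if_pos hh, fun hh => if_neg hh⟩
        · rw [Function.update_self]
          by_cases e : w = r
          · rw [e]
          · exact (g2 w (by omega) hl).trans hc.2.le
        · rw [Function.update_of_ne hu, g3 u hu]
        · rw [t2, if_neg hl, g4 l hl]
      · rw [if_neg hc] at t1
        rw [t1]
        have t3 : ((transitionProg E).eval g).I .asg' = g.I .asg' := by
          ext l
          rw [t2, if_neg (fun h => hc h.1)]
        rw [t3]
        refine ⟨⟨g0, g1, fun w hwr hl => ?_⟩, g3, g4⟩
        by_cases e : w = r
        · rw [e] at hl ⊢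
          exact not_lt.1 fun hlt => hc ⟨hl, hlt⟩
        · exact g2 w (by omega) hl)
  rw [hd1.states] at key
  exact key

theorem BestEntry.congr_row {E : ℕ} {h : Mem} {u j K : ℕ} {x : ℚ} {row row' : ℕ → ℕ}
    (hb : BestEntry E h u j K x row) (hrow : ∀ i < h.I .m 0, row' i = row i) :
    BestEntry E h u j K x row' := by
  obtain ⟨h0, h1, h2⟩ := hb
  refine ⟨h0, ?_, h2⟩
  rcases h1 with ⟨hx, h1⟩ | ⟨w, hw, hl, hx, hx', h1⟩
  · exact .inl ⟨hx, fun i hi => (hrow i hi).trans (h1 i hi)⟩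
  · exact .inr ⟨w, hw, hl, hx, hx', fun i hi =>
      ⟨fun t => (hrow i hi).trans ((h1 i hi).1 t), fun t => (hrow i hi).trans ((h1 i hi).2 t)⟩⟩

theorem BestEntry.congr_mem {E : ℕ} {h g : Mem} {u j K : ℕ} {x : ℚ} {row : ℕ → ℕ}
    (hd : SameData h g) (hV : g.V .V = h.V .V) (ha : g.I .asg = h.I .asg)
    (hb : BestEntry E g u j K x row) : BestEntry E h u j K x row := by
  simpa only [BestEntry, hd.legal, hd.worth, hd.inState, hd.m, hd.states, hd.rowm, hV, ha] using hb

/-- The rows of the assignment tables do not overlap. -/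
def RowsOK (h : Mem) : Prop := ∀ u < h.I .states 0, h.I .rowm u = u * h.I .m 0

theorem row_disjoint {m u u' i : ℕ} (hi : i < m) (hu : u ≠ u') :
    ¬ (u * m ≤ u' * m + i ∧ u' * m + i < u * m + m) := by
  rintro ⟨h1, h2⟩
  rcases Nat.lt_or_gt_of_ne hu with h | h
  · have := Nat.mul_le_mul_right m (show u + 1 ≤ u' from h)
    rw [add_mul] at this
    omega
  · have := Nat.mul_le_mul_right m (show u' + 1 ≤ u from h)
    rw [add_mul] at this
    omega

theorem copyProg_spec (h : Mem) (hrows : RowsOK h) : ∀ u < h.I .states 0,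
    (copyProg.eval h).V .V u = h.V .V' u ∧ ∀ i < h.I .m 0,
      (copyProg.eval h).I .asg (h.I .rowm u + i) = h.I .asg' (h.I .rowm u + i) := by
  set cp : Prog := .loop .i .m (.setI .asg (.add (.rd .rowm (sc .u)) (sc .i))
      (.rd .asg' (.add (.rd .rowm (sc .u)) (sc .i)))) with hcp
  have hcopy : ∀ g : Mem, ∀ l, (cp.eval g).I .asg l =
      if g.I .rowm (g.I .u 0) ≤ l ∧ l < g.I .rowm (g.I .u 0) + g.I .m 0 then g.I .asg' l
        else g.I .asg l := fun g => by
    set R := g.I .rowm (g.I .u 0) with hR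
    refine Prog.loop_inv (v := .i) (b := .m) (p := .setI .asg (.add (.rd .rowm (sc .u)) (sc .i))
      (.rd .asg' (.add (.rd .rowm (sc .u)) (sc .i)))) (h := g)
      (fun r f => ∀ l, f.I .asg l = if R ≤ l ∧ l < R + r then g.I .asg' l else g.I .asg l)
      (fun l => by rw [if_neg (by omega)]; simp) ?_
    intro r hr f hi hs hI l
    have e1 : f.I .rowm = g.I .rowm := by rw [hs.I (by simp)]
    have e2 : f.I .u = g.I .u := by rw [hs.I (by simp)]
    have e3 : f.I .asg' = g.I .asg' := by rw [hs.I (by simp)]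
    simp only [Prog.eval_setI, Mem.setI_I, reduceCtorEq, if_false, if_true, IE.eval, e1, e2, e3, hi,
      Function.update_apply, hI, ← hR]
    by_cases e : l = R + r
    · rw [if_pos e, if_pos (by omega), e]
    · rw [if_neg e]
      by_cases e' : R ≤ l ∧ l < R + r
      · rw [if_pos e', if_pos (by omega)]
      · rw [if_neg e', if_neg (by omega)]
  refine Prog.loop_inv (v := .u) (b := .states) (p := .setV .V (sc .u) (.rd .V' (sc .u)) ;; cp)
    (h := h) (fun r g => ∀ u < r, g.V .V u = h.V .V' u ∧ ∀ i < h.I .m 0,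
      g.I .asg (h.I .rowm u + i) = h.I .asg' (h.I .rowm u + i)) (by simp) ?_
  intro r hr g hu hs hI u hur
  have e1 : g.V .V' = h.V .V' := hs.V (by simp [hcp])
  have e2 : g.I .asg' = h.I .asg' := hs.I (by simp [hcp])
  have e3 : g.I .rowm = h.I .rowm := hs.I (by simp [hcp])
  have e4 : g.I .m = h.I .m := hs.I (by simp [hcp])
  have e5 : ∀ f : Mem, (cp.eval f).V .V = f.V .V := fun f => Prog.eval_V (by simp [hcp]) f
  simp only [Prog.eval_seq, Prog.eval_setV, Mem.setI_V, e5, Mem.setV_V, if_true, IE.eval, VE.eval,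
    hu, e1, Mem.setI_I, reduceCtorEq, if_false, hcopy, Mem.setV_I, e2, e3, e4]
  by_cases e : u = r
  · subst e
    refine ⟨by simp, fun i hi => ?_⟩
    rw [if_pos (by omega)]
  · refine ⟨?_, fun i hi => ?_⟩
    · rw [Function.update_of_ne e]; exact (hI u (by omega)).1
    · rw [if_neg]
      · exact (hI u (by omega)).2 i hi
      · rw [hrows r hr, hrows u (by omega)]
        exact row_disjoint hi (Ne.symm e)

/-- Transitions read `V`, `asg` and write `V'`, `asg'`, so all states are updated from the table
before this player; the final copy makes the update simultaneous. -/
theorem playerProg_spec (E : ℕ) (h : Mem) (hrows : RowsOK h) : ∀ u < h.I .states 0,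
    BestEntry E h u (h.I .j 0) (h.I .states 0) (((playerProg E).eval h).V .V u)
      (fun i => ((playerProg E).eval h).I .asg (h.I .rowm u + i)) := by
  have hmod : KeepsData (.loop .u .states (stateProg E)) := by
    constructor <;> simp [stateProg, transitionProg, bundleProg, rowProg]
  have main := Prog.loop_inv (v := .u) (b := .states) (p := stateProg E) (h := h)
    (fun r g => ∀ u < r, BestEntry E h u (h.I .j 0) (h.I .states 0) (g.V .V' u)
      (fun i => g.I .asg' (h.I .rowm u + i))) (by simp) (by
      intro r hr g hu hs hI u hur
      have hd : SameData h g := hs.data hmod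
      have hV : g.V .V = h.V .V := hs.V (by simp [stateProg, transitionProg, bundleProg, rowProg])
      have ha : g.I .asg = h.I .asg :=
        hs.I (by simp [stateProg, transitionProg, bundleProg, rowProg])
      have hj : g.I .j = h.I .j :=
        hs.I (by simp [stateProg, transitionProg, bundleProg, rowProg])
      obtain ⟨s1, s2, s3⟩ := stateProg_spec E g
      rw [hu, hj, hd.states] at s1
      rw [hu] at s2
      rw [hu, hd.m] at s3
      simp only [Mem.setI_V, Mem.setI_I, reduceCtorEq, if_false]
      by_cases e : u = r
      · subst e
        rw [hd.rowm] at s1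
        exact s1.congr_mem hd hV ha
      · rw [s2 u e]
        refine (hI u (by omega)).congr_row fun i hi => ?_
        refine s3 _ ?_
        rw [hd.rowm, hrows r hr, hrows u (by omega)]
        exact row_disjoint hi (Ne.symm e))
  set g := (Prog.loop .u .states (stateProg E)).eval h with hg
  have hd : SameData h g := (Prog.same _ h).data hmod
  intro u hu
  obtain ⟨c1, c2⟩ := copyProg_spec g (fun u hu => by
    rw [hd.rowm, hd.m]; exact hrows u (by rwa [← hd.states])) u (by rwa [hd.states])
  rw [hd.rowm, hd.m] at c2
  rw [playerProg, Prog.eval_seq, ← hg, c1]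
  exact (main u hu).congr_row fun i hi => c2 i hi

/-! ### Soundness of the tables, and why they do as well as a target assignment. -/

open Classical in
/-- The value that player `j` gets from the items in the state `u`. -/
noncomputable def stateValue (E : ℕ) (h : Mem) (u : ℕ) (row : ℕ → ℕ) (j : ℕ) : ℚ :=
  ∑ i ∈ range (h.I .m 0), if InState E h u i ∧ row i = j then h.V .val i else 0

/-- In the assignment `row`, the players satisfying `P` get at least `x` from the items in the
state `u`. -/
structure SoundRow (E : ℕ) (h : Mem) (P : ℕ → Prop) (u : ℕ) (x : ℚ) (row : ℕ → ℕ) : Prop where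
  feasible : ∀ i < h.I .m 0, row i < h.I .n 0 ∧ AdjM h i (row i)
  le : ∀ j < h.I .n 0, P j → x ≤ stateValue E h u row j

/-- An entry with value 0 is sound because values are nonnegative. Otherwise the items of `w` keep
their owners and lie in `u`, so earlier players lose nothing, while `j` owns everything in `u`
outside `w`. -/
theorem SoundRow.step {E : ℕ} {h : Mem} {P : ℕ → Prop} {j u : ℕ} {x : ℚ} {row : ℕ → ℕ}
    {V : ℕ → ℚ} {asg : ℕ → ℕ} (hval : ∀ i < h.I .m 0, 0 ≤ h.V .val i) (hj : j < h.I .n 0)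
    (hsound : ∀ w < h.I .states 0, SoundRow E h P w (V w) (fun i => asg (h.I .rowm w + i)))
    (hu : u < h.I .states 0)
    {g : Mem} (hd : SameData h g) (hV : g.V .V = V) (ha : g.I .asg = asg)
    (hb : BestEntry E g u j (h.I .states 0) x row) :
    SoundRow E h (fun p => P p ∨ p = j) u x row := by
  classical
  subst hV ha
  obtain ⟨-, h1, -⟩ := hb
  rw [hd.legal, hd.worth, hd.inState, hd.m, hd.rowm, hd.states] at h1
  rcases h1 with ⟨rfl, h1⟩ | ⟨w, hw, hl, hx, hx', h1⟩
  · refine ⟨fun i hi => by rw [h1 i hi]; exact (hsound u hu).feasible i hi, fun p hp hP => ?_⟩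
    refine sum_nonneg fun i hi => ?_
    split_ifs
    · exact hval i (mem_range.1 hi)
    · exact le_rfl
  · refine ⟨fun i hi => ?_, fun p hp hP => ?_⟩
    · by_cases t : InState E h u i ∧ ¬ InState E h w i
      · rw [(h1 i hi).1 t]
        exact ⟨hj, (hl i hi).1 t.1 t.2⟩
      · rw [(h1 i hi).2 t]
        exact (hsound w hw).feasible i hi
    · rcases hP with hP | rfl
      · refine hx.trans (((hsound w hw).le p hp hP).trans (sum_le_sum fun i hi => ?_))
        have hi' := mem_range.1 hi
        by_cases t : InState E h w i ∧ g.I .asg (h.I .rowm w + i) = p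
        · have e : row i = p := by rw [(h1 i hi').2 (fun t' => t'.2 t.1), t.2]
          rw [if_pos t, if_pos ⟨(hl i hi').2 t.1, e⟩]
        · rw [if_neg t]
          split_ifs
          · exact hval i hi'
          · exact le_rfl
      · refine hx'.trans (sum_le_sum fun i hi => ?_)
        have hi' := mem_range.1 hi
        by_cases t : InState E h u i ∧ ¬ InState E h w i
        · rw [if_pos t, if_pos ⟨t.1, (h1 i hi').1 t⟩]
        · rw [if_neg t]
          split_ifs
          · exact hval i hi'
          · exact le_rfl

/-- Player `p` is reached, and comes before the position `(k, j)`. -/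
def Before (h : Mem) (k j p : ℕ) : Prop :=
  1 ≤ h.I .levp p ∧ (h.I .keyp p < k ∨ h.I .keyp p = k ∧ p < j)

/-- `A` is an assignment of the reached items that gives at least `τ` to every reached player and
that is compatible with the states. -/
structure Target (E : ℕ) (h : Mem) (A : ℕ → ℕ) (τ : ℝ) : Prop where
  feasible : ∀ i < h.I .m 0, 1 ≤ h.I .lev i → A i < h.I .n 0 ∧ AdjM h i (A i)
  exists_state : ∀ k j, ∃ u < h.I .states 0, ∀ i < h.I .m 0,
    (InState E h u i ↔ 1 ≤ h.I .lev i ∧ Before h k j (A i))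
  le : ∀ p < h.I .n 0, 1 ≤ h.I .levp p →
    τ ≤ ((∑ i ∈ range (h.I .m 0) with 1 ≤ h.I .lev i ∧ A i = p, h.V .val i : ℚ) : ℝ)
  le_total : τ ≤ (h.V .total 0 : ℝ)

/-- The current state of the target assignment has a value of at least `τ`. -/
def Follows (E : ℕ) (h : Mem) (A : ℕ → ℕ) (τ : ℝ) (k j : ℕ) (V : ℕ → ℚ) : Prop :=
  ∃ u < h.I .states 0, (∀ i < h.I .m 0,
    (InState E h u i ↔ 1 ≤ h.I .lev i ∧ Before h k j (A i))) ∧ τ ≤ (V u : ℝ)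

/-- The states of the target before and after `j` differ exactly by the bundle of `j`. So the
transition between them is legal and worth at least `τ`, and `BestEntry` dominates every legal
transition. -/
theorem Follows.step {E : ℕ} {h : Mem} {A : ℕ → ℕ} {τ : ℝ} {k j : ℕ} {V V' : ℕ → ℚ}
    {row : ℕ → ℕ → ℕ} (hA : Target E h A τ) (hf : Follows E h A τ k j V) (hj : j < h.I .n 0)
    (hjr : 1 ≤ h.I .levp j) (hjk : h.I .keyp j = k) {g : Mem} (hd : SameData h g)
    (hV : g.V .V = V)
    (hb : ∀ u < h.I .states 0, BestEntry E g u j (h.I .states 0) (V' u) (row u)) :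
    Follows E h A τ k (j + 1) V' := by
  classical
  subst hV
  obtain ⟨w, hw, hwi, hwV⟩ := hf
  obtain ⟨u, hu, hui⟩ := hA.exists_state k (j + 1)
  refine ⟨u, hu, hui, ?_⟩
  obtain ⟨-, -, h2⟩ := hb u hu
  have h3 := h2 w hw
  rw [hd.legal, hd.worth] at h3
  have hbef : ∀ p, Before h k (j + 1) p ↔ Before h k j p ∨ p = j := by
    intro p
    constructor
    · rintro ⟨h1, h2 | ⟨h2, h3⟩⟩
      · exact .inl ⟨h1, .inl h2⟩
      · by_cases e : p = j
        · exact .inr e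
        · exact .inl ⟨h1, .inr ⟨h2, by omega⟩⟩
    · rintro (⟨h1, h2 | ⟨h2, h3⟩⟩ | rfl)
      · exact ⟨h1, .inl h2⟩
      · exact ⟨h1, .inr ⟨h2, by omega⟩⟩
      · exact ⟨hjr, .inr ⟨hjk, by omega⟩⟩
  have hnb : ¬ Before h k j j := by rintro ⟨-, h2 | ⟨-, h3⟩⟩ <;> omega
  have hnew : ∀ i < h.I .m 0, (InState E h u i ∧ ¬ InState E h w i ↔
      1 ≤ h.I .lev i ∧ A i = j) := by
    intro i hi
    rw [hui i hi, hwi i hi, hbef]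
    constructor
    · rintro ⟨⟨t1, t2⟩, t3⟩
      exact ⟨t1, t2.resolve_left fun t => t3 ⟨t1, t⟩⟩
    · rintro ⟨t1, t2⟩
      exact ⟨⟨t1, .inr t2⟩, fun t => hnb (t2 ▸ t.2)⟩
  have hl : Legal E h w u j := by
    intro i hi
    refine ⟨fun t1 t2 => ?_, fun t => ?_⟩
    · obtain ⟨t3, t4⟩ := (hnew i hi).1 ⟨t1, t2⟩
      exact t4 ▸ (hA.feasible i hi t3).2
    · rw [hui i hi, hbef]
      rw [hwi i hi] at t
      exact ⟨t.1, .inl t.2⟩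
  have h4 : ((min (g.V .V w) (worth E h w u) : ℚ) : ℝ) ≤ V' u := by exact_mod_cast h3 hl
  rw [Rat.cast_min] at h4
  refine le_trans (le_min hwV ?_) h4
  refine (hA.le j hj hjr).trans (le_of_eq ?_)
  congr 1
  rw [worth, sum_filter]
  refine sum_congr rfl fun i hi => ?_
  have := hnew i (mem_range.1 hi)
  by_cases t : 1 ≤ h.I .lev i ∧ A i = j
  · rw [if_pos t, if_pos (this.2 t)]
  · rw [if_neg t, if_neg (fun t' => t (this.1 t'))]

/-- The invariant of the dynamic program. -/
structure TableInv (E : ℕ) (h : Mem) (k j : ℕ) (g : Mem) : Prop where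
  sound : ∀ u < h.I .states 0, SoundRow E h (fun p => p < h.I .n 0 ∧ Before h k j p) u (g.V .V u)
    (fun i => g.I .asg (h.I .rowm u + i))
  follows : ∀ A τ, Target E h A τ → Follows E h A τ k j (g.V .V)

/-- The invariant depends on the position only through the set of players before it. This covers the
positions at which no player is processed. -/
theorem TableInv.congr {E : ℕ} {h : Mem} {k j k' j' : ℕ} {g f : Mem} (hI : TableInv E h k j g)
    (hb : ∀ p < h.I .n 0, Before h k j p ↔ Before h k' j' p)
    (hV : f.V .V = g.V .V) (ha : f.I .asg = g.I .asg) : TableInv E h k' j' f := by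
  constructor
  · intro u hu
    obtain ⟨h1, h2⟩ := hI.sound u hu
    rw [hV, ha]
    exact ⟨h1, fun p hp hP => h2 p hp ⟨hp, (hb p hp).2 hP.2⟩⟩
  · intro A τ hA
    obtain ⟨u, hu, h1, h2⟩ := hI.follows A τ hA
    refine ⟨u, hu, fun i hi => ?_, by rwa [hV]⟩
    rw [h1 i hi]
    refine and_congr_right fun hl => hb _ (hA.feasible i hi hl).1

/-- A counting sort: for each key value all players are scanned, so the reached players are
processed in the lexicographic order of (key, index). -/
theorem dpProg_spec (E : ℕ) (h : Mem) (hrows : RowsOK h)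
    (hval : ∀ i < h.I .m 0, 0 ≤ h.V .val i) (h0 : TableInv E h 0 0 h) :
    TableInv E h (h.I .keys 0) 0 ((dpProg E).eval h) := by
  refine Prog.loop_inv (v := .k) (b := .keys) (p := .loop .j .n (
    .ite (.and (eqTest (.rd .keyp (sc .j)) (sc .k)) (.ile (.const 1) (.rd .levp (sc .j))))
      (playerProg E) .skip)) (h := h) (fun k g => TableInv E h k 0 g)
    (h0.congr (fun p hp => Iff.rfl) (by simp) (by simp)) ?_
  intro k hk g hgk hs hI
  have main := Prog.loop_inv (v := .j) (b := .n) (p :=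
    .ite (.and (eqTest (.rd .keyp (sc .j)) (sc .k)) (.ile (.const 1) (.rd .levp (sc .j))))
      (playerProg E) .skip) (h := g) (fun j f => TableInv E h k j f)
    (hI.congr (fun p hp => Iff.rfl) (by simp) (by simp)) (by
      intro j hj f hfj hs' hI'
      have hd : SameData h f := (hs.data (by constructor <;> simp [playerProg, stateProg,
        transitionProg, bundleProg, rowProg, copyProg])).trans
        (hs'.data (by constructor <;> simp [playerProg, stateProg,
          transitionProg, bundleProg, rowProg, copyProg]))
      have hkeyp : f.I .keyp = h.I .keyp := by
        rw [hs'.I (by simp [playerProg, stateProg, transitionProg, bundleProg, rowProg, copyProg]),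
          hs.I (by simp [playerProg, stateProg, transitionProg, bundleProg, rowProg, copyProg])]
      have hlevp : f.I .levp = h.I .levp := by
        rw [hs'.I (by simp [playerProg, stateProg, transitionProg, bundleProg, rowProg, copyProg]),
          hs.I (by simp [playerProg, stateProg, transitionProg, bundleProg, rowProg, copyProg])]
      have hfk : f.I .k 0 = k := by
        rw [hs'.I (by simp [playerProg, stateProg, transitionProg, bundleProg, rowProg, copyProg]),
          hgk]
      have hjn : j < h.I .n 0 := by
        rwa [hs.I (by simp [playerProg, stateProg, transitionProg, bundleProg, rowProg,
          copyProg])] at hj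
      by_cases hc : h.I .keyp j = k ∧ 1 ≤ h.I .levp j
      · rw [Prog.eval_ite_pos (by simpa [hkeyp, hlevp, hfk, hfj] using hc)]
        have hsp := playerProg_spec E f (fun u hu => by
          rw [hd.rowm, hd.m]; exact hrows u (by rwa [← hd.states]))
        rw [hfj, hd.states, hd.rowm] at hsp
        constructor
        · intro u hu
          have := SoundRow.step hval hjn hI'.sound hu hd rfl rfl (hsp u hu)
          simp only [Mem.setI_V, Mem.setI_I, reduceCtorEq, if_false]
          refine ⟨this.feasible, fun p hp hP => this.le p hp ?_⟩
          obtain ⟨h1, h2, h3 | ⟨h3, h4⟩⟩ := hP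
          · exact .inl ⟨hp, h2, .inl h3⟩
          · by_cases e : p = j
            · exact .inr e
            · exact .inl ⟨hp, h2, .inr ⟨h3, by omega⟩⟩
        · intro A τ hA
          simp only [Mem.setI_V]
          exact (hI'.follows A τ hA).step hA hjn hc.2 hc.1 hd rfl hsp
      · rw [Prog.eval_ite_neg (by simpa [hkeyp, hlevp, hfk, hfj] using hc), Prog.eval_skip]
        refine hI'.congr (fun p hp => ?_) (by simp) (by simp)
        unfold Before
        constructor
        · rintro ⟨h1, h2 | ⟨h2, h3⟩⟩
          · exact ⟨h1, .inl h2⟩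
          · exact ⟨h1, .inr ⟨h2, by omega⟩⟩
        · rintro ⟨h1, h2 | ⟨h2, h3⟩⟩
          · exact ⟨h1, .inl h2⟩
          · have : p ≠ j := by rintro rfl; exact hc ⟨h2, h1⟩
            exact ⟨h1, .inr ⟨h2, by omega⟩⟩)
  refine main.congr (fun p hp => ?_) (by simp) (by simp)
  have : g.I .n = h.I .n := hs.I (by simp [playerProg, stateProg, transitionProg, bundleProg,
    rowProg, copyProg])
  rw [this]
  unfold Before
  refine and_congr_right fun _ => ?_
  omega

theorem startProg_spec (h : Mem) (hrows : RowsOK h) : ∀ u < h.I .states 0,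
    (startProg.eval h).V .V u = h.V .total 0 ∧
    ∀ i < h.I .m 0, (startProg.eval h).I .asg (h.I .rowm u + i) = h.I .ans i := by
  set cp : Prog := .loop .i .m (.setI .asg (.add (.rd .rowm (sc .u)) (sc .i))
      (.rd .ans (sc .i))) with hcp
  have hcopy : ∀ g : Mem, ∀ l, (cp.eval g).I .asg l =
      if g.I .rowm (g.I .u 0) ≤ l ∧ l < g.I .rowm (g.I .u 0) + g.I .m 0 then
        g.I .ans (l - g.I .rowm (g.I .u 0)) else g.I .asg l := fun g => by
    set R := g.I .rowm (g.I .u 0) with hR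
    refine Prog.loop_inv (v := .i) (b := .m) (p := .setI .asg (.add (.rd .rowm (sc .u)) (sc .i))
      (.rd .ans (sc .i))) (h := g)
      (fun r f => ∀ l, f.I .asg l = if R ≤ l ∧ l < R + r then g.I .ans (l - R) else g.I .asg l)
      (fun l => by rw [if_neg (by omega)]; simp) ?_
    intro r hr f hi hs hI l
    have e1 : f.I .rowm = g.I .rowm := by rw [hs.I (by simp)]
    have e2 : f.I .u = g.I .u := by rw [hs.I (by simp)]
    have e3 : f.I .ans = g.I .ans := by rw [hs.I (by simp)]
    simp only [Prog.eval_setI, Mem.setI_I, reduceCtorEq, if_false, if_true, IE.eval, e1, e2, e3, hi,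
      Function.update_apply, hI, ← hR]
    by_cases e : l = R + r
    · rw [if_pos e, if_pos (by omega), e, Nat.add_sub_cancel_left]
    · rw [if_neg e]
      by_cases e' : R ≤ l ∧ l < R + r
      · rw [if_pos e', if_pos (by omega)]
      · rw [if_neg e', if_neg (by omega)]
  refine Prog.loop_inv (v := .u) (b := .states)
    (p := .setV .V (sc .u) (.rd .total (.const 0)) ;; cp)
    (h := h) (fun r g => ∀ u < r, g.V .V u = h.V .total 0 ∧ ∀ i < h.I .m 0,
      g.I .asg (h.I .rowm u + i) = h.I .ans i) (by simp) ?_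
  intro r hr g hu hs hI u hur
  have e1 : g.V .total = h.V .total := hs.V (by simp [hcp])
  have e2 : g.I .ans = h.I .ans := hs.I (by simp [hcp])
  have e3 : g.I .rowm = h.I .rowm := hs.I (by simp [hcp])
  have e4 : g.I .m = h.I .m := hs.I (by simp [hcp])
  have e5 : ∀ f : Mem, (cp.eval f).V .V = f.V .V := fun f => Prog.eval_V (by simp [hcp]) f
  simp only [Prog.eval_seq, Prog.eval_setV, Mem.setI_V, e5, Mem.setV_V, if_true, IE.eval, VE.eval,
    hu, e1, Mem.setI_I, reduceCtorEq, if_false, hcopy, Mem.setV_I, e2, e3, e4]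
  by_cases e : u = r
  · subst e
    refine ⟨by simp, fun i hi => ?_⟩
    rw [if_pos (by omega), Nat.add_sub_cancel_left]
  · refine ⟨?_, fun i hi => ?_⟩
    · rw [Function.update_of_ne e]; exact (hI u (by omega)).1
    · rw [if_neg]
      · exact (hI u (by omega)).2 i hi
      · rw [hrows r hr, hrows u (by omega)]
        exact row_disjoint hi (Ne.symm e)

/-! ### Keeping the best assignment of each component. -/

/-- `ans` is a feasible assignment, and the players adjacent to item `i` get at least `best i`. -/
structure BestInv (h : Mem) (best : ℕ → ℚ) (ans : ℕ → ℕ) : Prop where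
  feasible : ∀ i < h.I .m 0, ans i < h.I .n 0 ∧ AdjM h i (ans i)
  le : ∀ j < h.I .n 0, ∀ i < h.I .m 0, AdjM h i j →
    best i ≤ ∑ l ∈ range (h.I .m 0) with ans l = j, h.V .val l
  const : ∀ j < h.I .n 0, ∀ i < h.I .m 0, ∀ i' < h.I .m 0, AdjM h i j → AdjM h i' j →
    best i = best i'

/-- The items adjacent to one player are all reached or all not reached, and they share the same
`best`. Hence all of them switch to the new row or none does, and no player mixes bundles from two
assignments. Components are thereby treated independently. -/
theorem BestInv.update {E : ℕ} {h : Mem} {best best' : ℕ → ℚ} {ans ans' row : ℕ → ℕ} {u : ℕ}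
    {x : ℚ} (hB : BestInv h best ans) (hval : ∀ i < h.I .m 0, 0 ≤ h.V .val i)
    (hlev : ∀ i < h.I .m 0, ∀ j < h.I .n 0, AdjM h i j → (1 ≤ h.I .lev i ↔ 1 ≤ h.I .levp j))
    (hrow : SoundRow E h (fun p => 1 ≤ h.I .levp p) u x row)
    (hbest : ∀ i < h.I .m 0, best' i = if 1 ≤ h.I .lev i ∧ best i < x then x else best i)
    (hans : ∀ i < h.I .m 0, ans' i = if 1 ≤ h.I .lev i ∧ best i < x then row i else ans i) :
    BestInv h best' ans' := by
  classical
  have hcond : ∀ j < h.I .n 0, ∀ i < h.I .m 0, ∀ i' < h.I .m 0, AdjM h i j → AdjM h i' j →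
      ((1 ≤ h.I .lev i ∧ best i < x) ↔ (1 ≤ h.I .lev i' ∧ best i' < x)) :=
    fun j hj i hi i' hi' ha ha' => by
      rw [hlev i hi j hj ha, hlev i' hi' j hj ha', hB.const j hj i hi i' hi' ha ha']
  constructor
  · intro i hi
    rw [hans i hi]
    split_ifs
    · exact hrow.feasible i hi
    · exact hB.feasible i hi
  · intro j hj i hi ha
    rw [hbest i hi, sum_filter]
    by_cases c : 1 ≤ h.I .lev i ∧ best i < x
    · rw [if_pos c]
      refine (hrow.le j hj ((hlev i hi j hj ha).1 c.1)).trans (sum_le_sum fun l hl => ?_)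
      have hl' := mem_range.1 hl
      by_cases t : InState E h u l ∧ row l = j
      · have hal : AdjM h l j := t.2 ▸ (hrow.feasible l hl').2
        rw [if_pos t, if_pos]
        rw [hans l hl', if_pos ((hcond j hj i hi l hl' ha hal).1 c), t.2]
      · rw [if_neg t]
        split_ifs
        · exact hval l hl'
        · exact le_rfl
    · rw [if_neg c]
      refine (hB.le j hj i hi ha).trans ?_
      rw [sum_filter]
      refine sum_le_sum fun l hl => ?_
      have hl' := mem_range.1 hl
      by_cases t : ans l = j
      · have hal : AdjM h l j := t ▸ (hB.feasible l hl').2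
        rw [if_pos t, if_pos]
        rw [hans l hl', if_neg fun c' => c ((hcond j hj i hi l hl' ha hal).2 c'), t]
      · rw [if_neg t]
        split_ifs
        · exact hval l hl'
        · exact le_rfl
  · intro j hj i hi i' hi' ha ha'
    have hc := hcond j hj i hi i' hi' ha ha'
    rw [hbest i hi, hbest i' hi']
    by_cases c : 1 ≤ h.I .lev i ∧ best i < x
    · rw [if_pos c, if_pos (hc.1 c)]
    · rw [if_neg c, if_neg (fun c' => c (hc.2 c'))]
      exact hB.const j hj i hi i' hi' ha ha'

/-- The update of the best assignment with the assignment of one state. -/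
def updateRow : Prog :=
  .loop .i .m (
    .ite (.and (.ile (.const 1) (.rd .lev (sc .i)))
        (.not (.vle (.rd .V (sc .u)) (.rd .best (sc .i)))))
      (.setV .best (sc .i) (.rd .V (sc .u)) ;;
        .setI .ans (sc .i) (.rd .asg (.add (.rd .rowm (sc .u)) (sc .i)))) .skip)

theorem updateRow_spec (h : Mem) :
    (∀ i < h.I .m 0, (updateRow.eval h).V .best i =
      if 1 ≤ h.I .lev i ∧ h.V .best i < h.V .V (h.I .u 0) then h.V .V (h.I .u 0)
        else h.V .best i) ∧
    (∀ i < h.I .m 0, (updateRow.eval h).I .ans i =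
      if 1 ≤ h.I .lev i ∧ h.V .best i < h.V .V (h.I .u 0) then
        h.I .asg (h.I .rowm (h.I .u 0) + i) else h.I .ans i) := by
  have := Prog.loop_inv (v := .i) (b := .m) (p :=
    .ite (.and (.ile (.const 1) (.rd .lev (sc .i)))
        (.not (.vle (.rd .V (sc .u)) (.rd .best (sc .i)))))
      (.setV .best (sc .i) (.rd .V (sc .u)) ;;
        .setI .ans (sc .i) (.rd .asg (.add (.rd .rowm (sc .u)) (sc .i)))) .skip) (h := h)
    (fun r g => (∀ i, r ≤ i → g.V .best i = h.V .best i ∧ g.I .ans i = h.I .ans i) ∧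
      (∀ i < r, g.V .best i =
        if 1 ≤ h.I .lev i ∧ h.V .best i < h.V .V (h.I .u 0) then h.V .V (h.I .u 0)
          else h.V .best i) ∧
      (∀ i < r, g.I .ans i =
        if 1 ≤ h.I .lev i ∧ h.V .best i < h.V .V (h.I .u 0) then
          h.I .asg (h.I .rowm (h.I .u 0) + i) else h.I .ans i)) (by simp) (by
      rintro r hr g hi hs ⟨h1, h2, h3⟩
      have e1 : g.I .lev = h.I .lev := hs.I (by simp)
      have e2 : g.V .V = h.V .V := hs.V (by simp)
      have e3 : g.I .u = h.I .u := hs.I (by simp)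
      have e4 : g.I .asg = h.I .asg := hs.I (by simp)
      have e5 : g.I .rowm = h.I .rowm := hs.I (by simp)
      obtain ⟨e6, e7⟩ := h1 r le_rfl
      by_cases c : 1 ≤ h.I .lev r ∧ h.V .best r < h.V .V (h.I .u 0)
      · rw [Prog.eval_ite_pos (by simpa [e1, e2, e3, hi, e6] using c)]
        simp only [Prog.eval_seq, Prog.eval_setV, Prog.eval_setI, Mem.setI_V, Mem.setV_V, if_true,
          IE.eval, VE.eval, Mem.setI_I, reduceCtorEq, if_false, Mem.setV_I, e2, e3, e4, e5, hi,
          Function.update_apply]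
        refine ⟨fun i hir => ?_, fun i hir => ?_, fun i hir => ?_⟩
        · rw [if_neg (by omega), if_neg (by omega)]; exact h1 i (by omega)
        · by_cases e : i = r
          · subst e; rw [if_pos rfl, if_pos c]
          · rw [if_neg e]; exact h2 i (by omega)
        · by_cases e : i = r
          · subst e; rw [if_pos rfl, if_pos c]
          · rw [if_neg e]; exact h3 i (by omega)
      · rw [Prog.eval_ite_neg (by simpa [e1, e2, e3, hi, e6] using c), Prog.eval_skip]
        simp only [Mem.setI_V, Mem.setI_I, reduceCtorEq, if_false]
        refine ⟨fun i hir => h1 i (by omega), fun i hir => ?_, fun i hir => ?_⟩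
        · by_cases e : i = r
          · subst e; rw [if_neg c, e6]
          · exact h2 i (by omega)
        · by_cases e : i = r
          · subst e; rw [if_neg c, e7]
          · exact h3 i (by omega))
  exact this.2

theorem updateProg_spec {E : ℕ} (h : Mem) (hB : BestInv h (h.V .best) (h.I .ans))
    (hval : ∀ i < h.I .m 0, 0 ≤ h.V .val i)
    (hlev : ∀ i < h.I .m 0, ∀ j < h.I .n 0, AdjM h i j → (1 ≤ h.I .lev i ↔ 1 ≤ h.I .levp j))
    (hrow : ∀ u < h.I .states 0, SoundRow E h (fun p => 1 ≤ h.I .levp p) u (h.V .V u)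
      (fun i => h.I .asg (h.I .rowm u + i))) :
    BestInv h ((updateProg.eval h).V .best) ((updateProg.eval h).I .ans) ∧
    (∀ i < h.I .m 0, h.V .best i ≤ (updateProg.eval h).V .best i) ∧
    (∀ u < h.I .states 0, ∀ i < h.I .m 0, 1 ≤ h.I .lev i →
      h.V .V u ≤ (updateProg.eval h).V .best i) := by
  refine Prog.loop_inv (v := .u) (b := .states) (p := updateRow) (h := h)
    (fun r g => BestInv h (g.V .best) (g.I .ans) ∧
    (∀ i < h.I .m 0, h.V .best i ≤ g.V .best i) ∧
    (∀ u < r, ∀ i < h.I .m 0, 1 ≤ h.I .lev i → h.V .V u ≤ g.V .best i)) (by simp [hB]) ?_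
  rintro r hr g hu hs ⟨h1, h2, h3⟩
  obtain ⟨s1, s2⟩ := updateRow_spec g
  have e1 : g.I .lev = h.I .lev := hs.I (by simp [updateRow])
  have e2 : g.V .V = h.V .V := hs.V (by simp [updateRow])
  have e4 : g.I .asg = h.I .asg := hs.I (by simp [updateRow])
  have e5 : g.I .rowm = h.I .rowm := hs.I (by simp [updateRow])
  have e6 : g.I .m = h.I .m := hs.I (by simp [updateRow])
  rw [e1, e2, e6, hu] at s1
  rw [e1, e2, e4, e5, e6, hu] at s2
  simp only [Mem.setI_V, Mem.setI_I, reduceCtorEq, if_false]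
  have hle : ∀ i < h.I .m 0, g.V .best i ≤ (updateRow.eval g).V .best i := fun i hi => by
    rw [s1 i hi]
    split_ifs with c
    · exact c.2.le
    · exact le_rfl
  refine ⟨h1.update hval hlev (hrow r hr) s1 s2, fun i hi => (h2 i hi).trans (hle i hi),
    fun u hur i hi hl => ?_⟩
  by_cases e : u = r
  · subst e
    rw [s1 i hi]
    split_ifs with c
    · exact le_rfl
    · exact not_lt.1 fun hlt => c ⟨hl, hlt⟩
  · exact (h3 u (by omega) i hi hl).trans (hle i hi)

/-! ### The main loop -/

/-- The part of the memory that is not changed by the main loop. -/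
structure Env (m n E S : ℕ) (adj : ℕ → ℕ → Prop) (v : ℕ → ℚ) (h : Mem) : Prop where
  m_eq : h.I .m 0 = m
  n_eq : h.I .n 0 = n
  b_eq : h.I .b 0 = m + 1
  unit_eq : h.I .unit 0 = 2 * m + 2 * n + 1
  rounds_eq : h.I .rounds 0 = m + n + 1
  keys_eq : h.I .keys 0 = (2 * m + 2 * n + 1) * (m + n + 2)
  cls0_eq : h.I .cls0 0 = E
  states_eq : h.I .states 0 = S
  adj_eq : AdjM h = adj
  val_eq : h.V .val = v
  total_eq : h.V .total 0 = ∑ i ∈ range m, v i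
  rowm : ∀ u < S, h.I .rowm u = u * m
  dig : ∀ u < S, ∀ c < E + 1, h.I .dig ((E + 1) * u + c) = u / (m + 1) ^ c % (m + 1)

theorem Env.same {m n E S : ℕ} {adj : ℕ → ℕ → Prop} {v : ℕ → ℚ} {h g : Mem} {p : Prog}
    (he : Env m n E S adj v h) (hs : Same p h g)
    (hI : ∀ a ∈ ([.m, .n, .b, .unit, .rounds, .keys, .cls0, .states, .inp, .rown, .rowm, .dig] :
      List IName), ¬ p.ModI a)
    (hV : ∀ a ∈ ([.val, .total] : List VName), ¬ p.ModV a) : Env m n E S adj v g where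
  m_eq := by rw [hs.I (hI _ (by simp)), he.m_eq]
  n_eq := by rw [hs.I (hI _ (by simp)), he.n_eq]
  b_eq := by rw [hs.I (hI _ (by simp)), he.b_eq]
  unit_eq := by rw [hs.I (hI _ (by simp)), he.unit_eq]
  rounds_eq := by rw [hs.I (hI _ (by simp)), he.rounds_eq]
  keys_eq := by rw [hs.I (hI _ (by simp)), he.keys_eq]
  cls0_eq := by rw [hs.I (hI _ (by simp)), he.cls0_eq]
  states_eq := by rw [hs.I (hI _ (by simp)), he.states_eq]
  adj_eq := by
    rw [← he.adj_eq]
    ext i j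
    exact AdjM_congr (hs.I (hI _ (by simp))) (hs.I (hI _ (by simp))) i j
  val_eq := by rw [hs.V (hV _ (by simp)), he.val_eq]
  total_eq := by rw [hs.V (hV _ (by simp)), he.total_eq]
  rowm := by rw [hs.I (hI _ (by simp))]; exact he.rowm
  dig := by rw [hs.I (hI _ (by simp))]; exact he.dig

/-- The memory after the preparation of the dynamic program for the guess `g`. -/
structure GuessMem (m n E S : ℕ) (adj : ℕ → ℕ → Prop) (v : ℕ → ℚ) (g : ℕ) (f : Mem) : Prop
    extends Env m n E S adj v f where
  levels : Levels (2 * m + 2 * n + 1) (adjV adj) (isItem (g % (m + 1))) (levOf m n f)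
  key_last : f.I .key m = 0
  key : ∀ i < m, f.I .key i = f.I .lev i + ∑ j ∈ range n,
    keyTerm (adj i j) (f.I .lev i) (f.I .levp j)
  keyp : ∀ j < n, f.I .keyp j = f.I .levp j + ∑ i ∈ range m,
    keyTerm (adj i j) (f.I .levp j) (f.I .lev i)
  cls : ∀ i < m, f.I .cls i = #{c ∈ range E | v (g / (m + 1) ^ (c + 1) % (m + 1)) < v i}

/-- The preparation of the dynamic program. -/
def prepareProg (E : ℕ) : Prog := bfsProg E ;; itemKeyProg ;; playerKeyProg ;; classProg E

theorem prepareProg_spec {m n E S : ℕ} {adj : ℕ → ℕ → Prop} {v : ℕ → ℚ} {h : Mem} {g : ℕ}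
    (he : Env m n E S adj v h) (hg : h.I .g 0 = g) (hgS : g < S) :
    GuessMem m n E S adj v g ((prepareProg E).eval h) := by
  set h1 := (bfsProg E).eval h with h1d
  set h2 := itemKeyProg.eval h1 with h2d
  set h3 := playerKeyProg.eval h2 with h3d
  set h4 := (classProg E).eval h3 with h4d
  have e4 : (prepareProg E).eval h = h4 := rfl
  rw [e4]
  have s1 : Same (bfsProg E) h h1 := Prog.same _ _
  have s2 : Same itemKeyProg h1 h2 := Prog.same _ _
  have s3 : Same playerKeyProg h2 h3 := Prog.same _ _
  have s4 : Same (classProg E) h3 h4 := Prog.same _ _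
  have he1 : Env m n E S adj v h1 := he.same s1 (by simp [bfsProg, bfsRound])
    (by simp [bfsProg, bfsRound])
  have he2 : Env m n E S adj v h2 := he1.same s2 (by simp [itemKeyProg]) (by simp [itemKeyProg])
  have he3 : Env m n E S adj v h3 := he2.same s3 (by simp [playerKeyProg])
    (by simp [playerKeyProg])
  have he4 : Env m n E S adj v h4 := he3.same s4 (by simp [classProg]) (by simp [classProg])
  have l2 : h2.I .lev = h1.I .lev := s2.I (by simp [itemKeyProg])
  have l3 : h3.I .lev = h2.I .lev := s3.I (by simp [playerKeyProg])
  have l4 : h4.I .lev = h3.I .lev := s4.I (by simp [classProg])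
  have p2 : h2.I .levp = h1.I .levp := s2.I (by simp [itemKeyProg])
  have p3 : h3.I .levp = h2.I .levp := s3.I (by simp [playerKeyProg])
  have p4 : h4.I .levp = h3.I .levp := s4.I (by simp [classProg])
  have k3 : h3.I .key = h2.I .key := s3.I (by simp [playerKeyProg])
  have k4 : h4.I .key = h3.I .key := s4.I (by simp [classProg])
  have q4 : h4.I .keyp = h3.I .keyp := s4.I (by simp [classProg])
  have hb := bfsProg_spec (E := E) he.m_eq he.n_eq he.b_eq (by rw [he.unit_eq]; omega) he.rounds_eq
  have d0 := he.dig g hgS 0 (by omega)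
  rw [add_zero, pow_zero, Nat.div_one] at d0
  rw [he.unit_eq, he.adj_eq, hg, d0] at hb
  have hk := itemKeyProg_spec h1
  rw [he1.m_eq, he1.n_eq, he1.adj_eq] at hk
  have hp := playerKeyProg_spec h2
  rw [he2.m_eq, he2.n_eq, he2.adj_eq] at hp
  have hc := classProg_spec E h3
  rw [he3.m_eq, he3.cls0_eq, he3.val_eq] at hc
  have g3 : h3.I .g 0 = g := by
    rw [s3.I (by simp [playerKeyProg]), s2.I (by simp [itemKeyProg]),
      s1.I (by simp [bfsProg, bfsRound]), hg]
  refine { he4 with levels := ?_, key_last := ?_, key := ?_, keyp := ?_, cls := ?_ }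
  · rw [levOf_congr (g := h4) (h := h1) (by rw [l4, l3, l2]) (by rw [p4, p3, p2])]
    exact hb
  · rw [k4, k3]; exact hk.1
  · intro i hi
    rw [k4, k3, l4, l3, l2, p4, p3, p2]
    exact hk.2 i hi
  · intro j hj
    rw [q4, l4, l3, p4, p3]
    exact hp j hj
  · intro i hi
    rw [hc i hi]
    congr 1
    refine filter_congr fun c hc' => ?_
    rw [g3, he3.dig g hgS (c + 1) (by have := mem_range.1 hc'; omega)]

theorem keyTerm_le (p : Prop) (a b : ℕ) : keyTerm p a b ≤ 2 := by
  unfold keyTerm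
  split_ifs <;> omega

theorem keyTerm_eq_one {p : Prop} {a b : ℕ} :
    keyTerm p a b = 1 ↔ ¬ p := by
  unfold keyTerm
  by_cases h : p
  · rw [if_pos h]
    split_ifs <;> simp [h]
  · simp [h]

namespace GuessMem

variable {m n E S g : ℕ} {adj : ℕ → ℕ → Prop} {v : ℕ → ℚ} {f : Mem}

theorem reached_iff (hf : GuessMem m n E S adj v g f) {i j : ℕ} (hi : i < m) (hj : j < n)
    (ha : adj i j) : 1 ≤ f.I .lev i ↔ 1 ≤ f.I .levp j := by
  constructor
  · intro h
    have := (hf.levels.adj (.inl ⟨i, hi⟩) (.inr ⟨j, hj⟩) ha (by simp [levOf]; omega)).1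
    simp [levOf] at this
    omega
  · intro h
    have := (hf.levels.adj (.inr ⟨j, hj⟩) (.inl ⟨i, hi⟩) ha (by simp [levOf]; omega)).1
    simp [levOf] at this
    omega

/-- With `B = 2 * m + 2 * n + 1`, the level is at most `B * (m + n)` and the correction at most `2 *
m < B`. -/
theorem keyp_lt_keys (hf : GuessMem m n E S adj v g f) {j : ℕ} (hj : j < n) :
    f.I .keyp j < f.I .keys 0 := by
  have h1 := hf.levels.le_card (by omega) (.inr ⟨j, hj⟩)
  simp only [levOf, Sum.elim_inr, Fintype.card_sum, Fintype.card_fin] at h1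
  have h2 : ∑ i ∈ range m, keyTerm (adj i j) (f.I .levp j) (f.I .lev i) ≤ ∑ i ∈ range m, 2 :=
    sum_le_sum fun i _ => keyTerm_le _ _ _
  rw [sum_const, card_range, smul_eq_mul] at h2
  rw [hf.keyp j hj, hf.keys_eq]
  nlinarith

end GuessMem

theorem Env.bestInv {m n E S : ℕ} {adj : ℕ → ℕ → Prop} {v : ℕ → ℚ} {h h' : Mem}
    (he : Env m n E S adj v h) (he' : Env m n E S adj v h') {b : ℕ → ℚ} {a : ℕ → ℕ}
    (hB : BestInv h b a) : BestInv h' b a := by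
  obtain ⟨k1, k2, k3⟩ := hB
  rw [he.m_eq, he.n_eq, he.adj_eq] at k1 k2
  rw [he.m_eq, he.n_eq, he.adj_eq] at k3
  rw [he.val_eq] at k2
  constructor
  · rw [he'.m_eq, he'.n_eq, he'.adj_eq]; exact k1
  · rw [he'.m_eq, he'.n_eq, he'.adj_eq, he'.val_eq]; exact k2
  · rw [he'.m_eq, he'.n_eq, he'.adj_eq]; exact k3

/-- Soundness holds for every guess, so wrong guesses do no harm. Only the last clause depends on
the guess being right, through the existence of a target for the prepared memory `f`. -/
theorem guessProg_spec {m n E S : ℕ} {adj : ℕ → ℕ → Prop} {v : ℕ → ℚ} {h : Mem} {g : ℕ}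
    (he : Env m n E S adj v h) (hg : h.I .g 0 = g) (hgS : g < S) (hv : ∀ i < m, 0 ≤ v i)
    (hB : BestInv h (h.V .best) (h.I .ans)) :
    BestInv h (((guessProg E).eval h).V .best) (((guessProg E).eval h).I .ans) ∧
    (∀ i < m, h.V .best i ≤ ((guessProg E).eval h).V .best i) ∧
    ∃ f, GuessMem m n E S adj v g f ∧ ∀ A τ, Target E f A τ → ∀ i < m, 1 ≤ f.I .lev i →
      τ ≤ (((guessProg E).eval h).V .best i : ℝ) := by
  set f := (prepareProg E).eval h with hfd
  have hf : GuessMem m n E S adj v g f := prepareProg_spec he hg hgS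
  have sf : Same (prepareProg E) h f := Prog.same _ _
  set h5 := startProg.eval f with h5d
  set h6 := (dpProg E).eval h5 with h6d
  have e7 : (guessProg E).eval h = updateProg.eval h6 := rfl
  rw [e7]
  have s5 : Same startProg f h5 := Prog.same _ _
  have s6 : Same (dpProg E) h5 h6 := Prog.same _ _
  have he5 : Env m n E S adj v h5 := hf.toEnv.same s5 (by simp [startProg]) (by simp [startProg])
  have he6 : Env m n E S adj v h6 := he5.same s6 (by simp [dpProg, playerProg, stateProg,
    transitionProg, bundleProg, rowProg, copyProg]) (by simp [dpProg, playerProg, stateProg,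
    transitionProg, bundleProg, rowProg, copyProg])
  have hrows : RowsOK f := fun u hu => by
    rw [hf.states_eq] at hu
    rw [hf.rowm u hu, hf.m_eq]
  have ans5 : f.I .ans = h.I .ans := sf.I (by simp [prepareProg, bfsProg, bfsRound, itemKeyProg,
    playerKeyProg, classProg])
  have ans6 : h6.I .ans = h.I .ans := by
    rw [s6.I (by simp [dpProg, playerProg, stateProg, transitionProg, bundleProg, rowProg,
      copyProg]), s5.I (by simp [startProg]), ans5]
  have best6 : h6.V .best = h.V .best := by
    rw [s6.V (by simp [dpProg, playerProg, stateProg, transitionProg, bundleProg, rowProg,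
      copyProg]), s5.V (by simp [startProg]), sf.V (by simp [prepareProg, bfsProg, bfsRound,
      itemKeyProg, playerKeyProg, classProg])]
  have lev5 : h5.I .lev = f.I .lev := s5.I (by simp [startProg])
  have levp5 : h5.I .levp = f.I .levp := s5.I (by simp [startProg])
  have key5 : h5.I .key = f.I .key := s5.I (by simp [startProg])
  have keyp5 : h5.I .keyp = f.I .keyp := s5.I (by simp [startProg])
  have cls5 : h5.I .cls = f.I .cls := s5.I (by simp [startProg])
  have dig5 : h5.I .dig = f.I .dig := s5.I (by simp [startProg])
  have bef5 : Before h5 = Before f := by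
    ext k j p
    simp [Before, levp5, keyp5]
  have ins5 : InState E h5 = InState E f := by
    ext u i
    simp [InState, lev5, key5, dig5, cls5]
  have hst := startProg_spec f hrows
  have hrows5 : RowsOK h5 := fun u hu => by
    rw [he5.states_eq] at hu
    rw [he5.rowm u hu, he5.m_eq]
  have tgt : ∀ {A τ}, Target E f A τ → Target E h5 A τ := by
    rintro A τ ⟨k1, k3, k4, k5⟩
    rw [hf.m_eq, hf.n_eq, hf.adj_eq] at k1
    rw [hf.m_eq] at k3 k4
    rw [hf.states_eq] at k3
    rw [hf.n_eq, hf.val_eq] at k4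
    rw [hf.total_eq] at k5
    constructor
    · rw [he5.m_eq, he5.n_eq, he5.adj_eq, lev5]; exact k1
    · rw [he5.m_eq, he5.states_eq, ins5, bef5, lev5]; exact k3
    · rw [he5.m_eq, he5.n_eq, he5.val_eq, lev5, levp5]; exact k4
    · rw [he5.total_eq]; exact k5
  have nb : ∀ p, ¬ Before h5 0 0 p := by
    rintro p ⟨-, h2 | ⟨-, h3⟩⟩ <;> omega
  -- No player comes before the position (0, 0), so every state is sound with the feasible row
  -- `ans`. The value `total` stands for infinity; by `Target.le_total` no target exceeds it.
  have h0 : TableInv E h5 0 0 h5 := by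
    constructor
    · intro u hu
      refine ⟨fun i hi => ?_, fun p hp hP => (nb p hP.2).elim⟩
      rw [he5.m_eq] at hi
      rw [he5.states_eq] at hu
      rw [he5.n_eq, he5.adj_eq]
      have := (hst u (by rw [hf.states_eq]; exact hu)).2 i (by rw [hf.m_eq]; exact hi)
      rw [he5.rowm u hu, ← hf.rowm u hu]
      rw [this, ans5]
      have := hB.feasible i (by rw [he.m_eq]; exact hi)
      rwa [he.n_eq, he.adj_eq] at this
    · intro A τ hA
      obtain ⟨u, hu, hui⟩ := hA.exists_state 0 0
      refine ⟨u, hu, hui, ?_⟩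
      rw [(hst u (by rw [hf.states_eq]; rwa [he5.states_eq] at hu)).1, hf.total_eq, ← he5.total_eq]
      exact hA.le_total
  have hv5 : ∀ i < h5.I .m 0, 0 ≤ h5.V .val i := by rw [he5.m_eq, he5.val_eq]; exact hv
  have hT := dpProg_spec E h5 hrows5 hv5 h0
  have dpk : SameData h5 h6 := s6.data (by constructor <;> simp [dpProg, playerProg, stateProg,
    transitionProg, bundleProg, rowProg, copyProg])
  have levp6 : h6.I .levp = h5.I .levp := s6.I (by simp [dpProg, playerProg, stateProg,
    transitionProg, bundleProg, rowProg, copyProg])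
  have befk : ∀ p < n, 1 ≤ f.I .levp p → Before h5 (h5.I .keys 0) 0 p := fun p hp hl => by
    rw [bef5]
    refine ⟨hl, .inl ?_⟩
    rw [he5.keys_eq, ← hf.keys_eq]
    exact hf.keyp_lt_keys hp
  have hup := updateProg_spec (E := E) h6 (by rw [best6, ans6]; exact he.bestInv he6 hB)
    (by rw [he6.m_eq, he6.val_eq]; exact hv) (by
      rw [he6.m_eq, he6.n_eq, he6.adj_eq, dpk.lev, levp6, lev5, levp5]
      exact fun i hi j hj ha => hf.reached_iff hi hj ha) (by
      intro u hu
      rw [he6.states_eq] at hu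
      obtain ⟨k1, k2⟩ := hT.sound u (by rw [he5.states_eq]; exact hu)
      rw [he5.rowm u hu, ← he6.rowm u hu] at k1 k2
      refine ⟨?_, ?_⟩
      · rw [he6.m_eq, he6.n_eq, he6.adj_eq, ← he5.m_eq, ← he5.n_eq, ← he5.adj_eq]; exact k1
      · intro p hp hl
        rw [he6.n_eq] at hp
        rw [levp6, levp5] at hl
        have := k2 p (by rw [he5.n_eq]; exact hp) ⟨by rw [he5.n_eq]; exact hp, befk p hp hl⟩
        have e : stateValue E h6 u (fun i => h6.I .asg (h6.I .rowm u + i)) p =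
            stateValue E h5 u (fun i => h6.I .asg (h6.I .rowm u + i)) p := by
          classical
          rw [stateValue, stateValue, dpk.m, dpk.val]
          exact sum_congr rfl fun i _ => if_congr (by rw [dpk.inState]) rfl rfl
        rw [e]
        exact this)
  obtain ⟨u1, u2, u3⟩ := hup
  rw [he6.m_eq, best6] at u2
  refine ⟨he6.bestInv he u1, u2, f, hf, ?_⟩
  intro A τ hA i hi hl
  obtain ⟨u, hu, -, huV⟩ := hT.follows A τ (tgt hA)
  refine huV.trans ?_
  rw [he5.states_eq, ← he6.states_eq] at hu
  exact_mod_cast u3 u hu i (by rw [he6.m_eq]; exact hi) (by rw [dpk.lev, lev5]; exact hl)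

/-- Since `best` never decreases, what a right guess achieves survives all later guesses. -/
theorem mainLoop_spec {m n E S : ℕ} {adj : ℕ → ℕ → Prop} {v : ℕ → ℚ} {h : Mem}
    (he : Env m n E S adj v h) (hv : ∀ i < m, 0 ≤ v i)
    (hB : BestInv h (h.V .best) (h.I .ans)) :
    let h' := (Prog.loop .g .states (guessProg E)).eval h
    BestInv h (h'.V .best) (h'.I .ans) ∧
    ∀ g < S, ∃ f, GuessMem m n E S adj v g f ∧ ∀ A τ, Target E f A τ → ∀ i < m,
      1 ≤ f.I .lev i → τ ≤ (h'.V .best i : ℝ) := by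
  rw [← he.states_eq]
  refine Prog.loop_inv (v := .g) (b := .states) (p := guessProg E) (h := h)
    (fun r k => BestInv h (k.V .best) (k.I .ans) ∧
    ∀ g < r, ∃ f, GuessMem m n E (h.I .states 0) adj v g f ∧ ∀ A τ, Target E f A τ → ∀ i < m,
      1 ≤ f.I .lev i → τ ≤ (k.V .best i : ℝ)) (by simp [hB]) ?_
  rintro r hr k hkg hs ⟨h1, h2⟩
  have hek : Env m n E S adj v k := he.same hs (by simp [guessProg, bfsProg, bfsRound, itemKeyProg,
    playerKeyProg, classProg, startProg, dpProg, playerProg, stateProg, transitionProg, bundleProg,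
    rowProg, copyProg, updateProg]) (by simp [guessProg, bfsProg, bfsRound, itemKeyProg,
    playerKeyProg, classProg, startProg, dpProg, playerProg, stateProg, transitionProg, bundleProg,
    rowProg, copyProg, updateProg])
  obtain ⟨g1, g2, g3⟩ := guessProg_spec hek hkg (by rwa [← he.states_eq]) hv (he.bestInv hek h1)
  simp only [Mem.setI_V, Mem.setI_I, reduceCtorEq, if_false]
  refine ⟨hek.bestInv he g1, fun g hg => ?_⟩
  by_cases e : g = r
  · subst e
    rw [he.states_eq]
    exact g3
  · obtain ⟨f, hf, hA⟩ := h2 g (by omega)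
    refine ⟨f, hf, fun A τ hT i hi hl => (hA A τ hT i hi hl).trans ?_⟩
    exact_mod_cast g2 i hi

end Ram
/-! ### Strong orders of bipartite graphs -/

/-- `R` sorts the two sides of the bipartite graph `G` in such a way that crossing edges span a
complete bipartite graph. -/
structure StrongOrder {V : Type*} (side : V → Bool) (G R : V → V → Prop) : Prop where
  bip : ∀ {v w}, G v w → side w = !side v
  symm : ∀ {v w}, G v w → G w v
  total : ∀ {v w}, side v = side w → R v w ∨ R w v
  cross : ∀ {v v' w w'}, side v = side v' → side w = side w' → R v v' → R w w' → G v w' →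
    G v' w → G v w ∧ G v' w'

namespace StrongOrder

variable {V : Type*} {side : V → Bool} {G R : V → V → Prop}

theorem side_eq (h : StrongOrder side G R) {v v' w w' : V} (hv : side v = side v') (hw : G v w)
    (hw' : G v' w') : side w = side w' := by
  rw [h.bip hw, h.bip hw', hv]

/-- Compare `w` with the neighbour `w'` of `v`: whichever comes first, the edge from `v` to `w'`
crosses one of the two outer edges at `w`. `R` is not assumed transitive, so all comparisons that
are needed appear as hypotheses. -/
theorem between (h : StrongOrder side G R) {u v v' w w' : V} (hu : side u = side v)
    (hv : side v = side v') (huv : R u v) (hvv : R v v') (h1 : G u w) (h2 : G v' w)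
    (h3 : G v w') : G v w := by
  have hs : side w = side w' := h.side_eq hu h1 h3
  rcases h.total hs with h4 | h4
  · exact (h.cross hv hs hvv h4 h3 h2).1
  · exact (h.cross hu hs.symm huv h4 h1 h3).2

/-- An edge that lies between two crossing edges. -/
theorem cross_between (h : StrongOrder side G R) {x y z p q r : V} (hy : side y = side x)
    (hz : side x = side z) (hr : side r = side q) (hp : side q = side p) (hyx : R y x)
    (hxz : R x z) (hyz : R y z) (hrq : R r q) (hqp : R q p) (hrp : R r p) (h1 : G y p)
    (h2 : G z r) {x' q' : V} (hx' : G x x') (hq' : G q q') : G x q := by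
  obtain ⟨h3, h4⟩ := h.cross (hy.trans hz) (hr.trans hp) hyz hrp h1 h2
  have h5 : G x r := h.between hy hz hyx hxz h3 h2 hx'
  have h6 : G x p := h.between hy hz hyx hxz h1 h4 hx'
  exact h.symm (h.between hr hp hrq hqp (h.symm h5) (h.symm h6) hq')

variable {B : ℕ} {L : V → ℕ} {r : V}

/-- Take predecessors `w` of `v` and `w'` of `v'`. If `w` comes first, induction applies to them.
Otherwise the two edges cross, so `v` is adjacent to `w'` and is reached one step after it. The root
must be the first reached vertex of its side for the induction to start. -/
theorem level_mono (h : StrongOrder side G R) (hB : 0 < B) (hL : Levels B G (· = r) L)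
    (hmin : ∀ v, side v = side r → L v ≠ 0 → R v r → v = r) {v v' : V} (hs : side v = side v')
    (hv : L v ≠ 0) (hv' : L v' ≠ 0) (hR : R v v') : L v ≤ L v' := by
  induction hl : L v' using Nat.strong_induction_on generalizing v v' with
  | _ l ih =>
  by_cases e' : v' = r
  · subst e'
    rw [hmin v hs hv hR, hl]
  obtain ⟨w', g1, g2, g3⟩ := hL.pred v' hv' e'
  by_cases e : v = r
  · rw [hL.root_eq v e]; omega
  obtain ⟨w, k1, k2, k3⟩ := hL.pred v hv e
  have hws : side w = side w' := h.side_eq hs k1 g1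
  rcases h.total hws with h4 | h4
  · have := ih (L w') (by omega) hws k2 g2 h4 rfl
    omega
  · have h5 := (h.cross hs hws.symm hR h4 k1 g1).1
    have := (hL.adj w' v (h.symm h5) g2).2
    omega

theorem le_of_level_lt (h : StrongOrder side G R) (hB : 0 < B) (hL : Levels B G (· = r) L)
    (hmin : ∀ v, side v = side r → L v ≠ 0 → R v r → v = r) {v v' : V} (hs : side v = side v')
    (hv : L v ≠ 0) (hv' : L v' ≠ 0) (hlt : L v < L v') : R v v' := by
  rcases h.total hs with h1 | h1
  · exact h1
  · have := h.level_mono hB hL hmin hs.symm hv' hv h1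
    omega

theorem eq_root (hL : Levels B G (· = r) L) {v : V} (hv : L v = B) (hB : 0 < B) : v = r := by
  by_contra e
  obtain ⟨w, -, h1, h2⟩ := hL.pred v (by omega) e
  omega

/-- Lower neighbourhoods shrink along a level. Let `w1` be a predecessor of `v`. If `w` comes before
`w1`, the edges `v w1` and `v' w` cross. Otherwise the edge from `w` to its own predecessor, which
lies before `v` by its level, crosses `v w1`, unless `w` is the root and equals `w1`. -/
theorem adj_lower (h : StrongOrder side G R) (hB : 0 < B) (hL : Levels B G (· = r) L)
    (hmin : ∀ v, side v = side r → L v ≠ 0 → R v r → v = r) {v v' w : V} (hs : side v = side v')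
    (hv : L v ≠ 0) (hR : R v v') (hll : L v = L v') (hw : G v' w) (hwl : L w + B = L v') :
    G v w := by
  have hw0 : L w ≠ 0 := (hL.adj v' w hw (by omega)).1
  have e : v ≠ r := fun e => by
    have := hL.root_eq v e
    omega
  obtain ⟨w1, k1, k2, k3⟩ := hL.pred v hv e
  have hs1 : side w1 = side w := h.side_eq hs k1 hw
  rcases h.total hs1 with h1 | h1
  · by_cases er : w = r
    · have : w1 = r := eq_root hL (by have := hL.root_eq w er; omega) hB
      rw [er, ← this]
      exact k1
    · obtain ⟨u, g1, g2, g3⟩ := hL.pred w hw0 er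
      have hsu : side u = side v := by
        rw [h.bip g1, h.bip hw, hs, Bool.not_not]
      have huv : R u v := h.le_of_level_lt hB hL hmin hsu g2 hv (by omega)
      exact (h.cross hsu hs1 huv h1 (h.symm g1) k1).2
  · exact (h.cross hs hs1.symm hR h1 k1 hw).1

/-- Upper neighbourhoods grow along a level: a predecessor of `v'` has a lower level than `w`, hence
comes before it, and its edge to `v'` crosses `v w`. -/
theorem adj_upper (h : StrongOrder side G R) (hB : 0 < B) (hL : Levels B G (· = r) L)
    (hmin : ∀ v, side v = side r → L v ≠ 0 → R v r → v = r) {v v' w : V} (hs : side v = side v')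
    (hv : L v ≠ 0) (hR : R v v') (hll : L v = L v') (hw : G v w) (hwl : L w = L v + B) :
    G v' w := by
  by_cases e : v' = r
  · have : v = r := eq_root hL (by rw [hll, hL.root_eq v' e]) hB
    rw [e, ← this]
    exact hw
  obtain ⟨u, g1, g2, g3⟩ := hL.pred v' (by omega) e
  have hsu : side u = side w := h.side_eq hs.symm g1 hw
  have huw : R u w := h.le_of_level_lt hB hL hmin hsu g2 (by omega) (by omega)
  exact (h.cross hs hsu hR huw hw g1).2

/-- Levels alternate between the sides, so adjacent vertices cannot share a level; `adj_level` rests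
on this. -/
theorem parity (h : StrongOrder side G R) (hB : 0 < B) (hL : Levels B G (· = r) L) {v : V}
    (hv : L v ≠ 0) : ∃ k, L v = B * (k + 1) ∧ (side v = side r ↔ Even k) := by
  induction hl : L v using Nat.strong_induction_on generalizing v with
  | _ l ih =>
  by_cases e : v = r
  · exact ⟨0, by rw [← hl, hL.root_eq v e]; ring, by simp [e]⟩
  · obtain ⟨w, g1, g2, g3⟩ := hL.pred v hv e
    obtain ⟨k, hk, hk'⟩ := ih (L w) (by omega) g2 rfl
    refine ⟨k + 1, by rw [← hl, ← g3, hk]; ring, ?_⟩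
    rw [Nat.even_add_one, ← hk', h.bip g1]
    cases side v <;> cases side r <;> simp

/-- Adjacent vertices are in consecutive levels. -/
theorem adj_level (h : StrongOrder side G R) (hB : 0 < B) (hL : Levels B G (· = r) L) {v w : V}
    (hvw : G v w) (hv : L v ≠ 0) : L w = L v + B ∨ L w + B = L v := by
  obtain ⟨hw, h1⟩ := hL.adj v w hvw hv
  obtain ⟨-, h2⟩ := hL.adj w v (h.symm hvw) hw
  obtain ⟨k, hk, hk'⟩ := h.parity hB hL hv
  obtain ⟨l, hl, hl'⟩ := h.parity hB hL hw
  have hkl : k ≠ l := by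
    rintro rfl
    rw [h.bip hvw, ← hk'] at hl'
    revert hl'
    cases side v <;> cases side r <;> simp
  rw [hk, hl] at h1 h2 ⊢
  have h3 : l + 1 ≤ k + 1 + 1 := Nat.le_of_mul_le_mul_left (by linarith) hB
  have h4 : k + 1 ≤ l + 1 + 1 := Nat.le_of_mul_le_mul_left (by linarith) hB
  have : l = k + 1 ∨ k = l + 1 := by omega
  rcases this with rfl | rfl
  · left; ring
  · right; ring

open Ram in
-- Moving right inside a level, a lower neighbour may be lost (0 becomes 1) and an upper one gained
-- (1 becomes 2), and nothing else can happen.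
theorem keyTerm_mono (h : StrongOrder side G R) (hB : 0 < B) (hL : Levels B G (· = r) L)
    (hmin : ∀ v, side v = side r → L v ≠ 0 → R v r → v = r) {v v' : V} (hs : side v = side v')
    (hv : L v ≠ 0) (hR : R v v') (hll : L v = L v') (w : V) :
    keyTerm (G v w) (L v) (L w) ≤ keyTerm (G v' w) (L v') (L w) := by
  unfold keyTerm
  by_cases h1 : G v w
  · rw [if_pos h1]
    by_cases h2 : L w ≤ L v
    · rw [if_pos h2]; exact Nat.zero_le _
    · have h3 : G v' w := h.adj_upper hB hL hmin hs hv hR hll h1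
        (by rcases h.adj_level hB hL h1 hv with h4 | h4 <;> omega)
      rw [if_neg h2, if_pos h3, if_neg (by omega)]
  · rw [if_neg h1]
    by_cases h2 : G v' w
    · rw [if_pos h2]
      split_ifs with h3
      · exact absurd (h.adj_lower hB hL hmin hs hv hR hll h2
          (by rcases h.adj_level hB hL h2 (by omega) with h4 | h4 <;> omega)) h1
      · omega
    · rw [if_neg h2]

/-- The key of a vertex. -/
noncomputable def key [Fintype V] (side : V → Bool) (G : V → V → Prop) (L : V → ℕ) (v : V) : ℕ :=
  L v + ∑ w, if side w = side v then 0 else Ram.keyTerm (G v w) (L v) (L w)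

variable [Fintype V]

/-- Between levels the gap `B` exceeds any correction, which is at most twice the number of
vertices. Inside a level the terms are ordered one by one, so equal sums force equal terms; as the
term 1 marks non-adjacency, vertices with equal keys are twins. -/
theorem key_mono (h : StrongOrder side G R) (hB : 2 * Fintype.card V < B)
    (hL : Levels B G (· = r) L)
    (hmin : ∀ v, side v = side r → L v ≠ 0 → R v r → v = r) {v v' : V} (hs : side v = side v')
    (hv : L v ≠ 0) (hv' : L v' ≠ 0) (hR : R v v') :
    key side G L v ≤ key side G L v' ∧
      (key side G L v = key side G L v' → ∀ w, G v w ↔ G v' w) := by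
  have hB0 : 0 < B := by omega
  have hle := h.level_mono hB0 hL hmin hs hv hv' hR
  rcases hle.lt_or_eq with hlt | heq
  · have h1 : ∑ w, (if side w = side v then 0 else Ram.keyTerm (G v w) (L v) (L w)) ≤
        ∑ w : V, 2 := sum_le_sum fun w _ => by
      split_ifs
      · omega
      · exact Ram.keyTerm_le _ _ _
    rw [sum_const, card_univ, smul_eq_mul] at h1
    obtain ⟨k, hk⟩ := hL.exists_eq hB0 v hv
    obtain ⟨l, hl⟩ := hL.exists_eq hB0 v' hv'
    have h2 : L v + B ≤ L v' := by
      rw [hk, hl] at hlt ⊢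
      have := Nat.lt_of_mul_lt_mul_left hlt
      calc B * (k + 1) + B = B * (k + 1 + 1) := by ring
        _ ≤ _ := Nat.mul_le_mul_left _ (by omega)
    have : key side G L v < key side G L v' := by
      unfold key; omega
    exact ⟨this.le, fun e => absurd e this.ne⟩
  · have hterm : ∀ w ∈ (univ : Finset V),
        (if side w = side v then 0 else Ram.keyTerm (G v w) (L v) (L w)) ≤
        (if side w = side v' then 0 else Ram.keyTerm (G v' w) (L v') (L w)) := fun w _ => by
      rw [hs]
      split_ifs
      · exact le_rfl
      · exact h.keyTerm_mono hB0 hL hmin hs hv hR heq w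
    refine ⟨add_le_add heq.le (sum_le_sum hterm), fun e w => ?_⟩
    have e2 : ∑ w, (if side w = side v then 0 else Ram.keyTerm (G v w) (L v) (L w)) =
        ∑ w, (if side w = side v' then 0 else Ram.keyTerm (G v' w) (L v') (L w)) := by
      unfold key at e; omega
    have e3 := (sum_eq_sum_iff_of_le hterm).1 e2 w (mem_univ w)
    by_cases hw : side w = side v
    · constructor
      · intro hg
        have := h.bip hg
        rw [hw] at this
        cases hsv : side v <;> simp [hsv] at this
      · intro hg
        have := h.bip hg
        rw [hw, hs] at this
        cases hsv : side v' <;> simp [hsv] at this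
    · rw [if_neg hw, if_neg (hs ▸ hw)] at e3
      rw [← not_iff_not, ← Ram.keyTerm_eq_one (a := L v) (b := L w), e3, Ram.keyTerm_eq_one]

/-- The keys sort the vertices that are reached. -/
theorem of_key (h : StrongOrder side G R) (hB : 2 * Fintype.card V < B)
    (hL : Levels B G (· = r) L)
    (hmin : ∀ v, side v = side r → L v ≠ 0 → R v r → v = r) :
    StrongOrder (V := {v // L v ≠ 0}) (fun v => side v) (fun v w => G v w)
      (fun v w => key side G L v ≤ key side G L w) where
  bip h1 := h.bip h1
  symm h1 := h.symm h1
  total _ := le_total _ _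
  cross := by
    rintro ⟨v, hv⟩ ⟨v', hv'⟩ ⟨w, hw⟩ ⟨w', hw'⟩ s1 s2 h1 h2 g1 g2
    dsimp only at *
    -- The order by keys agrees with `R` except between twins, and twins can be exchanged in every
    -- edge.
    have alt : ∀ {v v'}, side v = side v' → L v ≠ 0 → L v' ≠ 0 →
        key side G L v ≤ key side G L v' → R v v' ∨ ∀ w, G v w ↔ G v' w := by
      intro v v' s hv hv' hk
      rcases h.total s with h3 | h3
      · exact .inl h3
      · obtain ⟨h4, h5⟩ := h.key_mono hB hL hmin s.symm hv' hv h3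
        exact .inr fun w => (h5 (le_antisymm h4 hk) w).symm
    rcases alt s1 hv hv' h1 with h3 | h3
    · rcases alt s2 hw hw' h2 with h4 | h4
      · exact h.cross s1 s2 h3 h4 g1 g2
      · exact ⟨h.symm ((h4 v).2 (h.symm g1)), h.symm ((h4 v').1 (h.symm g2))⟩
    · exact ⟨(h3 w).2 g2, (h3 w').1 g1⟩

end StrongOrder

theorem Levels.reached_iff {V : Type*} {B : ℕ} {G : V → V → Prop} {r : V} {L : V → ℕ}
    (hL : Levels B G (· = r) L) (hB : 0 < B) (hG : ∀ {v w}, G v w → G w v) (v : V) :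
    L v ≠ 0 ↔ Relation.ReflTransGen G r v := by
  constructor
  · intro hv
    induction hl : L v using Nat.strong_induction_on generalizing v with
    | _ l ih =>
    by_cases e : v = r
    · rw [e]
    · obtain ⟨w, g1, g2, g3⟩ := hL.pred v hv e
      exact (ih (L w) (by omega) w g2 rfl).tail (hG g1)
  · intro hv
    induction hv with
    | refl => rw [hL.root_eq r rfl]; omega
    | tail _ h1 ih => exact (hL.adj _ _ h1 ih).1

/-! ### Inclusion-free convex graphs have a strong order. -/

namespace Instance

variable {m n : ℕ} {H : Instance m n} {pos : Equiv.Perm (Fin m)}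

/-- The order of the players that belongs to an order of the items. -/
def playerLe (H : Instance m n) (pos : Equiv.Perm (Fin m)) (j j' : Fin n) : Prop :=
  ∀ x y, pos x ≤ pos y → H.adj x j' → H.adj y j → H.adj x j ∧ H.adj y j'

theorem consecutive_le {S : Set (Fin m)} (hS : Consecutive pos S) {x y z : Fin m} (hx : x ∈ S)
    (hz : z ∈ S) (hxy : pos x ≤ pos y) (hyz : pos y ≤ pos z) : y ∈ S := by
  rcases hxy.lt_or_eq with h1 | h1
  · rcases hyz.lt_or_eq with h2 | h2
    · exact hS x hx z hz y h1 h2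
    · rwa [pos.injective h2]
  · rwa [← pos.injective h1]

/-- The items `a` and `c` separate the intervals: an item of `j'` left of `a` would pull `a` into
the interval of `j'`, and an item of `j` right of `c` would pull `c` into that of `j`. So crossing
edges end between `a` and `c`. -/
theorem playerLe_of_lt (ha : H.AdjacencyProperty pos) {j j' : Fin n} {a c : Fin m}
    (haj : H.adj a j) (haj' : ¬ H.adj a j') (hcj : ¬ H.adj c j) (hcj' : H.adj c j')
    (hac : pos a ≤ pos c) : H.playerLe pos j j' := by
  intro x y hxy hx hy
  have h1 : pos a ≤ pos x := by
    by_contra h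
    exact haj' (consecutive_le (ha j') hx hcj' (not_le.1 h).le hac)
  have h2 : pos y ≤ pos c := by
    by_contra h
    exact hcj (consecutive_le (ha j) haj hy hac (not_le.1 h).le)
  exact ⟨consecutive_le (ha j) haj hy h1 hxy, consecutive_le (ha j') hx hcj' hxy h2⟩

/-- Here the enclosure property enters: if both comparisons failed, the difference of the
neighbourhoods would have items on both sides of an item of the smaller one. -/
theorem playerLe_of_subset (ha : H.AdjacencyProperty pos) (he : H.EnclosureProperty pos)
    {j j' : Fin n} (hs : H.nbhd j ⊆ H.nbhd j') : H.playerLe pos j j' ∨ H.playerLe pos j' j := by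
  by_contra! hcon
  obtain ⟨h1, h2⟩ := hcon
  simp only [playerLe, not_forall] at h1 h2
  obtain ⟨x, y, hxy, hx, hy, h3⟩ := h1
  obtain ⟨x', y', hxy', hx', hy', h4⟩ := h2
  have h5 : ¬ H.adj x j := fun h => h3 ⟨h, hs hy⟩
  have h6 : ¬ H.adj y' j := fun h => h4 ⟨hs hx', h⟩
  have h7 : pos x ≤ pos x' := by
    by_contra h
    exact h5 (consecutive_le (ha j) hx' hy (not_le.1 h).le hxy)
  exact (consecutive_le (he j j' hs) (x := x) (z := y') ⟨hx, h5⟩ ⟨hy', h6⟩ h7 hxy').2 hx'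

theorem playerLe_total (ha : H.AdjacencyProperty pos) (he : H.EnclosureProperty pos)
    (j j' : Fin n) : H.playerLe pos j j' ∨ H.playerLe pos j' j := by
  by_cases h1 : H.nbhd j ⊆ H.nbhd j'
  · exact playerLe_of_subset ha he h1
  by_cases h2 : H.nbhd j' ⊆ H.nbhd j
  · exact (playerLe_of_subset ha he h2).symm
  obtain ⟨a, ha1, ha2⟩ := Set.not_subset.1 h1
  obtain ⟨c, hc1, hc2⟩ := Set.not_subset.1 h2
  rcases le_total (pos a) (pos c) with h3 | h3
  · exact .inl (playerLe_of_lt ha ha1 ha2 hc2 hc1 h3)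
  · exact .inr (playerLe_of_lt ha hc1 hc2 ha2 ha1 h3)

/-- The order of the items and players. -/
def vertexLe (H : Instance m n) (pos : Equiv.Perm (Fin m)) : Fin m ⊕ Fin n → Fin m ⊕ Fin n → Prop
  | .inl x, .inl y => pos x ≤ pos y
  | .inr j, .inr j' => H.playerLe pos j j'
  | _, _ => False

/-- The graph on the items and players. -/
def graph (H : Instance m n) : Fin m ⊕ Fin n → Fin m ⊕ Fin n → Prop
  | .inl i, .inr j => H.adj i j
  | .inr j, .inl i => H.adj i j
  | _, _ => False

/-- `playerLe` is the crossing condition itself, so `cross` is immediate and the content is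
totality. -/
theorem strongOrder (ha : H.AdjacencyProperty pos) (he : H.EnclosureProperty pos) :
    StrongOrder Sum.isLeft H.graph (H.vertexLe pos) where
  bip {v w} h := by rcases v with v | v <;> rcases w with w | w <;> simp_all [graph]
  symm {v w} h := by rcases v with v | v <;> rcases w with w | w <;> simp_all [graph]
  total {v w} h := by
    rcases v with v | v <;> rcases w with w | w <;> simp [vertexLe] at h ⊢
    · exact le_total _ _
    · exact playerLe_total ha he _ _
  cross {v v' w w'} h1 h2 h3 h4 h5 h6 := by
    rcases v with v | v <;> rcases w with w | w <;> rcases v' with v' | v' <;>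
      rcases w' with w' | w' <;> simp [vertexLe, graph] at h1 h2 h3 h4 h5 h6 ⊢
    · exact (h4 v v' h3 h5 h6)
    · exact h3 w w' h4 h6 h5

end Instance
/-! ### Monotone assignments -/

section

variable {X Y : Type*} {f : X → ℕ} {g : Y → ℕ} {B : X → Y} {w : X → ℝ}

open Classical in
/-- The weight of the items of `S` with the property `P`. -/
noncomputable def weight (S : Finset X) (w : X → ℝ) (P : X → Prop) : ℝ := ∑ x ∈ S with P x, w x

theorem weight_mono {S : Finset X} (hw : ∀ x ∈ S, 0 < w x) {P Q : X → Prop}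
    (h : ∀ x ∈ S, P x → Q x) : weight S w P ≤ weight S w Q := by
  classical
  refine sum_le_sum_of_subset_of_nonneg (fun x hx => ?_) fun x hx _ => (hw x (mem_filter.1 hx).1).le
  rw [mem_filter] at hx ⊢
  exact ⟨hx.1, h x hx.1 hx.2⟩

theorem weight_congr {S : Finset X} {P Q : X → Prop}
    (h : ∀ x ∈ S, P x ↔ Q x) : weight S w P = weight S w Q := by
  classical
  unfold weight
  rw [filter_congr h]

theorem weight_add {S : Finset X} {P Q : X → Prop} (h : ∀ x ∈ S, P x → ¬ Q x) :
    weight S w P + weight S w Q = weight S w (fun x => P x ∨ Q x) := by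
  classical
  rw [weight, weight, weight, ← sum_union (disjoint_filter.2 h), ← filter_or]
  exact sum_congr (by ext; simp) fun _ _ => rfl

theorem weight_nonneg {S : Finset X} (hw : ∀ x ∈ S, 0 < w x) (P : X → Prop) : 0 ≤ weight S w P := by
  classical
  exact sum_nonneg fun x hx => (hw x (mem_filter.1 hx).1).le

theorem weight_eq_zero {S : Finset X} {P : X → Prop} (h : ∀ x ∈ S, ¬ P x) : weight S w P = 0 := by
  classical
  rw [weight, filter_eq_empty_iff.2 (fun x hx => h x hx), sum_empty]

open Classical in
theorem weight_one {S : Finset X} {P : X → Prop} :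
    weight S (fun _ => 1) P = (#{x ∈ S | P x} : ℝ) := by
  rw [weight, sum_const, nsmul_eq_mul, mul_one]

/-- Unit weights count items, so a loss of strictly less than one is no loss. -/
theorem weight_one_le {S : Finset X} {P Q : X → Prop}
    (h : weight S (fun _ => 1) P - 1 < weight S (fun _ => 1) Q) :
    weight S (fun _ => 1) P ≤ weight S (fun _ => 1) Q := by
  rw [weight_one, weight_one] at h ⊢
  rw [sub_lt_iff_lt_add] at h
  exact_mod_cast Nat.lt_succ_iff.1 (by exact_mod_cast h)

theorem weight_filter {S : Finset X} {P Q : X → Prop} [DecidablePred Q] :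
    weight (S.filter Q) w P = weight S w (fun x => Q x ∧ P x) := by
  classical
  rw [weight, weight, filter_filter]
  exact sum_congr (by ext; simp) fun _ _ => rfl

theorem weight_eq_of_mem {S : Finset X} {x : X} (hx : x ∈ S) (hf : Set.InjOn f S) :
    weight S w (fun y => f y ≤ f x) = weight S w (fun y => f y < f x) + w x := by
  classical
  have h1 : weight S w (fun y => f y ≤ f x) = weight S w (fun y => f y < f x ∨ y = x) :=
    weight_congr fun y hy => by
      constructor
      · intro h
        rcases h.lt_or_eq with h | h
        · exact .inl h
        · exact .inr (hf hy hx h)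
      · rintro (h | rfl)
        · exact h.le
        · exact le_rfl
  rw [h1, ← weight_add (by rintro y - h rfl; exact h.false)]
  congr 1
  unfold weight
  rw [filter_eq' S x, if_pos hx, sum_singleton]

/-- An assignment can be replaced by a monotone one, with little loss for each player. -/
theorem exists_monotone (S : Finset X) (hf : Set.InjOn f S) (hg : Function.Injective g)
    (hw : ∀ x ∈ S, 0 < w x) {M : ℝ} (hM : 0 < M) (hwM : ∀ x ∈ S, w x ≤ M) :
    ∃ A : X → Y, (∀ x ∈ S, ∀ x' ∈ S, f x ≤ f x' → g (A x) ≤ g (A x')) ∧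
      (∀ x ∈ S, ∃ y ∈ S, ∃ z ∈ S, f y ≤ f x ∧ f x ≤ f z ∧ g (A x) ≤ g (B y) ∧ g (B z) ≤ g (A x)) ∧
      (∀ x ∈ S, ∃ y ∈ S, A x = B y) ∧
      ∀ q, weight S w (fun x => B x = q) - M < weight S w (fun x => A x = q) := by
  classical
  -- Lay the items on a line in the order of `f`; item `x` starts at `pre x`. In the order of `g`,
  -- the block of player `q` ends at `ble q` and is as long as its share under `B`. `A x` is the
  -- first player occurring in `B` whose block ends after the start of `x`.
  set pre : X → ℝ := fun x => weight S w (fun y => f y < f x) with hpre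
  set ble : Y → ℝ := fun q => weight S w (fun y => g (B y) ≤ g q) with hble
  have ex : ∀ x, ∃ q, x ∈ S → (∃ y ∈ S, q = B y) ∧ pre x < ble q ∧
      ∀ y ∈ S, pre x < ble (B y) → g q ≤ g (B y) := by
    intro x
    by_cases hx : x ∈ S
    · obtain ⟨y0, hy0, hmax⟩ := exists_max_image S (fun y => g (B y)) ⟨x, hx⟩
      have hne : ({y ∈ S | pre x < ble (B y)} : Finset X).Nonempty := by
        refine ⟨y0, mem_filter.2 ⟨hy0, ?_⟩⟩
        have h1 : weight S w (fun y => f y ≤ f x) ≤ ble (B y0) :=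
          weight_mono hw fun y hy _ => hmax y hy
        rw [weight_eq_of_mem hx hf] at h1
        have := hw x hx
        simp only [hpre]
        linarith
      obtain ⟨y, hy, hmin⟩ := exists_min_image _ (fun y => g (B y)) hne
      rw [mem_filter] at hy
      exact ⟨B y, fun _ => ⟨⟨y, hy.1, rfl⟩, hy.2, fun z hz h =>
        hmin z (mem_filter.2 ⟨hz, h⟩)⟩⟩
    · exact ⟨B x, fun h => absurd h hx⟩
  choose A hA using ex
  have hlt : ∀ x ∈ S, weight S w (fun y => g (B y) < g (A x)) ≤ pre x := by
    intro x hx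
    obtain ⟨-, -, h3⟩ := hA x hx
    rcases ({y ∈ S | g (B y) < g (A x)} : Finset X).eq_empty_or_nonempty with h | h
    · have : weight S w (fun y => g (B y) < g (A x)) = 0 :=
        weight_eq_zero (filter_eq_empty_iff.1 h)
      rw [this]
      exact weight_nonneg hw _
    · obtain ⟨y, hy, hmax⟩ := exists_max_image _ (fun y => g (B y)) h
      rw [mem_filter] at hy
      by_contra hcon
      have h4 : weight S w (fun y => g (B y) < g (A x)) ≤ ble (B y) :=
        weight_mono hw fun z hz hz' => hmax z (mem_filter.2 ⟨hz, hz'⟩)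
      have := h3 y hy.1 (by linarith)
      omega
  refine ⟨A, ?_, ?_, fun x hx => (hA x hx).1, ?_⟩
  · intro x hx x' hx' hxx
    obtain ⟨⟨y, hy, e⟩, h2, -⟩ := hA x' hx'
    obtain ⟨-, -, h3⟩ := hA x hx
    rw [e] at h2 ⊢
    refine h3 y hy (lt_of_le_of_lt (weight_mono hw fun z _ hz => ?_) h2)
    omega
  · intro x hx
    obtain ⟨-, h2, -⟩ := hA x hx
    have h1 := hlt x hx
    -- Otherwise `B` gives all items up to `x` to players before `A x`. Their blocks end no later
    -- than the start of `x`, which leaves no room for `w x > 0`.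
    have hy : ∃ y ∈ S, f y ≤ f x ∧ g (A x) ≤ g (B y) := by
      by_contra! hcon
      have h3 : weight S w (fun y => f y ≤ f x) ≤ weight S w (fun y => g (B y) < g (A x)) :=
        weight_mono hw fun y hy h => hcon y hy h
      rw [weight_eq_of_mem hx hf] at h3
      have := hw x hx
      simp only [hpre] at h1
      linarith
    -- Otherwise everything that `B` gives to players up to `A x` lies before `x`, and the block of
    -- `A x` ends before `x` starts.
    have hz : ∃ z ∈ S, f x ≤ f z ∧ g (B z) ≤ g (A x) := by
      by_contra! hcon
      have h3 : ble (A x) ≤ pre x := weight_mono hw fun y hy h => by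
        by_contra h'
        exact absurd (hcon y hy (not_lt.1 h')) (by omega)
      linarith
    obtain ⟨y, hy, hy1, hy2⟩ := hy
    obtain ⟨z, hz, hz1, hz2⟩ := hz
    exact ⟨y, hy, z, hz, hy1, hz1, hy2, hz2⟩
  · intro q
    by_cases hq : ∃ y ∈ S, B y = q
    · obtain ⟨y0, hy0, rfl⟩ := hq
      set q := B y0
      set blt : ℝ := weight S w (fun y => g (B y) < g q) with hblt
      have hin : ∀ x ∈ S, blt ≤ pre x → pre x < ble q → A x = q := by
        intro x hx h1 h2
        obtain ⟨⟨y, hy, e⟩, h4, h5⟩ := hA x hx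
        have h6 := h5 y0 hy0 h2
        refine hg (h6.antisymm ?_)
        by_contra h7
        have h8 : g (A x) < g q := not_le.1 h7
        have : ble (A x) ≤ blt := weight_mono hw fun z _ hz => lt_of_le_of_lt hz h8
        linarith
      -- Items that start before the block of `q` can protrude into it only by less than the length
      -- of the last one.
      have hT : weight S w (fun x => pre x < blt) < blt + M := by
        rcases ({x ∈ S | pre x < blt} : Finset X).eq_empty_or_nonempty with h | h
        · have : weight S w (fun x => pre x < blt) = 0 :=
            weight_eq_zero (filter_eq_empty_iff.1 h)
          have h0 : 0 ≤ blt := weight_nonneg hw _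
          linarith
        · obtain ⟨x, hx, hmax⟩ := exists_max_image _ f h
          rw [mem_filter] at hx
          have h1 : weight S w (fun x => pre x < blt) ≤ weight S w (fun y => f y ≤ f x) :=
            weight_mono hw fun z hz hz' => hmax z (mem_filter.2 ⟨hz, hz'⟩)
          rw [weight_eq_of_mem hx.1 hf] at h1
          have h2 := hx.2
          have h3 := hwM x hx.1
          simp only [hpre] at h2
          linarith
      -- Items that start before the end of the block cover the line up to that end. Subtracting the
      -- items of `hT` leaves the share of `q`.
      have hU : ble q ≤ weight S w (fun x => pre x < ble q) := by
        rcases ({x ∈ S | ¬ pre x < ble q} : Finset X).eq_empty_or_nonempty with h | h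
        · refine weight_mono hw fun y hy _ => ?_
          by_contra hcon
          exact notMem_empty y (h ▸ mem_filter.2 ⟨hy, hcon⟩)
        · obtain ⟨x, hx, hmin⟩ := exists_min_image _ f h
          rw [mem_filter] at hx
          refine (not_lt.1 hx.2).trans (weight_mono hw fun z hz hz' => ?_)
          by_contra hcon
          have := hmin z (mem_filter.2 ⟨hz, hcon⟩)
          omega
      have h1 : weight S w (fun x => B x = q) + blt = ble q := by
        rw [hblt, hble, weight_add (by rintro x - h; rw [h]; exact lt_irrefl _)]
        refine weight_congr fun x hx => ?_
        constructor
        · rintro (h | h)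
          · rw [h]
          · exact h.le
        · intro h
          rcases h.lt_or_eq with h | h
          · exact .inr h
          · exact .inl (hg h)
      have h2 : weight S w (fun x => pre x < ble q) ≤
          weight S w (fun x => A x = q) + weight S w (fun x => pre x < blt) := by
        have h3 : weight S w (fun x => A x = q ∧ ¬ pre x < blt) ≤ weight S w (fun x => A x = q) :=
          weight_mono hw fun x _ h => h.1
        have h4 : weight S w (fun x => pre x < ble q) ≤
            weight S w (fun x => (A x = q ∧ ¬ pre x < blt) ∨ pre x < blt) :=
          weight_mono hw fun x hx h => by
            by_cases h5 : pre x < blt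
            · exact .inr h5
            · exact .inl ⟨hin x hx (not_lt.1 h5) h, h5⟩
        rw [← weight_add (fun x _ h => h.2)] at h4
        linarith
      linarith
    · have : weight S w (fun x => B x = q) = 0 := weight_eq_zero fun x hx h => hq ⟨x, hx, h⟩
      rw [this]
      have := weight_nonneg hw (fun x => A x = q)
      linarith

/-- An assignment can be replaced by one that is monotone on each class of items. Each player gets
at least as many items of each positive class, and almost the same value from the items of
class `0`. -/
theorem exists_classwise_monotone (S : Finset X) (cls : X → ℕ) (hf : Set.InjOn f S)
    (hg : Function.Injective g) (hw : ∀ x ∈ S, 0 < w x) {M : ℝ} (hM : 0 < M)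
    (hwM : ∀ x ∈ S, cls x = 0 → w x ≤ M) :
    ∃ A : X → Y, (∀ x ∈ S, ∀ x' ∈ S, cls x = cls x' → f x ≤ f x' → g (A x) ≤ g (A x')) ∧
      (∀ x ∈ S, ∃ y ∈ S, ∃ z ∈ S, f y ≤ f x ∧ f x ≤ f z ∧ g (A x) ≤ g (B y) ∧ g (B z) ≤ g (A x)) ∧
      (∀ x ∈ S, ∃ y ∈ S, A x = B y) ∧
      (∀ q, weight S w (fun x => cls x = 0 ∧ B x = q) - M <
        weight S w (fun x => cls x = 0 ∧ A x = q)) ∧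
      ∀ c, c ≠ 0 → ∀ q, weight S (fun _ => 1) (fun x => cls x = c ∧ B x = q) ≤
        weight S (fun _ => 1) (fun x => cls x = c ∧ A x = q) := by
  classical
  -- Class 0 is balanced by value; the other classes by number, with unit weights and `M = 1`, where
  -- the strict bound rounds to no loss at all.
  have ex : ∀ c, ∃ A : X → Y, _ := fun c =>
    exists_monotone (B := B) (w := if c = 0 then w else fun _ => 1) (M := if c = 0 then M else 1)
      ({x ∈ S | cls x = c} : Finset X)
      (hf.mono (by intro x; simp +contextual)) hg (by
        intro x hx
        rw [mem_filter] at hx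
        split_ifs
        · exact hw x hx.1
        · exact one_pos) (by split_ifs; exacts [hM, one_pos]) (by
        intro x hx
        rw [mem_filter] at hx
        split_ifs with e
        · exact hwM x hx.1 (hx.2.trans e)
        · exact le_rfl)
  choose A hA using ex
  have hcg : ∀ c (w' : X → ℝ) q, weight S w' (fun x => cls x = c ∧ A (cls x) x = q) =
      weight S w' (fun x => cls x = c ∧ A c x = q) := fun c w' q =>
    weight_congr fun x _ => and_congr_right fun h => by rw [h]
  refine ⟨fun x => A (cls x) x, ?_, ?_, ?_, ?_, ?_⟩
  · intro x hx x' hx' hc hxx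
    have : g (A (cls x) x) ≤ g (A (cls x) x') :=
      (hA (cls x)).1 x (mem_filter.2 ⟨hx, rfl⟩) x' (mem_filter.2 ⟨hx', hc.symm⟩) hxx
    rwa [show A (cls x) x' = A (cls x') x' by rw [hc]] at this
  · intro x hx
    obtain ⟨y, hy, z, hz, h⟩ := (hA (cls x)).2.1 x (mem_filter.2 ⟨hx, rfl⟩)
    exact ⟨y, (mem_filter.1 hy).1, z, (mem_filter.1 hz).1, h⟩
  · intro x hx
    obtain ⟨y, hy, h⟩ := (hA (cls x)).2.2.1 x (mem_filter.2 ⟨hx, rfl⟩)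
    exact ⟨y, (mem_filter.1 hy).1, h⟩
  · intro q
    have := (hA 0).2.2.2 q
    rw [if_pos rfl, if_pos rfl, weight_filter, weight_filter] at this
    rwa [hcg]
  · intro c hc q
    have := (hA c).2.2.2 q
    rw [if_neg hc, if_neg hc, weight_filter, weight_filter] at this
    rw [hcg]
    exact weight_one_le this

end

/-! ### The value kept when the numbers of items in the classes are kept. -/

section

variable {X : Type*} {w : X → ℝ} {S : Finset X}

theorem weight_le_mul {c : ℝ} {P : X → Prop} (h : ∀ x ∈ S, P x → w x ≤ c) :
    weight S w P ≤ c * weight S (fun _ => 1) P := by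
  classical
  rw [weight, weight, mul_sum]
  refine sum_le_sum fun x hx => ?_
  rw [mem_filter] at hx
  rw [mul_one]
  exact h x hx.1 hx.2

theorem mul_le_weight {c : ℝ} {P : X → Prop} (h : ∀ x ∈ S, P x → c ≤ w x) :
    c * weight S (fun _ => 1) P ≤ weight S w P := by
  classical
  rw [weight, weight, mul_sum]
  refine sum_le_sum fun x hx => ?_
  rw [mem_filter] at hx
  rw [mul_one]
  exact h x hx.1 hx.2

theorem sum_weight_classes (cls : X → ℕ) (E : ℕ) (P : X → Prop) :
    ∑ c ∈ range E, weight S w (fun x => cls x = c ∧ P x) =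
      weight S w (fun x => cls x < E ∧ P x) := by
  classical
  simp only [weight, sum_filter]
  rw [sum_comm]
  refine sum_congr rfl fun x _ => ?_
  by_cases h : P x <;> simp [h]

theorem single_le_weight (hw : ∀ x ∈ S, 0 < w x) {P : X → Prop} {x : X} (hx : x ∈ S) (hP : P x) :
    w x ≤ weight S w P := by
  classical
  exact single_le_sum (f := w) (fun y hy => (hw y (mem_filter.1 hy).1).le)
    (mem_filter.2 ⟨hx, hP⟩)

/-- A bundle with value at least `t` and a bundle that has at least as many items in each positive
class, and almost the same value in class `0`. -/
theorem le_weight_of_classes (hw : ∀ x ∈ S, 0 < w x) {cls : X → ℕ} {E : ℕ} (hE : 0 < E)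
    {t l : ℝ} (ht : 0 < t) (hl : 0 < l) (hl1 : l ≤ 1) (hcE : ∀ x ∈ S, cls x ≤ E)
    (hlow : ∀ x ∈ S, ∀ c, cls x = c + 1 → t * l ^ (E - c) ≤ w x)
    (hupp : ∀ x ∈ S, cls x < E → w x ≤ t * l ^ (E - cls x))
    {P Q : X → Prop} (hP : t ≤ weight S w P)
    (h0 : weight S w (fun x => cls x = 0 ∧ P x) - t * l ^ E <
      weight S w (fun x => cls x = 0 ∧ Q x))
    (h1 : ∀ c, c ≠ 0 → weight S (fun _ => 1) (fun x => cls x = c ∧ P x) ≤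
      weight S (fun _ => 1) (fun x => cls x = c ∧ Q x)) :
    t * (l - l ^ E) ≤ weight S w Q := by
  have hlE : 0 < t * l ^ E := by positivity
  -- Values in the top class have no upper bound, so equal numbers say little there. But a single
  -- such item is worth at least `t * l`, which is enough.
  by_cases hbig : ∃ x ∈ S, cls x = E ∧ P x
  · obtain ⟨x, hx, hx'⟩ := hbig
    have h2 : (1 : ℝ) ≤ weight S (fun _ => 1) (fun x => cls x = E ∧ P x) :=
      single_le_weight (w := fun _ => (1 : ℝ)) (fun _ _ => one_pos) hx hx'
    have h3 := h2.trans (h1 E hE.ne')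
    have h4 : ∃ y ∈ S, cls y = E ∧ Q y := by
      by_contra! hcon
      rw [weight_eq_zero (fun y hy h => hcon y hy h.1 h.2)] at h3
      linarith
    obtain ⟨y, hy, hyc, hyQ⟩ := h4
    have h5 := hlow y hy (E - 1) (by omega)
    rw [show E - (E - 1) = 1 by omega, pow_one] at h5
    have h6 := single_le_weight hw hy hyQ
    linarith
  · have h2 : weight S w P = weight S w (fun x => cls x < E ∧ P x) :=
      weight_congr fun x hx => ⟨fun h => ⟨lt_of_le_of_ne (hcE x hx)
        fun e => hbig ⟨x, hx, e, h⟩, h⟩, fun h => h.2⟩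
    rw [h2, ← sum_weight_classes] at hP
    have h3 : ∑ c ∈ range E, weight S w (fun x => cls x = c ∧ Q x) ≤ weight S w Q := by
      rw [sum_weight_classes]
      exact weight_mono hw fun x _ h => h.2
    refine le_trans ?_ h3
    -- In class `c + 1` the values lie between `t * l ^ (E - c)` and `t * l ^ (E - (c + 1))`, so
    -- keeping the number costs at most the factor `l`. Class 0 brings the additive loss, counted
    -- once.
    have h4 : ∀ c ∈ range E, l * weight S w (fun x => cls x = c ∧ P x) -
        (if c = 0 then t * l ^ E else 0) ≤ weight S w (fun x => cls x = c ∧ Q x) := by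
      intro c hc
      have hcE' := mem_range.1 hc
      have hnn := weight_nonneg hw (fun x => cls x = c ∧ P x)
      rcases c with _ | c
      · rw [if_pos rfl]
        nlinarith
      · rw [if_neg (by omega), sub_zero]
        have k1 : weight S w (fun x => cls x = c + 1 ∧ P x) ≤
            t * l ^ (E - (c + 1)) * weight S (fun _ => 1) (fun x => cls x = c + 1 ∧ P x) :=
          weight_le_mul fun x hx h => by
            rw [← h.1]; exact hupp x hx (by omega)
        have k2 : t * l ^ (E - c) * weight S (fun _ => 1) (fun x => cls x = c + 1 ∧ Q x) ≤
            weight S w (fun x => cls x = c + 1 ∧ Q x) :=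
          mul_le_weight fun x hx h => hlow x hx c h.1
        have k3 := h1 (c + 1) (by omega)
        have e : l ^ (E - c) = l * l ^ (E - (c + 1)) := by
          rw [← pow_succ']; congr 1; omega
        refine le_trans ?_ k2
        calc l * weight S w (fun x => cls x = c + 1 ∧ P x)
            ≤ l * (t * l ^ (E - (c + 1)) *
              weight S (fun _ => 1) (fun x => cls x = c + 1 ∧ P x)) :=
              mul_le_mul_of_nonneg_left k1 hl.le
          _ = t * l ^ (E - c) * weight S (fun _ => 1) (fun x => cls x = c + 1 ∧ P x) := by
              rw [e]; ring
          _ ≤ _ := mul_le_mul_of_nonneg_left k3 (by positivity)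
    refine le_trans ?_ (sum_le_sum h4)
    rw [sum_sub_distrib, ← mul_sum, sum_ite_eq' (range E) 0, if_pos (mem_range.2 hE)]
    nlinarith

end

/-! ### Counting thresholds and encoding digits. -/

/-- The number of elements of an initial segment. -/
theorem lt_card_filter_iff {E : ℕ} {P : ℕ → Prop} [DecidablePred P]
    (hP : ∀ c d, c ≤ d → P d → P c) {c : ℕ} (hc : c < E) : c < #{d ∈ range E | P d} ↔ P c := by
  constructor
  · intro h
    by_contra hn
    have : ({d ∈ range E | P d} : Finset ℕ) ⊆ range c := fun d hd => by
      rw [mem_filter] at hd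
      rw [mem_range]
      by_contra hcd
      exact hn (hP c d (by omega) hd.2)
    have := card_le_card this
    rw [card_range] at this
    omega
  · intro h
    have : range (c + 1) ⊆ ({d ∈ range E | P d} : Finset ℕ) := fun d hd => by
      rw [mem_range] at hd
      exact mem_filter.2 ⟨mem_range.2 (by omega), hP d c (by omega) h⟩
    have := card_le_card this
    rw [card_range] at this
    omega

/-- Every sequence of digits belongs to a number. -/
theorem exists_digits (b D : ℕ) (d : ℕ → ℕ) (hd : ∀ c < D, d c < b) :
    ∃ u < b ^ D, ∀ c < D, u / b ^ c % b = d c := by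
  induction D with
  | zero => exact ⟨0, by simp, by simp⟩
  | succ D ih =>
    obtain ⟨u, hu, hu'⟩ := ih fun c hc => hd c (by omega)
    have hb : 0 < b := by have := hd D (by omega); omega
    refine ⟨u + d D * b ^ D, ?_, fun c hc => ?_⟩
    · have h1 : (d D + 1) * b ^ D ≤ b * b ^ D := Nat.mul_le_mul_right _ (hd D (by omega))
      rw [pow_succ']
      linarith
    · by_cases e : c = D
      · subst e
        rw [Nat.add_mul_div_right _ _ (by positivity), Nat.div_eq_of_lt hu, zero_add,
          Nat.mod_eq_of_lt (hd c (by omega))]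
      · have h1 : d D * b ^ D = (d D * b ^ (D - c - 1) * b) * b ^ c := by
          rw [mul_assoc, mul_assoc, ← pow_succ', ← pow_add]
          congr 2
          omega
        rw [h1, Nat.add_mul_div_right _ _ (by positivity), Nat.add_mul_mod_self_right]
        exact hu' c (by omega)

end SantaClaus

namespace SantaClaus
namespace Ram

/-! ### The right guess -/

/-- `adj` and `v` describe the instance `H`. -/
structure Describes {m n : ℕ} (H : Instance m n) (adj : ℕ → ℕ → Prop) (v : ℕ → ℚ) : Prop where
  adj_iff : ∀ (i : Fin m) (j : Fin n), adj i j ↔ H.adj i j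
  val_eq : ∀ i : Fin m, v i = H.v i
  val_last : v m = 0

theorem Describes.adjV_eq {m n : ℕ} {H : Instance m n} {adj : ℕ → ℕ → Prop} {v : ℕ → ℚ}
    (hd : Describes H adj v) : adjV adj = H.graph := by
  ext x y
  rcases x with x | x <;> rcases y with y | y <;> simp [adjV, Instance.graph, hd.adj_iff]

/-- An index of a value that separates the values below `θ` from the other ones. -/
theorem Describes.exists_threshold {m n : ℕ} {H : Instance m n} {adj : ℕ → ℕ → Prop} {v : ℕ → ℚ}
    (hd : Describes H adj v) (θ : ℝ) :
    ∃ z < m + 1, ∀ i : Fin m, v z < v i ↔ θ ≤ (H.v i : ℝ) := by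
  classical
  rcases ({i : Fin m | (H.v i : ℝ) < θ} : Finset (Fin m)).eq_empty_or_nonempty with h | h
  · refine ⟨m, by omega, fun i => ?_⟩
    have : i ∉ ({i : Fin m | (H.v i : ℝ) < θ} : Finset (Fin m)) := by rw [h]; exact notMem_empty i
    rw [mem_filter] at this
    rw [hd.val_last, hd.val_eq]
    exact ⟨fun _ => not_lt.1 fun h' => this ⟨mem_univ i, h'⟩, fun _ => H.v_pos i⟩
  · obtain ⟨z, hz, hmax⟩ := exists_max_image _ (fun i => H.v i) h
    rw [mem_filter] at hz
    refine ⟨z, by omega, fun i => ?_⟩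
    rw [hd.val_eq, hd.val_eq]
    constructor
    · intro h1
      by_contra h2
      have := hmax i (mem_filter.2 ⟨mem_univ i, not_le.1 h2⟩)
      exact absurd h1 (not_lt.2 this)
    · intro h1
      exact_mod_cast hz.2.trans_le h1

/-- The items that are reached. -/
def reachedItems (m : ℕ) (f : Mem) : Finset (Fin m) := {i | 1 ≤ f.I .lev i}

theorem mem_reachedItems {m : ℕ} {f : Mem} {i : Fin m} :
    i ∈ reachedItems m f ↔ 1 ≤ f.I .lev i := by simp [reachedItems]

/-- The position of an item in the sorted sequence of items. -/
def itemRank {m : ℕ} (f : Mem) (i : Fin m) : ℕ := f.I .key i * (m + 1) + i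

/-- The position of a player in the sorted sequence of players. -/
def playerRank {n : ℕ} (f : Mem) (j : Fin n) : ℕ := f.I .keyp j * (n + 1) + j

theorem lex_le {d a b i j : ℕ} (hi : i < d) (hj : j < d) :
    a * (d + 1) + i ≤ b * (d + 1) + j ↔ a < b ∨ a = b ∧ i ≤ j := by
  constructor
  · intro h
    rcases lt_trichotomy a b with h1 | h1 | h1
    · exact .inl h1
    · subst h1; exact .inr ⟨rfl, by omega⟩
    · have : (b + 1) * (d + 1) ≤ a * (d + 1) := Nat.mul_le_mul_right _ h1
      rw [add_mul] at this
      omega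
  · rintro (h1 | ⟨rfl, h1⟩)
    · have : (a + 1) * (d + 1) ≤ b * (d + 1) := Nat.mul_le_mul_right _ h1
      rw [add_mul] at this
      omega
    · omega

theorem itemRank_le {m : ℕ} {f : Mem} {i i' : Fin m} : itemRank f i ≤ itemRank f i' ↔
    f.I .key i < f.I .key i' ∨ f.I .key i = f.I .key i' ∧ (i : ℕ) ≤ i' := lex_le i.2 i'.2

theorem playerRank_le {n : ℕ} {f : Mem} {j j' : Fin n} : playerRank f j ≤ playerRank f j' ↔
    f.I .keyp j < f.I .keyp j' ∨ f.I .keyp j = f.I .keyp j' ∧ (j : ℕ) ≤ j' := lex_le j.2 j'.2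

theorem itemRank_injective {m : ℕ} (f : Mem) :
    Function.Injective (itemRank f : Fin m → ℕ) := fun i i' h => by
  have h1 := itemRank_le.1 h.le
  have h2 := itemRank_le.1 h.ge
  exact Fin.ext (by omega)

theorem playerRank_injective {n : ℕ} (f : Mem) :
    Function.Injective (playerRank f : Fin n → ℕ) := fun i i' h => by
  have h1 := playerRank_le.1 h.le
  have h2 := playerRank_le.1 h.ge
  exact Fin.ext (by omega)

namespace GuessMem

variable {m n E S g : ℕ} {adj : ℕ → ℕ → Prop} {v : ℕ → ℚ} {f : Mem} {H : Instance m n}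

theorem key_inl (hf : GuessMem m n E S adj v g f) (hd : Describes H adj v) (i : Fin m) :
    StrongOrder.key Sum.isLeft H.graph (levOf m n f) (.inl i) = f.I .key i := by
  rw [StrongOrder.key, Fintype.sum_sum_type, hf.key i i.2, ← Fin.sum_univ_eq_sum_range (fun j =>
    keyTerm (adj i j) (f.I .lev i) (f.I .levp j))]
  simp [levOf, Instance.graph, hd.adj_iff]

theorem key_inr (hf : GuessMem m n E S adj v g f) (hd : Describes H adj v) (j : Fin n) :
    StrongOrder.key Sum.isLeft H.graph (levOf m n f) (.inr j) = f.I .keyp j := by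
  rw [StrongOrder.key, Fintype.sum_sum_type, hf.keyp j j.2, ← Fin.sum_univ_eq_sum_range (fun i =>
    keyTerm (adj i j) (f.I .levp j) (f.I .lev i))]
  simp [levOf, Instance.graph, hd.adj_iff]

/-- An edge between two crossing edges, in the order of the keys. -/
theorem cross (hf : GuessMem m n E S adj v g f) (hd : Describes H adj v)
    {pos : Equiv.Perm (Fin m)} (ha : H.AdjacencyProperty pos) (he : H.EnclosureProperty pos)
    {r : Fin m} (hL : Levels (2 * m + 2 * n + 1) H.graph (· = .inl r) (levOf m n f))
    (hmin : ∀ i ∈ reachedItems m f, pos r ≤ pos i) {x y z x₀ : Fin m} {B : Fin m → Fin n}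
    (hB : ∀ i, H.adj i (B i)) {q : Fin n} (hx : x ∈ reachedItems m f)
    (hy : y ∈ reachedItems m f) (hz : z ∈ reachedItems m f) (hx₀ : x₀ ∈ reachedItems m f)
    (hyx : itemRank f y ≤ itemRank f x) (hxz : itemRank f x ≤ itemRank f z)
    (hq : playerRank f q ≤ playerRank f (B y)) (hq' : playerRank f (B z) ≤ playerRank f q)
    (hq₀ : H.adj x₀ q) : H.adj x q := by
  have hso := (Instance.strongOrder ha he).of_key (B := 2 * m + 2 * n + 1)
    (by simp only [Fintype.card_sum, Fintype.card_fin]; omega) hL (by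
      intro w hw hw0 hR
      rcases w with i | j
      · have h1 := hmin i (mem_reachedItems.2 (by simp [levOf] at hw0; omega))
        rw [pos.injective (le_antisymm h1 hR)]
      · simp at hw)
  have li : ∀ i ∈ reachedItems m f, levOf m n f (.inl i) ≠ 0 := fun i hi => by
    have := mem_reachedItems.1 hi
    simp [levOf]; omega
  have lp : ∀ i ∈ reachedItems m f, ∀ j, H.adj i j → levOf m n f (.inr j) ≠ 0 :=
    fun i hi j hij => (hL.adj (.inl i) (.inr j) hij (li i hi)).1
  have ki : ∀ {i i'}, itemRank f i ≤ itemRank f i' →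
      StrongOrder.key Sum.isLeft H.graph (levOf m n f) (.inl i) ≤
        StrongOrder.key Sum.isLeft H.graph (levOf m n f) (.inl i') := fun h => by
    rw [hf.key_inl hd, hf.key_inl hd]
    have := itemRank_le.1 h
    omega
  have kp : ∀ {j j'}, playerRank f j ≤ playerRank f j' →
      StrongOrder.key Sum.isLeft H.graph (levOf m n f) (.inr j) ≤
        StrongOrder.key Sum.isLeft H.graph (levOf m n f) (.inr j') := fun h => by
    rw [hf.key_inr hd, hf.key_inr hd]
    have := playerRank_le.1 h
    omega
  exact hso.cross_between (x := ⟨.inl x, li x hx⟩) (y := ⟨.inl y, li y hy⟩)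
    (z := ⟨.inl z, li z hz⟩) (p := ⟨.inr (B y), lp y hy _ (hB y)⟩)
    (q := ⟨.inr q, lp x₀ hx₀ _ hq₀⟩) (r := ⟨.inr (B z), lp z hz _ (hB z)⟩) rfl rfl rfl rfl
    (ki hyx) (ki hxz) (ki (hyx.trans hxz)) (kp hq') (kp hq) (kp (hq'.trans hq)) (hB y) (hB z)
    (x' := ⟨.inr (B x), lp x hx _ (hB x)⟩) (q' := ⟨.inl x₀, li x₀ hx₀⟩) (hB x) hq₀

/-- The players before a position are an initial segment of the sorted players, and `A` is monotone
on each class, so their items form a prefix of every class. Its last item gives the digit of that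
class. -/
theorem exists_state {A : Fin m → Fin n} (hf : GuessMem m n E ((m + 1) ^ (E + 1)) adj v g f)
    (hmono : ∀ x ∈ reachedItems m f, ∀ x' ∈ reachedItems m f, f.I .cls x = f.I .cls x' →
      itemRank f x ≤ itemRank f x' → playerRank f (A x) ≤ playerRank f (A x'))
    (hreach : ∀ x ∈ reachedItems m f, 1 ≤ f.I .levp (A x)) (k j : ℕ) :
    ∃ u < (m + 1) ^ (E + 1), ∀ i : Fin m,
      (InState E f u i ↔ 1 ≤ f.I .lev i ∧ Before f k j (A i)) := by
  classical
  have ex : ∀ c, ∃ y < m + 1, ∀ i ∈ reachedItems m f, f.I .cls i = c →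
      (¬ (f.I .key y ≤ f.I .key i ∧ ¬ (f.I .key i ≤ f.I .key y ∧ (i : ℕ) ≤ y)) ↔
        Before f k j (A i)) := by
    intro c
    rcases ({i ∈ reachedItems m f | f.I .cls i = c ∧ Before f k j (A i)} :
      Finset (Fin m)).eq_empty_or_nonempty with h | h
    -- An empty prefix is named by the index `m`, whose key 0 is smaller than all keys of reached
    -- items.
    · refine ⟨m, by omega, fun i hi hc => ?_⟩
      have h1 : ¬ Before f k j (A i) := fun h1 =>
        notMem_empty i (h ▸ mem_filter.2 ⟨hi, hc, h1⟩)
      have h2 : f.I .lev i ≤ f.I .key i := by rw [hf.key i i.2]; omega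
      have h3 := mem_reachedItems.1 hi
      rw [hf.key_last]
      simp only [h1, iff_false, not_not]
      omega
    · obtain ⟨y, hy, hmax⟩ := exists_max_image _ (itemRank f) h
      rw [mem_filter] at hy
      refine ⟨y, by omega, fun i hi hc => ?_⟩
      have h1 : Before f k j (A i) ↔ itemRank f i ≤ itemRank f y := by
        constructor
        · exact fun h1 => hmax i (mem_filter.2 ⟨hi, hc, h1⟩)
        · intro h1
          have h2 := playerRank_le.1 (hmono i hi y hy.1 (hc.trans hy.2.1.symm) h1)
          have h3 := hy.2.2.2
          refine ⟨hreach i hi, ?_⟩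
          omega
      rw [h1, itemRank_le]
      omega
  choose d hd hd' using ex
  obtain ⟨u, hu, hu'⟩ := exists_digits (m + 1) (E + 1) d fun c _ => hd c
  refine ⟨u, hu, fun i => ?_⟩
  have hc : f.I .cls i < E + 1 := by
    rw [hf.cls i i.2]
    have := card_filter_le (range E) (fun c => v (g / (m + 1) ^ (c + 1) % (m + 1)) < v i)
    rw [card_range] at this
    omega
  unfold InState
  rw [hf.dig u hu _ hc, hu' _ hc]
  refine and_congr_right fun hl => ?_
  exact hd' _ i (mem_reachedItems.2 hl) rfl

end GuessMem

namespace GuessMem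

variable {m n E S g : ℕ} {adj : ℕ → ℕ → Prop} {v : ℕ → ℚ} {f : Mem} {H : Instance m n}

/-- If the guess is right, then the dynamic program can follow an assignment that is almost as
good as a given one. -/
theorem exists_target (hf : GuessMem m n E ((m + 1) ^ (E + 1)) adj v g f) (hd : Describes H adj v)
    {pos : Equiv.Perm (Fin m)} (ha : H.AdjacencyProperty pos) (he : H.EnclosureProperty pos)
    {r : Fin m} (hr : g % (m + 1) = r)
    (hmin : ∀ i, Relation.ReflTransGen H.graph (.inl r) (.inl i) → pos r ≤ pos i)
    {t l : ℝ} (ht : 0 < t) (hl : 0 < l) (hl1 : l ≤ 1) (hE : 0 < E)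
    (hcls : ∀ c < E, ∀ i : Fin m,
      v (g / (m + 1) ^ (c + 1) % (m + 1)) < v i ↔ t * l ^ (E - c) ≤ (H.v i : ℝ))
    {B : Fin m → Fin n} (hB : H.IsTAssignment t B) (hn : 0 < n) :
    ∃ A, Target E f A (t * (l - l ^ E)) := by
  classical
  have hL := hf.levels
  have hroot : (isItem (g % (m + 1)) : Fin m ⊕ Fin n → Prop) = (· = .inl r) := by
    ext x
    rcases x with x | x
    · simp [isItem, hr, Fin.ext_iff]
    · simp [isItem]
  rw [hroot, hd.adjV_eq] at hL
  have hsym : ∀ {x y}, H.graph x y → H.graph y x := (Instance.strongOrder ha he).symm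
  have hmin' : ∀ i ∈ reachedItems m f, pos r ≤ pos i := fun i hi => by
    refine hmin i ((hL.reached_iff (by omega) hsym _).1 ?_)
    have := mem_reachedItems.1 hi
    simp [levOf]; omega
  set w : Fin m → ℝ := fun i => H.v i with hw
  have hwpos : ∀ x ∈ reachedItems m f, 0 < w x := fun x _ => by
    exact Rat.cast_pos.2 (H.v_pos x)
  have hcard : ∀ i : Fin m, f.I .cls i = #{c ∈ range E | t * l ^ (E - c) ≤ w i} := fun i => by
    rw [hf.cls i i.2]
    congr 1
    exact filter_congr fun c hc => hcls c (mem_range.1 hc) i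
  have hPmono : ∀ i : Fin m, ∀ c d, c ≤ d → t * l ^ (E - d) ≤ w i → t * l ^ (E - c) ≤ w i :=
    fun i c d hcd h => le_trans (mul_le_mul_of_nonneg_left
      (pow_le_pow_of_le_one hl.le hl1 (by omega)) ht.le) h
  have hcE : ∀ i : Fin m, f.I .cls i ≤ E := fun i => by
    rw [hcard]
    exact (card_filter_le _ _).trans_eq (card_range E)
  have hlow : ∀ i : Fin m, ∀ c, f.I .cls i = c + 1 → t * l ^ (E - c) ≤ w i := fun i c h => by
    have := hcE i
    refine (lt_card_filter_iff (hPmono i) (show c < E by omega)).1 ?_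
    rw [← hcard]
    omega
  have hupp : ∀ i : Fin m, f.I .cls i < E → w i ≤ t * l ^ (E - f.I .cls i) := fun i h => by
    have := mt (lt_card_filter_iff (hPmono i) h).2
    rw [← hcard] at this
    exact (not_le.1 (this (lt_irrefl _))).le
  -- Items of class 0 have not passed the smallest threshold `t * l ^ E`, which therefore bounds the
  -- loss there.
  obtain ⟨A, hA1, hA2, hA3, hA4, hA5⟩ := exists_classwise_monotone (B := B) (w := w)
    (M := t * l ^ E) (reachedItems m f) (fun i => f.I .cls i)
    ((itemRank_injective f).injOn) (playerRank_injective f) hwpos (by positivity) (by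
      intro x _ h
      have := hupp x (by omega)
      rwa [h] at this)
  -- The item `x` lies between `y` and `z`, and `A x` between `B z` and `B y`, so the edges of `B`
  -- at `y` and `z` cross around the pair. The item `x₀` shows that `A x` has a reached neighbour.
  have hfeas : ∀ x ∈ reachedItems m f, H.adj x (A x) := fun x hx => by
    obtain ⟨y, hy, z, hz, h1, h2, h3, h4⟩ := hA2 x hx
    obtain ⟨x₀, hx₀, h5⟩ := hA3 x hx
    exact hf.cross hd ha he hL hmin' hB.1 hx hy hz hx₀ h1 h2 h3 h4 (h5 ▸ hB.1 x₀)
  have hreach : ∀ x ∈ reachedItems m f, 1 ≤ f.I .levp (A x) := fun x hx =>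
    (hf.reached_iff x.2 (A x).2 ((hd.adj_iff _ _).2 (hfeas x hx))).1 (mem_reachedItems.1 hx)
  set A' : ℕ → ℕ := fun i => if h : i < m then A ⟨i, h⟩ else 0 with hA'
  have eA : ∀ i : Fin m, A' i = A i := fun i => by simp [hA']
  have htot : ∀ j, H.utility B j ≤ ∑ i, H.v i := fun j =>
    sum_le_sum_of_subset_of_nonneg (filter_subset _ _) fun i _ _ => (H.v_pos i).le
  refine ⟨A', ?_, ?_, ?_, ?_⟩
  · intro i hi hl
    rw [hf.m_eq] at hi
    rw [hf.n_eq, hf.adj_eq]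
    have h1 := hfeas ⟨i, hi⟩ (mem_reachedItems.2 hl)
    have h2 := eA ⟨i, hi⟩
    dsimp only at h2
    rw [h2]
    exact ⟨(A ⟨i, hi⟩).2, (hd.adj_iff ⟨i, hi⟩ _).2 h1⟩
  · intro k j
    obtain ⟨u, hu, hu'⟩ := hf.exists_state hA1 hreach k j
    rw [hf.states_eq, hf.m_eq]
    refine ⟨u, hu, fun i hi => ?_⟩
    have h2 := eA ⟨i, hi⟩
    dsimp only at h2
    rw [h2]
    exact hu' ⟨i, hi⟩
  · intro p hp hlp
    rw [hf.n_eq] at hp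
    have hin : ∀ i, B i = ⟨p, hp⟩ → i ∈ reachedItems m f := fun i hi => by
      rw [mem_reachedItems, hf.reached_iff i.2 hp]
      · exact hlp
      · have := (hd.adj_iff i (B i)).2 (hB.1 i)
        rwa [hi] at this
    have hP : t ≤ weight (reachedItems m f) w (fun i => B i = ⟨p, hp⟩) := by
      refine (hB.2 ⟨p, hp⟩).trans (le_of_eq ?_)
      rw [Instance.utility, weight, Rat.cast_sum]
      refine sum_congr ?_ fun _ _ => rfl
      ext i
      simp only [mem_filter, mem_univ, true_and]
      exact ⟨fun h => ⟨hin i h, h⟩, fun h => h.2⟩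
    have hQ := le_weight_of_classes hwpos hE ht hl hl1 (fun i _ => hcE i) (fun i _ => hlow i)
      (fun i _ => hupp i) hP (hA4 ⟨p, hp⟩) (fun c hc => hA5 c hc ⟨p, hp⟩)
    refine hQ.trans (le_of_eq ?_)
    rw [hf.m_eq, hf.val_eq, sum_filter, ← Fin.sum_univ_eq_sum_range (fun i =>
      if 1 ≤ f.I .lev i ∧ A' i = p then v i else 0), Rat.cast_sum, weight, reachedItems,
      filter_filter, sum_filter]
    refine sum_congr rfl fun i _ => ?_
    rw [eA, hd.val_eq]
    by_cases h : 1 ≤ f.I .lev i ∧ A i = ⟨p, hp⟩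
    · rw [if_pos h, if_pos ⟨h.1, by rw [h.2]⟩]
    · rw [if_neg h, if_neg (fun h' => h ⟨h'.1, Fin.ext h'.2⟩), Rat.cast_zero]
  -- The total is at least the utility of a single player under `B`, hence at least `t`; this uses
  -- that there is a player.
  · rw [hf.total_eq, ← Fin.sum_univ_eq_sum_range]
    simp only [hd.val_eq]
    have h1 : (H.utility B ⟨0, hn⟩ : ℝ) ≤ ((∑ i, H.v i : ℚ) : ℝ) := by exact_mod_cast htot _
    have h2 := hB.2 ⟨0, hn⟩
    have h3 : 0 < l ^ E := by positivity
    nlinarith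

end GuessMem

/-- For every item there is a right guess. -/
theorem exists_guess {m n E : ℕ} {adj : ℕ → ℕ → Prop} {v : ℕ → ℚ} {H : Instance m n}
    (hd : Describes H adj v) {pos : Equiv.Perm (Fin m)} (ha : H.AdjacencyProperty pos)
    (he : H.EnclosureProperty pos) {t l : ℝ} (ht : 0 < t) (hl : 0 < l) (hl1 : l ≤ 1)
    (hE : 0 < E) {B : Fin m → Fin n} (hB : H.IsTAssignment t B) (hn : 0 < n) (i₀ : Fin m) :
    ∃ g < (m + 1) ^ (E + 1), ∀ f, GuessMem m n E ((m + 1) ^ (E + 1)) adj v g f →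
      1 ≤ f.I .lev i₀ ∧ ∃ A, Target E f A (t * (l - l ^ E)) := by
  classical
  have hsym : ∀ {x y}, H.graph x y → H.graph y x := (Instance.strongOrder ha he).symm
  -- The root is the leftmost item of the component in the hidden order, as the key argument
  -- requires.
  obtain ⟨r, hr, hmin⟩ := exists_min_image
    ({i | Relation.ReflTransGen H.graph (.inl i₀) (.inl i)} : Finset (Fin m)) pos
    ⟨i₀, mem_filter.2 ⟨mem_univ _, .refl⟩⟩
  have hr' : Relation.ReflTransGen H.graph (.inl i₀) (.inl r) := (mem_filter.1 hr).2
  have hr'' : Relation.ReflTransGen H.graph (.inl r) (.inl i₀) :=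
    haveI : Std.Symm H.graph := ⟨fun _ _ => hsym⟩
    Std.Symm.symm _ _ hr'
  choose z hz hz' using fun c : ℕ => hd.exists_threshold (t * l ^ (E - c))
  -- Digit 0 of the guess is the root, and digit `c + 1` is an index whose value acts as the
  -- threshold `t * l ^ (E - c)`. Neither `t` nor `l` is known to the program.
  obtain ⟨g, hg, hg'⟩ := exists_digits (m + 1) (E + 1)
    (fun c => match c with | 0 => (r : ℕ) | c + 1 => z c) (by
      rintro (_ | c) _
      · exact r.2.trans (Nat.lt_succ_self m)
      · exact hz c)
  have hgr : g % (m + 1) = r := by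
    have := hg' 0 (by omega)
    rwa [pow_zero, Nat.div_one] at this
  refine ⟨g, hg, fun f hf => ⟨?_, hf.exists_target hd ha he hgr (fun i hi => ?_) ht hl hl1 hE ?_ hB
    hn⟩⟩
  · have hL := hf.levels
    have hroot : (isItem (g % (m + 1)) : Fin m ⊕ Fin n → Prop) = (· = .inl r) := by
      ext x
      rcases x with x | x
      · simp [isItem, hgr, Fin.ext_iff]
      · simp [isItem]
    rw [hroot, hd.adjV_eq] at hL
    have := (hL.reached_iff (by omega) hsym _).2 hr''
    simp only [levOf, Sum.elim_inl] at this
    omega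
  · exact hmin i (mem_filter.2 ⟨mem_univ _, hr'.trans hi⟩)
  · intro c hc i
    rw [hg' (c + 1) (by omega)]
    exact hz' c i

/-! ### Correctness of the whole program -/

/-- The program without the conversion of the input and the output. -/
def coreProg (E : ℕ) : Prog := scalarsProg E ;; setupProg ;; mainProg E ;; outProg

theorem outProg_spec (h : Mem) :
    ∀ i < h.I .m 0, (outProg.eval h).I .out (h.I .m 0 + i) = h.I .ans i := by
  refine Prog.loop_inv (v := .i) (b := .m)
    (p := .setI .out (.add (sc .m) (sc .i)) (.rd .ans (sc .i))) (h := h)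
    (fun r g => ∀ i < r, g.I .out (h.I .m 0 + i) = h.I .ans i) (by simp) ?_
  intro r hr g hg hs hI i hi
  have e1 : g.I .m = h.I .m := hs.I (by simp)
  have e2 : g.I .ans = h.I .ans := hs.I (by simp)
  simp only [Prog.eval_setI, Mem.setI_I, reduceCtorEq, if_false, if_true, IE.eval, e1, e2, hg,
    Function.update_apply]
  by_cases e : i = r
  · rw [if_pos (by omega), e]
  · rw [if_neg (by omega)]
    exact hI i (by omega)

/-- The memory contains the instance `H`. -/
structure Holds {m n : ℕ} (H : Instance m n) (h : Mem) : Prop where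
  m_eq : h.I .inp 0 = m
  n_eq : h.I .inp 1 = n
  adj_iff : ∀ (i : Fin m) (j : Fin n), 1 ≤ h.I .inp (2 + i * n + j) ↔ H.adj i j
  val_eq : ∀ i : Fin m, h.V .val i = H.v i

/-- The scalars that bound the loops. -/
structure Scalars (m n E : ℕ) (h : Mem) : Prop where
  m_eq : h.I .m 0 = m
  n_eq : h.I .n 0 = n
  b_eq : h.I .b 0 = m + 1
  dim_eq : h.I .dim 0 = E + 1
  cls0_eq : h.I .cls0 0 = E
  unit_eq : h.I .unit 0 = 2 * m + 2 * n + 1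
  rounds_eq : h.I .rounds 0 = m + n + 1

theorem scalarsProg_spec {m n : ℕ} (E : ℕ) {h : Mem} (hm : h.I .inp 0 = m) (hn : h.I .inp 1 = n) :
    Scalars m n E ((scalarsProg E).eval h) := by
  constructor <;> simp [scalarsProg, hm, hn]
  ring

theorem Scalars.same {m n E : ℕ} {h g : Mem} {p : Prog} (he : Scalars m n E h) (hs : Same p h g)
    (hI : ∀ a ∈ ([.m, .n, .b, .dim, .cls0, .unit, .rounds] : List IName), ¬ p.ModI a) :
    Scalars m n E g where
  m_eq := by rw [hs.I (hI _ (by simp)), he.m_eq]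
  n_eq := by rw [hs.I (hI _ (by simp)), he.n_eq]
  b_eq := by rw [hs.I (hI _ (by simp)), he.b_eq]
  dim_eq := by rw [hs.I (hI _ (by simp)), he.dim_eq]
  cls0_eq := by rw [hs.I (hI _ (by simp)), he.cls0_eq]
  unit_eq := by rw [hs.I (hI _ (by simp)), he.unit_eq]
  rounds_eq := by rw [hs.I (hI _ (by simp)), he.rounds_eq]

theorem setupProg_states {m n E : ℕ} {h : Mem} (hs : Scalars m n E h) :
    (setupProg.eval h).I .states 0 = (if n ≤ m then (m + 1) ^ (E + 1) else 0) ∧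
    (setupProg.eval h).I .keys 0 = (2 * m + 2 * n + 1) * (m + n + 2) := by
  have h2 := hs.same (Prog.same rownProg h) (by simp [rownProg])
  have h3 := h2.same (Prog.same defaultProg _) (by simp [defaultProg])
  have h4 := h3.same (Prog.same statesProg _) (by simp [statesProg])
  constructor
  · have := statesProg_spec (defaultProg.eval (rownProg.eval h))
    rw [h3.m_eq, h3.n_eq, h3.b_eq, h3.dim_eq] at this
    rw [← this]
    exact congrFun ((Prog.same keyBoundProg _).I (by simp [keyBoundProg])) 0
  · have := keyBoundProg_spec (statesProg.eval (defaultProg.eval (rownProg.eval h)))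
    rw [h4.unit_eq, h4.rounds_eq] at this
    exact this

theorem setupProg_spec {m n E : ℕ} {H : Instance m n} {h : Mem} (hs : Scalars m n E h)
    (hH : Holds H h) : ∃ v : ℕ → ℚ, Describes H (AdjM (setupProg.eval h)) v ∧
      (setupProg.eval h).V .val = v ∧ (setupProg.eval h).V .total 0 = ∑ i ∈ range m, v i ∧
      (∀ i < m, (setupProg.eval h).V .best i = 0) ∧
      ∀ i < m, (setupProg.eval h).I .ans i < n ∧
        AdjM (setupProg.eval h) i ((setupProg.eval h).I .ans i) := by
  set h2 := rownProg.eval h with h2d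
  set h3 := defaultProg.eval h2 with h3d
  set h4 := statesProg.eval h3 with h4d
  have e5 : setupProg.eval h = keyBoundProg.eval h4 := rfl
  set h5 := keyBoundProg.eval h4 with h5d
  rw [e5]
  have s2 : Same rownProg h h2 := Prog.same _ _
  have s3 : Same defaultProg h2 h3 := Prog.same _ _
  have s4 : Same statesProg h3 h4 := Prog.same _ _
  have s5 : Same keyBoundProg h4 h5 := Prog.same _ _
  have k2 := hs.same s2 (by simp [rownProg])
  have hrown := rownProg_spec h
  rw [hs.m_eq, hs.n_eq] at hrown
  have adj2 : ∀ (i : Fin m) (j : Fin n), AdjM h2 i j ↔ H.adj i j := fun i j => by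
    rw [AdjM, s2.I (by simp [rownProg]), hrown i i.2]
    exact hH.adj_iff i j
  have adj53 : AdjM h5 = AdjM h3 := by
    ext i j
    refine AdjM_congr ?_ ?_ i j
    · rw [s5.I (by simp [keyBoundProg]), s4.I (by simp [statesProg])]
    · rw [s5.I (by simp [keyBoundProg]), s4.I (by simp [statesProg])]
  have adj32 : AdjM h3 = AdjM h2 := by
    ext i j
    exact AdjM_congr (s3.I (by simp [defaultProg])) (s3.I (by simp [defaultProg])) i j
  have v53 : ∀ a, h5.V a = h3.V a := fun a => by
    rw [s5.V (by simp [keyBoundProg]), s4.V (by simp [statesProg])]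
  have a53 : h5.I .ans = h3.I .ans := by
    rw [s5.I (by simp [keyBoundProg]), s4.I (by simp [statesProg])]
  obtain ⟨d1, d2, d3, d4, d5⟩ := defaultProg_spec h2
  rw [k2.m_eq] at d1 d2 d3 d4 d5
  rw [k2.n_eq] at d5
  have v2 : h2.V .val = h.V .val := s2.V (by simp [rownProg])
  refine ⟨h5.V .val, ⟨?_, ?_, ?_⟩, rfl, ?_, ?_, ?_⟩
  · rw [adj53, adj32]; exact adj2
  · intro i
    rw [v53, d1 i i.2, v2]
    exact hH.val_eq i
  · rw [v53]; exact d2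
  · rw [v53, v53, d4]
    exact sum_congr rfl fun i hi => (d1 i (mem_range.1 hi)).symm
  · rw [v53]; exact d3
  · rw [adj53, adj32, a53]
    intro i hi
    obtain ⟨j, hj⟩ := H.exists_adj ⟨i, hi⟩
    exact d5 i hi ⟨j, j.2, (adj2 ⟨i, hi⟩ j).2 hj⟩

/-- The output does not depend on `t`. For given `t` and player `j`, an item `i₀` that `B` gives to
`j` selects the component, `exists_guess` a right guess for it, and `best i₀` records what this
guess achieved, which is a lower bound for the utility of `j`. -/
theorem mainProg_spec {m n E : ℕ} {H : Instance m n} {h : Mem} {v : ℕ → ℚ}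
    (hs : Scalars m n E h) (hn : 0 < n)
    (hstates : h.I .states 0 = (if n ≤ m then (m + 1) ^ (E + 1) else 0))
    (hkeys : h.I .keys 0 = (2 * m + 2 * n + 1) * (m + n + 2)) (hd : Describes H (AdjM h) v)
    (hval : h.V .val = v) (htotal : h.V .total 0 = ∑ i ∈ range m, v i)
    (hbest : ∀ i < m, h.V .best i = 0) (hans : ∀ i < m, h.I .ans i < n ∧ AdjM h i (h.I .ans i))
    (hH : H.InclusionFreeConvex) {l : ℝ} (hl : 0 < l) (hl1 : l ≤ 1) (hE : 0 < E) :
    ∃ A : Fin m → Fin n, (∀ i : Fin m, ((mainProg E).eval h).I .ans i = A i) ∧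
      H.IsApproxSolution (l - l ^ E) A := by
  classical
  obtain ⟨pos, ha, he⟩ := hH
  set h6 := rowmProg.eval h with h6d
  set h7 := (digProg E).eval h6 with h7d
  have e8 : (mainProg E).eval h = (Prog.loop .g .states (guessProg E)).eval h7 := rfl
  rw [e8]
  have s6 : Same rowmProg h h6 := Prog.same _ _
  have s7 : Same (digProg E) h6 h7 := Prog.same _ _
  have k6 := hs.same s6 (by simp [rowmProg])
  have k7 := k6.same s7 (by simp [digProg])
  have I7 : ∀ a ∈ ([.states, .keys, .inp, .rown, .ans] : List IName), h7.I a = h.I a := by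
    intro a ha
    fin_cases ha <;> rw [s7.I (by simp [digProg]), s6.I (by simp [rowmProg])]
  have V7 : ∀ a, h7.V a = h.V a := fun a => by
    rw [s7.V (by simp [digProg]), s6.V (by simp [rowmProg])]
  have st6 : h6.I .states 0 = h.I .states 0 := by rw [s6.I (by simp [rowmProg])]
  have hrowm := rowmProg_spec h
  rw [hs.m_eq] at hrowm
  have hdig := digProg_spec E h6 (by rw [k6.b_eq]; omega) k6.dim_eq
  rw [k6.b_eq, st6] at hdig
  have henv : Env m n E (h.I .states 0) (AdjM h) v h7 := by
    constructor
    · exact k7.m_eq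
    · exact k7.n_eq
    · exact k7.b_eq
    · exact k7.unit_eq
    · exact k7.rounds_eq
    · rw [I7 _ (by simp), hkeys]
    · exact k7.cls0_eq
    · rw [I7 _ (by simp)]
    · ext i j
      exact AdjM_congr (I7 _ (by simp)) (I7 _ (by simp)) i j
    · rw [V7, hval]
    · rw [V7, htotal]
    · rw [s7.I (by simp [digProg])]; exact hrowm
    · exact hdig
  have hv : ∀ i < m, 0 ≤ v i := fun i hi => by
    rw [hd.val_eq ⟨i, hi⟩]; exact (H.v_pos _).le
  have hB : BestInv h7 (h7.V .best) (h7.I .ans) := by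
    constructor
    · rw [henv.m_eq, henv.n_eq, henv.adj_eq, I7 _ (by simp)]; exact hans
    · rw [henv.m_eq, henv.n_eq, henv.val_eq, V7]
      intro j _ i hi _
      rw [hbest i hi]
      exact sum_nonneg fun x hx => hv x (mem_range.1 (mem_filter.1 hx).1)
    · rw [henv.m_eq, V7]
      intro j _ i hi i' hi' _ _
      rw [hbest i hi, hbest i' hi']
  obtain ⟨⟨m1, m2, -⟩, m4⟩ := mainLoop_spec henv hv hB
  set h8 := (Prog.loop .g .states (guessProg E)).eval h7 with h8d
  rw [henv.m_eq, henv.n_eq, henv.adj_eq] at m1 m2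
  rw [henv.val_eq] at m2
  refine ⟨fun i => ⟨h8.I .ans i, (m1 i i.2).1⟩, fun i => rfl, ?_⟩
  set A : Fin m → Fin n := fun i => ⟨h8.I .ans i, (m1 i i.2).1⟩ with hA
  have hfeas : H.Feasible A := fun i => (hd.adj_iff i (A i)).1 (m1 i i.2).2
  refine ⟨hfeas, fun t ht ⟨B, hBt⟩ => ⟨hfeas, fun j => ?_⟩⟩
  have hnn : 0 ≤ H.utility A j := sum_nonneg fun i _ => (H.v_pos i).le
  rcases ht.eq_or_lt with rfl | ht
  · rw [mul_zero]; exact_mod_cast hnn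
  have hsurj : Function.Surjective B := fun q => by
    by_contra! hcon
    have h1 := hBt.2 q
    have h2 : H.utility B q = 0 := by
      rw [Instance.utility, filter_eq_empty_iff.2 (fun i _ => hcon i), sum_empty]
    rw [h2, Rat.cast_zero] at h1
    linarith
  -- For positive `t` every player needs an item. This justifies having no states when there are
  -- more players than items.
  have hnm : n ≤ m := by
    have := Fintype.card_le_of_surjective B hsurj
    simpa using this
  obtain ⟨i₀, hi₀⟩ := hsurj j
  rw [hstates, if_pos hnm] at m4
  obtain ⟨g, hg, hf⟩ := exists_guess hd ha he ht hl hl1 hE hBt hn i₀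
  obtain ⟨f, hfm, hT⟩ := m4 g hg
  obtain ⟨hreach, A', hA'⟩ := hf f hfm
  have h1 := hT A' _ hA' i₀ i₀.2 hreach
  have h2 := m2 j j.2 i₀ i₀.2 ((hd.adj_iff i₀ j).2 (hi₀ ▸ hBt.1 i₀))
  have h3 : ∑ l ∈ range m with h8.I .ans l = j, v l = H.utility A j := by
    rw [sum_filter, ← Fin.sum_univ_eq_sum_range (fun l => if h8.I .ans l = j then v l else 0),
      Instance.utility, sum_filter]
    refine sum_congr rfl fun i _ => ?_
    rw [hd.val_eq]
    exact if_congr (by rw [hA, Fin.ext_iff]) rfl rfl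
  rw [h3] at h2
  rw [mul_comm]
  refine h1.trans ?_
  exact_mod_cast h2

theorem coreProg_spec {m n E : ℕ} {H : Instance m n} {h : Mem} (hn : 0 < n) (hh : Holds H h)
    (hH : H.InclusionFreeConvex) {l : ℝ} (hl : 0 < l) (hl1 : l ≤ 1) (hE : 0 < E) :
    ((coreProg E).eval h).I .m 0 = m ∧
    ∃ A : Fin m → Fin n, (∀ i : Fin m, ((coreProg E).eval h).I .out (m + i) = A i) ∧
      H.IsApproxSolution (l - l ^ E) A := by
  set h1 := (scalarsProg E).eval h with h1d
  set h2 := setupProg.eval h1 with h2d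
  set h3 := (mainProg E).eval h2 with h3d
  have e4 : (coreProg E).eval h = outProg.eval h3 := rfl
  rw [e4]
  have s1 : Same (scalarsProg E) h h1 := Prog.same _ _
  have k1 : Scalars m n E h1 := scalarsProg_spec E hh.m_eq hh.n_eq
  have k2 : Scalars m n E h2 := k1.same (Prog.same setupProg h1) (by simp [setupProg, rownProg,
    defaultProg, statesProg, keyBoundProg])
  have hh1 : Holds H h1 := by
    have e1 : h1.I .inp = h.I .inp := s1.I (by simp [scalarsProg])
    have e2 : h1.V .val = h.V .val := s1.V (by simp [scalarsProg])
    constructor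
    · rw [e1]; exact hh.m_eq
    · rw [e1]; exact hh.n_eq
    · rw [e1]; exact hh.adj_iff
    · rw [e2]; exact hh.val_eq
  obtain ⟨st, ky⟩ := setupProg_states k1
  obtain ⟨v, v1, v2, v3, v4, v5⟩ := setupProg_spec k1 hh1
  obtain ⟨A, hA, hA'⟩ := mainProg_spec k2 hn st ky v1 v2 v3 v4 v5 hH hl hl1 hE
  have m3 : h3.I .m 0 = m := by
    rw [(Prog.same (mainProg E) h2).I (by simp [mainProg, rowmProg, digProg, guessProg, bfsProg,
      bfsRound, itemKeyProg, playerKeyProg, classProg, startProg, dpProg, playerProg, stateProg,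
      transitionProg, bundleProg, rowProg, copyProg, updateProg]), k2.m_eq]
  refine ⟨?_, A, fun i => ?_, hA'⟩
  · rw [(Prog.same outProg h3).I (by simp [outProg]), m3]
  · have := outProg_spec h3 i (by rw [m3]; exact i.2)
    rw [m3] at this
    rw [this, hA i]

/-! ### Input and output -/

/-- The program halts after at most `c` steps in a state with the property `Q`. -/
def Runs (p : Cmd) (s : State) (c : ℕ) (Q : State → Prop) : Prop :=
  ∃ T s', Exec p s T s' ∧ T ≤ c ∧ Q s'

theorem Runs.setIdx {a e : IExpr} {s : State} {c : ℕ} {Q : State → Prop}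
    (hc : a.cost + e.cost + 1 ≤ c)
    (h : Q { s with idx := Function.update s.idx (a.eval s) (e.eval s) }) :
    Runs (.setIdx a e) s c Q := ⟨_, _, Exec.setIdx a e s, hc, h⟩

theorem Runs.setVal {a : IExpr} {e : VExpr} {s : State} {c : ℕ} {Q : State → Prop}
    (hc : a.cost + e.cost + 1 ≤ c)
    (h : Q { s with val := Function.update s.val (a.eval s) (e.eval s) }) :
    Runs (.setVal a e) s c Q := ⟨_, _, Exec.setVal a e s, hc, h⟩

theorem Runs.seq {p q : Cmd} {s : State} {c c' : ℕ} {P Q : State → Prop} (hp : Runs p s c P)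
    (hq : ∀ s', P s' → Runs q s' c' Q) : Runs (.seq p q) s (c + c') Q := by
  obtain ⟨T, s', e, hT, hP⟩ := hp
  obtain ⟨T', s'', e', hT', hQ⟩ := hq s' hP
  exact ⟨_, _, Exec.seq e e', by omega, hQ⟩

theorem Runs.mono {p : Cmd} {s : State} {c c' : ℕ} {P Q : State → Prop} (hp : Runs p s c P)
    (hc : c ≤ c') (h : ∀ s', P s' → Q s') : Runs p s c' Q := by
  obtain ⟨T, s', e, hT, hP⟩ := hp
  exact ⟨T, s', e, hT.trans hc, h s' hP⟩

open Classical in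
theorem Runs.ite {b : BExpr} {p q : Cmd} {s : State} {c : ℕ} {Q : State → Prop}
    (hp : b.Holds s → Runs p s c Q) (hq : ¬ b.Holds s → Runs q s c Q) :
    Runs (.ite b p q) s (b.cost + c + 1) Q := by
  by_cases h : b.Holds s
  · obtain ⟨T, s', e, hT, hQ⟩ := hp h
    exact ⟨_, _, Exec.ite_true h e, by omega, hQ⟩
  · obtain ⟨T, s', e, hT, hQ⟩ := hq h
    exact ⟨_, _, Exec.ite_false h e, by omega, hQ⟩

/-- A loop with a variant that decreases by one in each round. -/
theorem Runs.loop {b : BExpr} {p : Cmd} (Inv : ℕ → State → Prop) (c : ℕ)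
    (h0 : ∀ s, Inv 0 s → ¬ b.Holds s)
    (hs : ∀ r s, Inv (r + 1) s → b.Holds s ∧ Runs p s c (Inv r)) (r : ℕ) (s : State)
    (h : Inv r s) : Runs (.loop b p) s (r * (b.cost + c + 1) + (b.cost + 1)) (Inv 0) := by
  induction r generalizing s with
  | zero => exact ⟨_, _, Exec.loop_false (h0 s h), by omega, h⟩
  | succ r ih =>
    obtain ⟨hb, T, s', e, hT, hs'⟩ := hs r s h
    obtain ⟨T', s'', e', hT', hs''⟩ := ih s' hs'
    refine ⟨_, _, Exec.loop_true hb e e', ?_, hs''⟩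
    rw [add_mul]
    omega

theorem mulc_cost (e : IExpr) (k : ℕ) : (mulc e k).cost = 1 + k * (e.cost + 1) := by
  induction k with
  | zero => simp [mulc, IExpr.cost]
  | succ k ih => simp [mulc, IExpr.cost, ih]; ring

theorem addr_cost (e : IExpr) (a : ℕ) : (addr e a).cost = 64 * e.cost + 67 := by
  simp [addr, IExpr.cost, mulc_cost]; ring

/-- The content of a fixed cell. -/
abbrev reg (a : ℕ) : IExpr := .load (.const a)

/-- Cell `2` gets the product of the cells `0` and `1`. -/
def productCmd : Cmd :=
  .seq (.setIdx (.const 2) (.const 0))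
    (.seq (.setIdx (.const 3) (reg 0))
      (.loop (.ile (.const 1) (reg 3))
        (.seq (.setIdx (.const 2) (.add (reg 2) (reg 1)))
          (.setIdx (.const 3) (.sub (reg 3) (.const 1))))))

/-- The cells from cell `4` on are moved to an array. -/
def spreadCmd : Cmd :=
  .seq (.setIdx (.const 3) (.add (reg 2) (.const 4)))
    (.loop (.not (.ile (reg 3) (.const 4)))
      (.seq (.setIdx (.const 3) (.sub (reg 3) (.const 1)))
        (.setIdx (addr (reg 3) 4) (.load (reg 3)))))

/-- The first cells are moved; the contents of the cells `2` and `3` are `b` and `c`. -/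
def headCmd (b c : ℕ) : Cmd :=
  .seq (.setIdx (.const 196) (.const c)) (.seq (.setIdx (.const 132) (.const b))
    (.seq (.setIdx (.const 68) (reg 1)) (.setIdx (.const 4) (reg 0))))

/-- The values are moved to an array. -/
def valuesCmd : Cmd :=
  .seq (.setIdx (.const 3) (reg 0))
    (.loop (.ile (.const 1) (reg 3))
      (.seq (.setIdx (.const 3) (.sub (reg 3) (.const 1)))
        (.setVal (addr (reg 3) 0) (.load (reg 3)))))

/-- The input is moved to arrays; the contents of the cells `2` and `3` are `b` and `c`. -/
def moveCmd (b c : ℕ) : Cmd :=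
  .seq productCmd (.seq spreadCmd (.seq (headCmd b c) valuesCmd))

/-- The input is moved to arrays. -/
def inputCmd : Cmd :=
  .ite (.ile (.const 1) (reg 2))
    (.ite (.ile (.const 1) (reg 3)) (moveCmd 1 1) (moveCmd 1 0))
    (.ite (.ile (.const 1) (reg 3)) (moveCmd 0 1) (moveCmd 0 0))

theorem productCmd_runs {m n : ℕ} {s : State} (hm : s.idx 0 = m) (hn : s.idx 1 = n) :
    Runs productCmd s (30 * m + 30) (fun s' => s'.idx 2 = m * n ∧ s'.val = s.val ∧
      ∀ a, a ≠ 2 → a ≠ 3 → s'.idx a = s.idx a) := by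
  refine Runs.mono (c := 3 + (5 + (m * _ + _))) (Runs.seq (Runs.setIdx (Q := fun s' =>
    s'.idx 2 = 0 ∧ s'.val = s.val ∧ ∀ a, a ≠ 2 → a ≠ 3 → s'.idx a = s.idx a) (by rfl) ?_)
    fun s1 h1 => Runs.seq (Runs.setIdx (Q := fun s' => s'.idx 3 = m ∧
    s'.idx 2 = 0 ∧ s'.val = s.val ∧ ∀ a, a ≠ 2 → a ≠ 3 → s'.idx a = s.idx a) (by
      simp [IExpr.cost]) ?_) fun s2 h2 => Runs.loop (fun r s' => r ≤ m ∧ s'.idx 3 = r ∧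
      s'.idx 2 = (m - r) * n ∧ s'.val = s.val ∧ ∀ a, a ≠ 2 → a ≠ 3 → s'.idx a = s.idx a) 14
      ?_ ?_ m s2 ?_) ?_ ?_
  · refine ⟨by simp [IExpr.eval], rfl, fun a h2 h3 => by simp [IExpr.eval, h2]⟩
  · obtain ⟨h1, h2, h3⟩ := h1
    refine ⟨?_, ?_, h2, fun a h2 h3' => ?_⟩
    · simp [IExpr.eval, h3 0, hm]
    · simp [IExpr.eval, h1]
    · simp [IExpr.eval, h3', h3 a h2 h3']
  · rintro s' ⟨-, h1, -⟩
    simp [BExpr.Holds, IExpr.eval, h1]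
  · rintro r s' ⟨h0, h1, h2, h3, h4⟩
    refine ⟨by simp [BExpr.Holds, IExpr.eval, h1], Runs.mono (c := 7 + 7) (Runs.seq (Runs.setIdx
      (Q := fun s' => s'.idx 3 = r + 1 ∧ s'.idx 2 = (m - r) * n ∧ s'.val = s.val ∧
      ∀ a, a ≠ 2 → a ≠ 3 → s'.idx a = s.idx a) (by simp [IExpr.cost]) ?_) fun s3 h => Runs.setIdx
      (by simp [IExpr.cost]) ?_) le_rfl fun _ h => h⟩
    · refine ⟨by simp [IExpr.eval, h1], ?_, h3, fun a k1 k2 => by simp [IExpr.eval, k1, h4 a k1 k2]⟩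
      have : m - r = m - (r + 1) + 1 := by omega
      simp [IExpr.eval, h2, h4 1, hn, this, add_mul]
    · obtain ⟨k1, k2, k3, k4⟩ := h
      exact ⟨by omega, by simp [IExpr.eval, k1], by simp [IExpr.eval, k2], k3,
        fun a l1 l2 => by simp [IExpr.eval, l2, k4 a l1 l2]⟩
  · obtain ⟨k1, k2, k3, k4⟩ := h2
    exact ⟨le_rfl, k1, by simp [k2], k3, k4⟩
  · simp [BExpr.cost, IExpr.cost]; omega
  · rintro s' ⟨-, -, h2, h3, h4⟩
    exact ⟨by simpa using h2, h3, h4⟩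

/-- Cell `a` goes to the later cell `64 * a + 4` (4 is the number of the array `inp`). Working
downwards, no cell is overwritten before it is read. -/
theorem spreadCmd_runs {k : ℕ} {s : State} (hk : s.idx 2 = k) :
    Runs spreadCmd s (300 * k + 300) (fun s' => s'.val = s.val ∧ s'.idx 0 = s.idx 0 ∧
      s'.idx 1 = s.idx 1 ∧ ∀ a, 4 ≤ a → a < k + 4 → s'.idx (64 * a + 4) = s.idx a) := by
  refine Runs.mono (c := 7 + (k * _ + _)) (Runs.seq (Runs.setIdx (Q := fun s' =>
    s'.idx 3 = k + 4 ∧ s'.val = s.val ∧ ∀ a, a ≠ 3 → s'.idx a = s.idx a)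
      (by simp [IExpr.cost]) ?_)
    fun s1 h1 => Runs.loop (fun r s' => r ≤ k ∧ s'.idx 3 = r + 4 ∧ s'.val = s.val ∧
      s'.idx 0 = s.idx 0 ∧ s'.idx 1 = s.idx 1 ∧
      (∀ a, 4 ≤ a → a < r + 4 → s'.idx a = s.idx a) ∧
      ∀ a, r + 4 ≤ a → a < k + 4 → s'.idx (64 * a + 4) = s.idx a) 230 ?_ ?_ k s1 ?_) ?_ ?_
  · exact ⟨by simp [IExpr.eval, hk], rfl, fun a h => by simp [IExpr.eval, h]⟩
  · rintro s' ⟨-, h1, -⟩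
    simp [BExpr.Holds, IExpr.eval, h1]
  · rintro r s' ⟨h0, h1, h2, h3, h4, h5, h6⟩
    refine ⟨by simp [BExpr.Holds, IExpr.eval, h1], Runs.mono (c := 6 + 200) (Runs.seq (Runs.setIdx
      (Q := fun s' => s'.idx 3 = r + 4 ∧ s'.val = s.val ∧ s'.idx 0 = s.idx 0 ∧
      s'.idx 1 = s.idx 1 ∧ (∀ a, 4 ≤ a → a < r + 5 → s'.idx a = s.idx a) ∧
      ∀ a, r + 5 ≤ a → a < k + 4 → s'.idx (64 * a + 4) = s.idx a) (by simp [IExpr.cost]) ?_)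
      fun s3 h => Runs.setIdx (by simp [IExpr.cost, addr_cost]) ?_) (by omega) fun _ h => h⟩
    · refine ⟨by simp [IExpr.eval, h1], h2, by simp [IExpr.eval, h3], by simp [IExpr.eval, h4],
        fun a k1 k2 => ?_, fun a k1 k2 => ?_⟩
      · have : a ≠ 3 := by omega
        simp [IExpr.eval, this, h5 a k1 (by omega)]
      · have : 64 * a + 4 ≠ 3 := by omega
        simp only [IExpr.eval, Function.update_apply, if_neg this]
        exact h6 a (by omega) k2
    · obtain ⟨k1, k2, k3, k4, k5, k6⟩ := h
      simp only [addr_eval, IExpr.eval, k1, k5 (r + 4) (by omega) (by omega)]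
      refine ⟨by omega, ?_, k2, ?_, ?_, fun a l1 l2 => ?_, fun a l1 l2 => ?_⟩
      · rw [Function.update_of_ne (by omega), k1]
      · rw [Function.update_of_ne (by omega), k3]
      · rw [Function.update_of_ne (by omega), k4]
      · rw [Function.update_of_ne (by omega), k5 a l1 (by omega)]
      · by_cases e : a = r + 4
        · rw [e, Function.update_self]
        · rw [Function.update_of_ne (by omega), k6 a (by omega) l2]
  · obtain ⟨k1, k2, k3⟩ := h1
    exact ⟨le_rfl, k1, k2, k3 0 (by omega), k3 1 (by omega), fun a l1 l2 => k3 a (by omega),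
      fun a l1 l2 => by omega⟩
  · simp [BExpr.cost, IExpr.cost]; omega
  · rintro s' ⟨-, -, h2, h3, h4, -, h6⟩
    exact ⟨h2, h3, h4, fun a l1 l2 => h6 a (by omega) l2⟩

theorem headCmd_runs {b c : ℕ} {s : State} :
    Runs (headCmd b c) s 20 (fun s' => s'.val = s.val ∧ s'.idx 0 = s.idx 0 ∧ s'.idx 4 = s.idx 0 ∧
      s'.idx 68 = s.idx 1 ∧ s'.idx 132 = b ∧ s'.idx 196 = c ∧
      ∀ a, 4 ≤ a → s'.idx (64 * a + 4) = s.idx (64 * a + 4)) := by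
  refine ⟨_, _, Exec.seq (Exec.setIdx _ _ _) (Exec.seq (Exec.setIdx _ _ _) (Exec.seq
    (Exec.setIdx _ _ _) (Exec.setIdx _ _ _))), ?_, ?_⟩
  · simp [IExpr.cost]
  · simp only [IExpr.eval, Function.update_apply]
    refine ⟨trivial, by simp, by simp, by simp, by simp, by simp, fun a ha => ?_⟩
    rw [if_neg (by omega), if_neg (by omega), if_neg (by omega), if_neg (by omega)]

theorem valuesCmd_runs {m : ℕ} {s : State} (hm : s.idx 0 = m) :
    Runs valuesCmd s (300 * m + 300) (fun s' => (∀ a, a ≠ 3 → s'.idx a = s.idx a) ∧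
      ∀ a < m, s'.val (64 * a) = s.val a) := by
  refine Runs.mono (c := 5 + (m * _ + _)) (Runs.seq (Runs.setIdx (Q := fun s' =>
    s'.idx 3 = m ∧ s'.val = s.val ∧ ∀ a, a ≠ 3 → s'.idx a = s.idx a)
      (by simp [IExpr.cost]) ?_)
    fun s1 h1 => Runs.loop (fun r s' => r ≤ m ∧ s'.idx 3 = r ∧
      (∀ a, a ≠ 3 → s'.idx a = s.idx a) ∧ (∀ a < r, s'.val a = s.val a) ∧
      ∀ a, r ≤ a → a < m → s'.val (64 * a) = s.val a) 230 ?_ ?_ m s1 ?_) ?_ ?_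
  · exact ⟨by simp [IExpr.eval, hm], rfl, fun a h => by simp [IExpr.eval, h]⟩
  · rintro s' ⟨-, h1, -⟩
    simp [BExpr.Holds, IExpr.eval, h1]
  · rintro r s' ⟨h0, h1, h2, h3, h4⟩
    refine ⟨by simp [BExpr.Holds, IExpr.eval, h1], Runs.mono (c := 6 + 200) (Runs.seq (Runs.setIdx
      (Q := fun s' => s'.idx 3 = r ∧ (∀ a, a ≠ 3 → s'.idx a = s.idx a) ∧
      (∀ a < r + 1, s'.val a = s.val a) ∧
      ∀ a, r + 1 ≤ a → a < m → s'.val (64 * a) = s.val a) (by simp [IExpr.cost]) ?_)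
      fun s3 h => Runs.setVal (by simp [IExpr.cost, VExpr.cost, addr_cost]) ?_) (by omega)
      fun _ h => h⟩
    · exact ⟨by simp [IExpr.eval, h1], fun a ha => by simp [IExpr.eval, ha, h2 a ha], h3, h4⟩
    · obtain ⟨k1, k2, k3, k4⟩ := h
      simp only [addr_eval, IExpr.eval, VExpr.eval, k1, k3 r (by omega)]
      refine ⟨by omega, trivial, k2, fun a l1 => ?_, fun a l1 l2 => ?_⟩
      · rw [Function.update_of_ne (by omega), k3 a (by omega)]
      · by_cases e : a = r
        · rw [e, add_zero, Function.update_self]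
        · rw [Function.update_of_ne (by omega), k4 a (by omega) l2]
  · obtain ⟨k1, k2, k3⟩ := h1
    exact ⟨le_rfl, k1, k3, fun a _ => by rw [k2], fun a l1 l2 => by omega⟩
  · simp [BExpr.cost, IExpr.cost]; omega
  · rintro s' ⟨-, -, h2, -, h4⟩
    exact ⟨h2, fun a l => h4 a (by omega) l⟩

theorem moveCmd_runs {m n b c : ℕ} {s : State} (hm : s.idx 0 = m) (hn : s.idx 1 = n)
    (hb : s.idx 2 = b) (hc : s.idx 3 = c) (hm0 : 0 < m) (hn0 : 0 < n) :
    Runs (moveCmd b c) s (1500 * (m * n)) (fun s' =>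
      (∀ a < m * n + 4, s'.idx (64 * a + 4) = s.idx a) ∧
      ∀ a < m, s'.val (64 * a) = s.val a) := by
  have hmn : m ≤ m * n := Nat.le_mul_of_pos_right m hn0
  refine Runs.mono (c := 30 * m + 30 + (300 * (m * n) + 300 + (20 + (300 * m + 300))))
    (Runs.seq (productCmd_runs hm hn) fun s1 h1 => Runs.seq (spreadCmd_runs h1.1)
    fun s2 h2 => Runs.seq (headCmd_runs (s := s2) (b := b) (c := c)) fun s3 h3 =>
    (valuesCmd_runs (m := m) ?_).mono le_rfl ?_) (by omega) fun _ h => h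
  · rw [h3.2.1, h2.2.1, h1.2.2 0 (by omega) (by omega), hm]
  · rintro s4 ⟨h4, h5⟩
    obtain ⟨-, v1, w1⟩ := h1
    obtain ⟨v2, x2, y2, w2⟩ := h2
    obtain ⟨v3, -, x3, y3, z3, u3, w3⟩ := h3
    refine ⟨fun a ha => ?_, fun a ha => ?_⟩
    · rw [h4 _ (by omega)]
      by_cases e : 4 ≤ a
      · rw [w3 a e, w2 a e (by omega), w1 a (by omega) (by omega)]
      · have : a = 0 ∨ a = 1 ∨ a = 2 ∨ a = 3 := by omega
        rcases this with rfl | rfl | rfl | rfl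
        · rw [x3, x2, w1 0 (by omega) (by omega)]
        · rw [y3, y2, w1 1 (by omega) (by omega)]
        · rw [z3, hb]
        · rw [u3, hc]
    · rw [h5 a ha, v3, v2, v1]

theorem inputCmd_runs {m n : ℕ} {s : State} (hm : s.idx 0 = m) (hn : s.idx 1 = n)
    (hb : s.idx 2 ≤ 1) (hc : s.idx 3 ≤ 1) (hm0 : 0 < m) (hn0 : 0 < n) :
    Runs inputCmd s (1510 * (m * n)) (fun s' =>
      (∀ a < m * n + 4, s'.idx (64 * a + 4) = s.idx a) ∧
      ∀ a < m, s'.val (64 * a) = s.val a) := by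
  have hmn : 0 < m * n := Nat.mul_pos hm0 hn0
  refine Runs.mono (c := 4 + (4 + 1500 * (m * n) + 1) + 1) (Runs.ite (fun h => Runs.ite
    (fun h' => moveCmd_runs hm hn ?_ ?_ hm0 hn0) fun h' => moveCmd_runs hm hn ?_ ?_ hm0 hn0)
    fun h => Runs.ite (fun h' => moveCmd_runs hm hn ?_ ?_ hm0 hn0)
      fun h' => moveCmd_runs hm hn ?_ ?_ hm0 hn0) (by omega) fun _ h => h
  all_goals simp only [BExpr.Holds, IExpr.eval] at h h'; omega

theorem Holds.of_input {m n : ℕ} {H : Instance m n} {s : State}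
    (h1 : ∀ a < m * n + 4, s.idx (64 * a + 4) = H.input.idx a)
    (h2 : ∀ a < m, s.val (64 * a) = H.input.val a) : Holds H (dec s) := by
  have hin : ∀ a, (dec s).I .inp a = s.idx (64 * a + 4) := fun a => rfl
  constructor
  · rw [hin, h1 0 (by omega)]; rfl
  · rw [hin, h1 1 (by omega)]; rfl
  · intro i j
    have h3 : (i : ℕ) * n + j < m * n := by
      calc (i : ℕ) * n + j < i * n + n := by omega
        _ = (i + 1) * n := by ring
        _ ≤ m * n := Nat.mul_le_mul_right n i.2
    rw [hin, h1 _ (by omega)]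
    simp only [Instance.input]
    rw [if_neg (by omega), if_neg (by omega)]
    constructor
    · intro h
      by_contra hcon
      rw [if_neg] at h
      · omega
      · rintro ⟨i', j', h4, h5⟩
        have hn : 0 < n := j.pos
        have h6 : n * (i : ℕ) + j = n * i' + j' := by rw [mul_comm n, mul_comm n]; omega
        have h7 : (i : ℕ) = i' := by
          have := congrArg (· / n) h6
          simpa [Nat.mul_add_div hn, Nat.div_eq_of_lt] using this
        have h8 : (j : ℕ) = j' := by rw [h7] at h6; omega
        rw [Fin.ext h7, Fin.ext h8] at hcon
        exact hcon h4
    · intro h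
      rw [if_pos ⟨i, j, h, rfl⟩]
  · intro i
    have : (dec s).V .val i = s.val (64 * i) := rfl
    rw [this, h2 i i.2]
    simp [Instance.input]

/-- The output is moved to the first cells. -/
def outputCmd : Cmd :=
  .seq (.setIdx (.const 0) (reg 1)) (.seq
    (.loop (.not (.ile (reg 0) (.const 2)))
      (.seq (.setIdx (.const 0) (.sub (reg 0) (.const 1)))
        (.setIdx (reg 0) (.load (addr (.add (reg 1) (reg 0)) 8)))))
    (.seq (.setIdx (.const 0) (.load (addr (reg 1) 8)))
      (.setIdx (.const 1) (.load (addr (.add (reg 1) (.const 1)) 8)))))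

theorem outputCmd_runs {m : ℕ} {s : State} {A : ℕ → ℕ} (hm0 : 0 < m) (hm : s.idx 1 = m)
    (hA : ∀ i < m, s.idx (64 * (m + i) + 8) = A i) :
    Runs outputCmd s (1000 * m + 1000) (fun s' => ∀ i < m, s'.idx i = A i) := by
  refine Runs.mono (c := 4 + (((m - 2) * _ + _) + (200 + 400))) (Runs.seq (Runs.setIdx
    (Q := fun s' => s'.idx 0 = m ∧ s'.idx 1 = m ∧ ∀ i < m, s'.idx (64 * (m + i) + 8) = A i)
      (by simp [IExpr.cost]) ?_) fun s1 h1 => Runs.seq (Runs.loop (fun r s' =>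
      (s'.idx 0 = r + 2 ∧ r + 2 ≤ m ∨ s'.idx 0 ≤ 2 ∧ r = 0) ∧ s'.idx 1 = m ∧
      (∀ i < m, s'.idx (64 * (m + i) + 8) = A i) ∧ ∀ i, r + 2 ≤ i → i < m → s'.idx i = A i)
      500 ?_ ?_ (m - 2) s1 ?_) fun s2 h2 => Runs.seq (Runs.setIdx (Q := fun s' =>
      s'.idx 0 = A 0 ∧ s'.idx 1 = m ∧
      (∀ i < m, s'.idx (64 * (m + i) + 8) = A i) ∧ ∀ i, 2 ≤ i → i < m → s'.idx i = A i)
      (by simp [IExpr.cost, addr_cost]) ?_) fun s3 h3 => Runs.setIdx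
      (by simp [IExpr.cost, addr_cost]) ?_) ?_ fun _ h => h
  · refine ⟨by simp [IExpr.eval, hm], by simp [IExpr.eval, hm], fun i hi => ?_⟩
    simp [IExpr.eval, hA i hi]
  · rintro s' ⟨h1, -⟩
    simp only [BExpr.Holds, IExpr.eval]
    omega
  · rintro r s' ⟨h1, h2, h3, h4⟩
    have h1' : s'.idx 0 = r + 3 ∧ r + 3 ≤ m := by omega
    refine ⟨by simp only [BExpr.Holds, IExpr.eval]; omega, Runs.mono (c := 6 + 400) (Runs.seq
      (Runs.setIdx (Q := fun s' => s'.idx 0 = r + 2 ∧ s'.idx 1 = m ∧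
      (∀ i < m, s'.idx (64 * (m + i) + 8) = A i) ∧ ∀ i, r + 3 ≤ i → i < m → s'.idx i = A i)
      (by simp [IExpr.cost]) ?_) fun s3 h => Runs.setIdx (by simp [IExpr.cost, addr_cost]) ?_)
      (by omega) fun _ h => h⟩
    · refine ⟨by simp [IExpr.eval, h1'.1], by simp [IExpr.eval, h2], fun i hi => ?_,
        fun i k1 k2 => ?_⟩
      · simp [IExpr.eval, h3 i hi]
      · have : i ≠ 0 := by omega
        simp [IExpr.eval, this, h4 i (by omega) k2]
    · obtain ⟨k1, k2, k3, k4⟩ := h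
      simp only [addr_eval, IExpr.eval, k1, k2]
      refine ⟨?_, ?_, fun i l1 => ?_, fun i l1 l2 => ?_⟩
      · rw [Function.update_of_ne (by omega), k1]; omega
      · rw [Function.update_of_ne (by omega), k2]
      · rw [Function.update_of_ne (by omega), k3 i l1]
      · by_cases e : i = r + 2
        · rw [e, Function.update_self, k3 _ (by omega)]
        · rw [Function.update_of_ne e, k4 i (by omega) l2]
  · obtain ⟨k1, k2, k3⟩ := h1
    exact ⟨by omega, k2, k3, fun i l1 l2 => by omega⟩
  · obtain ⟨-, k2, k3, k4⟩ := h2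
    simp only [addr_eval, IExpr.eval, k2]
    refine ⟨?_, ?_, fun i l1 => ?_, fun i l1 l2 => ?_⟩
    · rw [Function.update_self]; exact k3 0 hm0
    · rw [Function.update_of_ne (by omega), k2]
    · rw [Function.update_of_ne (by omega), k3 i l1]
    · rw [Function.update_of_ne (by omega), k4 i (by omega) l2]
  · obtain ⟨k1, k2, k3, k4⟩ := h3
    intro i hi
    simp only [addr_eval, IExpr.eval, k2]
    rcases i with _ | _ | i
    · rw [Function.update_of_ne (by omega), k1]
    · rw [Function.update_self, k3 1 hi]
    · rw [Function.update_of_ne (by omega), k4 _ (by omega) hi]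
  · simp [BExpr.cost, IExpr.cost]; omega

/-! ### Running time -/

/-- The values of the scalars that bound the loops. -/
def bounds (m n E S : ℕ) : IName → ℕ
  | .m => m
  | .n => n
  | .b => m + 1
  | .dim => E + 1
  | .cls0 => E
  | .rounds => m + n + 1
  | .keys => (2 * m + 2 * n + 1) * (m + n + 2)
  | .states => S
  | _ => 0

/-- The running time of the compiled program is bounded by a monomial in the number of items, the
number of players, the number of states, and the number of vertices. -/
structure Cost (E a b c d : ℕ) (p : Prog) : Prop where
  exists_bound : ∃ K, ∀ m n S, 1 ≤ m → 1 ≤ n → 1 ≤ S →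
    p.bnd (bounds m n E S) ≤ K * (m ^ a * n ^ b * S ^ c * (m + n) ^ d)

namespace Cost

variable {E a b c d : ℕ} {p q : Prog}

theorem one_le {m n S : ℕ} (hm : 1 ≤ m) (hn : 1 ≤ n) (hS : 1 ≤ S) (a b c d : ℕ) :
    1 ≤ m ^ a * n ^ b * S ^ c * (m + n) ^ d := by
  have : 0 < m + n := by omega
  exact Nat.succ_le_of_lt (by positivity)

theorem setI (x : IName) (i y : IE) : Cost E a b c d (.setI x i y) :=
  ⟨(addr i.compile x.ctorIdx).cost + y.compile.cost + 1, fun _ _ _ hm hn hS =>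
    Nat.le_mul_of_pos_right _ (one_le hm hn hS a b c d)⟩

theorem setV (x : VName) (i : IE) (y : VE) : Cost E a b c d (.setV x i y) :=
  ⟨(addr i.compile x.ctorIdx).cost + y.compile.cost + 1, fun _ _ _ hm hn hS =>
    Nat.le_mul_of_pos_right _ (one_le hm hn hS a b c d)⟩

theorem skip : Cost E a b c d .skip :=
  ⟨1, fun _ _ _ hm hn hS => by rw [one_mul]; exact one_le hm hn hS a b c d⟩

theorem seq (hp : Cost E a b c d p) (hq : Cost E a b c d q) : Cost E a b c d (p ;; q) := by
  obtain ⟨K, hK⟩ := hp.exists_bound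
  obtain ⟨K', hK'⟩ := hq.exists_bound
  refine .mk ⟨K + K', fun m n S hm hn hS => ?_⟩
  rw [add_mul]
  exact add_le_add (hK m n S hm hn hS) (hK' m n S hm hn hS)

theorem ite {t : BE} (hp : Cost E a b c d p) (hq : Cost E a b c d q) :
    Cost E a b c d (.ite t p q) := by
  obtain ⟨K, hK⟩ := (hp.seq hq).exists_bound
  refine .mk ⟨t.compile.cost + 1 + K, fun m n S hm hn hS => ?_⟩
  have h1 := hK m n S hm hn hS
  have h2 := Nat.le_mul_of_pos_right (t.compile.cost + 1) (one_le hm hn hS a b c d)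
  rw [add_mul]
  simp only [Prog.bnd] at h1 ⊢
  omega

theorem loop {x y : IName} {a' b' c' d' L : ℕ} (hp : Cost E a b c d p)
    (h : ∀ m n S, 1 ≤ m → 1 ≤ n → 1 ≤ S → bounds m n E S y * (m ^ a * n ^ b * S ^ c * (m + n) ^ d) ≤
      L * (m ^ a' * n ^ b' * S ^ c' * (m + n) ^ d')) : Cost E a' b' c' d' (.loop x y p) := by
  obtain ⟨K, hK⟩ := hp.exists_bound
  refine .mk ⟨(K + 20) * L + 20, fun m n S hm hn hS => ?_⟩
  have h1 := hK m n S hm hn hS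
  have h2 := one_le hm hn hS a b c d
  have h3 := one_le hm hn hS a' b' c' d'
  have h4 := h m n S hm hn hS
  set X := m ^ a * n ^ b * S ^ c * (m + n) ^ d
  set Y := m ^ a' * n ^ b' * S ^ c' * (m + n) ^ d'
  simp only [Prog.bnd]
  calc bounds m n E S y * (p.bnd (bounds m n E S) + 20) + 20
      ≤ bounds m n E S y * ((K + 20) * X) + 20 := by
        have : p.bnd (bounds m n E S) + 20 ≤ (K + 20) * X := by nlinarith
        exact Nat.add_le_add_right (Nat.mul_le_mul_left _ this) _
    _ = (K + 20) * (bounds m n E S y * X) + 20 := by ring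
    _ ≤ (K + 20) * (L * Y) + 20 * Y :=
        add_le_add (Nat.mul_le_mul_left _ h4) (by omega)
    _ = _ := by ring

theorem loop_m {x : IName} (hp : Cost E a b c d p) : Cost E (a + 1) b c d (.loop x .m p) :=
  hp.loop (L := 1) fun m n S _ _ _ => le_of_eq (by simp only [bounds]; ring)

theorem loop_b {x : IName} (hp : Cost E a b c d p) : Cost E (a + 1) b c d (.loop x .b p) :=
  hp.loop (L := 2) fun m n S hm _ _ => by
    simp only [bounds]
    calc (m + 1) * (m ^ a * n ^ b * S ^ c * (m + n) ^ d)
        ≤ (2 * m) * (m ^ a * n ^ b * S ^ c * (m + n) ^ d) := Nat.mul_le_mul_right _ (by omega)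
      _ = _ := by ring

theorem loop_n {x : IName} (hp : Cost E a b c d p) : Cost E a (b + 1) c d (.loop x .n p) :=
  hp.loop (L := 1) fun m n S _ _ _ => le_of_eq (by simp only [bounds]; ring)

theorem loop_states {x : IName} (hp : Cost E a b c d p) :
    Cost E a b (c + 1) d (.loop x .states p) :=
  hp.loop (L := 1) fun m n S _ _ _ => le_of_eq (by simp only [bounds]; ring)

theorem loop_dim {x : IName} (hp : Cost E a b c d p) : Cost E a b c d (.loop x .dim p) :=
  hp.loop (L := E + 1) fun _ _ _ _ _ _ => le_rfl

theorem loop_cls0 {x : IName} (hp : Cost E a b c d p) : Cost E a b c d (.loop x .cls0 p) :=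
  hp.loop (L := E) fun _ _ _ _ _ _ => le_rfl

theorem loop_rounds {x : IName} (hp : Cost E a b c d p) :
    Cost E a b c (d + 1) (.loop x .rounds p) :=
  hp.loop (L := 2) fun m n S hm _ _ => by
    simp only [bounds]
    calc (m + n + 1) * (m ^ a * n ^ b * S ^ c * (m + n) ^ d)
        ≤ (2 * (m + n)) * (m ^ a * n ^ b * S ^ c * (m + n) ^ d) :=
          Nat.mul_le_mul_right _ (by omega)
      _ = _ := by ring

theorem loop_keys {x : IName} (hp : Cost E a b c d p) :
    Cost E a b c (d + 2) (.loop x .keys p) :=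
  hp.loop (L := 9) fun m n S hm _ _ => by
    simp only [bounds]
    calc ((2 * m + 2 * n + 1) * (m + n + 2)) * (m ^ a * n ^ b * S ^ c * (m + n) ^ d)
        ≤ (3 * (m + n)) * (3 * (m + n)) * (m ^ a * n ^ b * S ^ c * (m + n) ^ d) :=
          Nat.mul_le_mul_right _ (Nat.mul_le_mul (by omega) (by omega))
      _ = _ := by ring

end Cost

theorem setupProg_cost (E : ℕ) : Cost E 1 1 0 1 setupProg := by
  unfold setupProg rownProg defaultProg statesProg keyBoundProg
  repeat' first
    | exact Cost.setI _ _ _ | exact Cost.setV _ _ _ | exact Cost.skip | apply Cost.seq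
    | apply Cost.ite | apply Cost.loop_m | apply Cost.loop_n | apply Cost.loop_b
    | apply Cost.loop_dim | apply Cost.loop_rounds

theorem mainProg_cost (E : ℕ) : Cost E 1 1 3 2 (mainProg E) := by
  unfold mainProg rowmProg digProg guessProg bfsProg bfsRound itemKeyProg playerKeyProg classProg
    startProg dpProg playerProg stateProg transitionProg bundleProg rowProg copyProg updateProg
  repeat' first
    | exact Cost.setI _ _ _ | exact Cost.setV _ _ _ | exact Cost.skip | apply Cost.seq
    | apply Cost.ite | apply Cost.loop_m | apply Cost.loop_n | apply Cost.loop_b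
    | apply Cost.loop_dim | apply Cost.loop_rounds | apply Cost.loop_states | apply Cost.loop_cls0
    | apply Cost.loop_keys

theorem outProg_cost (E : ℕ) : Cost E 1 0 0 0 outProg := by
  unfold outProg
  exact Cost.loop_m (Cost.setI _ _ _)

theorem mainProg_cost_zero (E : ℕ) : ∃ K, ∀ m n,
    (mainProg E).bnd (bounds m n E 0) = K := by
  refine ⟨(mainProg E).bnd (bounds 0 0 E 0), fun m n => ?_⟩
  simp [mainProg, rowmProg, digProg, Prog.bnd, bounds]

theorem scalarsProg_cost (E : ℕ) : ∃ K, ∀ β, (scalarsProg E).bnd β = K :=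
  ⟨(scalarsProg E).bnd fun _ => 0, fun _ => rfl⟩

theorem setupProg_bnd {m n E S : ℕ} :
    setupProg.bnd (bounds m n E S) = setupProg.bnd (bounds m n E 1) := by
  simp [setupProg, rownProg, defaultProg, statesProg, keyBoundProg, Prog.bnd, bounds]

theorem outProg_bnd {m n E S : ℕ} :
    outProg.bnd (bounds m n E S) = outProg.bnd (bounds m n E 1) := by
  simp [outProg, Prog.bnd, bounds]

/-- The number of states for `m` items and `n` players. -/
def numStates (m n E : ℕ) : ℕ := if n ≤ m then (m + 1) ^ (E + 1) else 0

/-- The total time of the compiled programs. -/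
theorem total_cost {E : ℕ} (hE : 0 < E) : ∃ K, ∀ m n, 0 < m → 0 < n →
    1510 * (m * n) + ((scalarsProg E).bnd (bounds m n E (numStates m n E)) +
      (setupProg.bnd (bounds m n E (numStates m n E)) +
      ((mainProg E).bnd (bounds m n E (numStates m n E)) +
      (outProg.bnd (bounds m n E (numStates m n E)) + (1000 * m + 1000))))) ≤
    K * ((m + n) * n * m ^ (2 * (2 * E + 1 + 1))) := by
  obtain ⟨K1, h1⟩ := scalarsProg_cost E
  obtain ⟨K2, h2⟩ := (setupProg_cost E).exists_bound
  obtain ⟨K3, h3⟩ := (mainProg_cost E).exists_bound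
  obtain ⟨K3', h3'⟩ := mainProg_cost_zero E
  obtain ⟨K4, h4⟩ := (outProg_cost E).exists_bound
  refine ⟨1510 + (K1 + (K2 + ((K3 * 2 ^ (3 * E + 4) + K3') + (K4 + 2000)))),
    fun m n hm hn => ?_⟩
  rw [h1, setupProg_bnd, outProg_bnd]
  set X := (m + n) * n * m ^ (2 * (2 * E + 1 + 1)) with hX
  have hmp : m ≤ m ^ (2 * (2 * E + 1 + 1)) := Nat.le_self_pow (by omega) m
  have x1 : m * n * (m + n) ≤ X := by
    calc m * n * (m + n) = (m + n) * n * m := by ring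
      _ ≤ X := Nat.mul_le_mul_left _ hmp
  have x2 : m * n ≤ X := (Nat.le_mul_of_pos_right _ (by omega)).trans x1
  have x3 : m ≤ X := (Nat.le_mul_of_pos_right _ hn).trans x2
  have x4 : 1 ≤ X := le_trans hm x3
  have y2 : setupProg.bnd (bounds m n E 1) ≤ K2 * X := by
    refine (h2 m n 1 hm hn le_rfl).trans (Nat.mul_le_mul_left _ (le_trans (le_of_eq ?_) x1))
    ring
  have y4 : outProg.bnd (bounds m n E 1) ≤ K4 * X := by
    refine (h4 m n 1 hm hn le_rfl).trans (Nat.mul_le_mul_left _ (le_trans (le_of_eq ?_) x3))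
    ring
  have y3 : (mainProg E).bnd (bounds m n E (numStates m n E)) ≤
      (K3 * 2 ^ (3 * E + 4) + K3') * X := by
    rw [add_mul]
    by_cases hnm : n ≤ m
    · refine le_trans ?_ (Nat.le_add_right _ _)
      rw [numStates, if_pos hnm, mul_assoc]
      refine (h3 m n _ hm hn (Nat.one_le_pow _ _ (by omega))).trans (Nat.mul_le_mul_left _ ?_)
      calc m ^ 1 * n ^ 1 * ((m + 1) ^ (E + 1)) ^ 3 * (m + n) ^ 2
          ≤ m ^ 1 * n ^ 1 * ((2 * m) ^ (E + 1)) ^ 3 * ((m + n) * (2 * m)) := by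
            refine Nat.mul_le_mul (Nat.mul_le_mul_left _ (Nat.pow_le_pow_left
              (Nat.pow_le_pow_left (by omega) _) _)) ?_
            rw [pow_two]
            exact Nat.mul_le_mul_left _ (by omega)
        _ = 2 ^ (3 * E + 4) * ((m + n) * n * m ^ (3 * E + 5)) := by
            rw [mul_pow]
            ring
        _ ≤ 2 ^ (3 * E + 4) * X := by
            refine Nat.mul_le_mul_left _ (Nat.mul_le_mul_left _ ?_)
            exact Nat.pow_le_pow_right hm (by omega)
    · rw [numStates, if_neg hnm, h3']
      exact (Nat.le_mul_of_pos_right _ x4).trans (Nat.le_add_left _ _)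
  have y1 : K1 ≤ K1 * X := Nat.le_mul_of_pos_right _ x4
  have y5 : 1510 * (m * n) ≤ 1510 * X := Nat.mul_le_mul_left _ x2
  simp only [add_mul] at y3 ⊢
  omega

/-! ### The algorithm -/

theorem Runs.compile {p : Prog} {β : IName → ℕ} (hwf : p.WF)
    (hb : ∀ a, p.Bounds a → ¬ p.ModI a) {s : State}
    (hβ : ∀ a, p.Bounds a → (dec s).I a 0 = β a) :
    Runs p.compile s (p.bnd β) (fun s' => dec s' = p.eval (dec s)) :=
  p.exec_compile β hwf hb s hβ

theorem scalarsProg_runs (E : ℕ) (s : State) (β : IName → ℕ) :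
    Runs (scalarsProg E).compile s ((scalarsProg E).bnd β)
      (fun s' => dec s' = (scalarsProg E).eval (dec s)) :=
  Runs.compile (by simp [scalarsProg]) (by simp [scalarsProg]) (by simp [scalarsProg])

theorem setupProg_runs {m n E S : ℕ} {s : State} (hs : Scalars m n E (dec s)) :
    Runs setupProg.compile s (setupProg.bnd (bounds m n E S))
      (fun s' => dec s' = setupProg.eval (dec s)) := by
  refine Runs.compile ?_ (fun a => ?_) (fun a => ?_)
  · simp [setupProg, rownProg, defaultProg, statesProg, keyBoundProg]
  · simp only [setupProg, rownProg, defaultProg, statesProg, keyBoundProg, Prog.Bounds, Prog.ModI]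
    cases a <;> simp
  · simp only [setupProg, rownProg, defaultProg, statesProg, keyBoundProg, Prog.Bounds]
    cases a <;> simp [bounds, hs.m_eq, hs.n_eq, hs.b_eq, hs.dim_eq, hs.rounds_eq]

theorem mainProg_runs {m n E S : ℕ} {s : State} (hs : Scalars m n E (dec s))
    (hS : (dec s).I .states 0 = S)
    (hK : (dec s).I .keys 0 = (2 * m + 2 * n + 1) * (m + n + 2)) :
    Runs (mainProg E).compile s ((mainProg E).bnd (bounds m n E S))
      (fun s' => dec s' = (mainProg E).eval (dec s)) := by
  refine Runs.compile ?_ (fun a => ?_) (fun a => ?_)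
  · simp [mainProg, rowmProg, digProg, guessProg, bfsProg, bfsRound, itemKeyProg, playerKeyProg,
      classProg, startProg, dpProg, playerProg, stateProg, transitionProg, bundleProg, rowProg,
      copyProg, updateProg]
  · simp only [mainProg, rowmProg, digProg, guessProg, bfsProg, bfsRound, itemKeyProg,
      playerKeyProg, classProg, startProg, dpProg, playerProg, stateProg, transitionProg,
      bundleProg, rowProg, copyProg, updateProg, Prog.Bounds, Prog.ModI]
    cases a <;> simp
  · simp only [mainProg, rowmProg, digProg, guessProg, bfsProg, bfsRound, itemKeyProg,
      playerKeyProg, classProg, startProg, dpProg, playerProg, stateProg, transitionProg,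
      bundleProg, rowProg, copyProg, updateProg, Prog.Bounds]
    cases a <;> simp [bounds, hs.m_eq, hs.n_eq, hs.b_eq, hs.dim_eq, hs.rounds_eq, hs.cls0_eq, hS,
      hK]

theorem outProg_runs {m n E S : ℕ} {s : State} (hm : (dec s).I .m 0 = m) :
    Runs outProg.compile s (outProg.bnd (bounds m n E S))
      (fun s' => dec s' = outProg.eval (dec s)) := by
  refine Runs.compile ?_ (fun a => ?_) (fun a => ?_)
  · simp [outProg]
  · simp only [outProg, Prog.Bounds, Prog.ModI]
    cases a <;> simp
  · simp only [outProg, Prog.Bounds]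
    cases a <;> simp [bounds, hm]

/-- The algorithm. -/
def algorithm (E : ℕ) : Cmd :=
  .seq inputCmd (.seq (scalarsProg E).compile (.seq setupProg.compile
    (.seq (mainProg E).compile (.seq outProg.compile outputCmd))))

theorem mainProg_m (E : ℕ) (h : Mem) : ((mainProg E).eval h).I .m = h.I .m :=
  (Prog.same (mainProg E) h).I (by simp [mainProg, rowmProg, digProg, guessProg, bfsProg,
    bfsRound, itemKeyProg, playerKeyProg, classProg, startProg, dpProg, playerProg, stateProg,
    transitionProg, bundleProg, rowProg, copyProg, updateProg])

theorem algorithm_runs {m n E : ℕ} (hm : 0 < m) (hn : 0 < n) (H : Instance m n)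
    (hH : H.InclusionFreeConvex) {l : ℝ} (hl : 0 < l) (hl1 : l ≤ 1) (hE : 0 < E) :
    Runs (algorithm E) H.input (1510 * (m * n) +
      ((scalarsProg E).bnd (bounds m n E (numStates m n E)) +
      (setupProg.bnd (bounds m n E (numStates m n E)) +
      ((mainProg E).bnd (bounds m n E (numStates m n E)) +
      (outProg.bnd (bounds m n E (numStates m n E)) + (1000 * m + 1000))))))
      (fun s => ∃ A : Fin m → Fin n, s.Outputs A ∧ H.IsApproxSolution (l - l ^ E) A) := by
  have hbit : ∀ a, 2 ≤ a → H.input.idx a ≤ 1 := fun a ha => by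
    simp only [Instance.input]
    rw [if_neg (by omega), if_neg (by omega)]
    split_ifs <;> omega
  refine Runs.seq (inputCmd_runs (s := H.input) rfl rfl (hbit 2 le_rfl) (hbit 3 (by omega)) hm hn)
    fun s1 h1 => ?_
  have hh : Holds H (dec s1) := Holds.of_input h1.1 h1.2
  refine Runs.seq (scalarsProg_runs E s1 _) fun s2 h2 => ?_
  have k2 : Scalars m n E (dec s2) := h2 ▸ scalarsProg_spec E hh.m_eq hh.n_eq
  refine Runs.seq (setupProg_runs k2) fun s3 h3 => ?_
  have k3 : Scalars m n E (dec s3) := h3 ▸ k2.same (Prog.same setupProg _) (by simp [setupProg,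
    rownProg, defaultProg, statesProg, keyBoundProg])
  obtain ⟨st, ky⟩ := setupProg_states k2
  rw [← h3] at st ky
  refine Runs.seq (mainProg_runs k3 st ky) fun s4 h4 => ?_
  refine Runs.seq (outProg_runs (m := m) (by rw [h4, mainProg_m]; exact k3.m_eq)) fun s5 h5 => ?_
  have e5 : dec s5 = (coreProg E).eval (dec s1) := by
    rw [h5, h4, h3, h2]
    rfl
  obtain ⟨c1, A, c2, c3⟩ := coreProg_spec hn hh hH hl hl1 hE
  rw [← e5] at c1 c2
  refine (outputCmd_runs (A := fun i => if h : i < m then A ⟨i, h⟩ else 0) hm c1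
    fun i hi => ?_).mono le_rfl fun s6 h6 => ⟨A, fun i => ?_, c3⟩
  · rw [dif_pos hi]
    exact c2 ⟨i, hi⟩
  · rw [h6 i i.2, dif_pos i.2]

theorem exists_algorithm {E : ℕ} {l : ℝ} (hl : 0 < l) (hl1 : l ≤ 1) (hE : 0 < E) :
    ∃ p K, IsApproxAlgorithm p (l - l ^ E)
      (fun m n => K * ((m + n) * n * m ^ (2 * (2 * E + 1 + 1)))) := by
  obtain ⟨K, hK⟩ := total_cost hE
  refine ⟨algorithm E, K, fun m n hm hn H hH => ?_⟩
  obtain ⟨T, s, h1, h2, A, h3, h4⟩ := algorithm_runs hm hn H hH hl hl1 hE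
  exact ⟨T, s, A, h1, h2.trans (hK m n hm hn), h3, h4⟩

end Ram

theorem Instance.IsApproxSolution.mono {m n : ℕ} {H : Instance m n} {A : Fin m → Fin n}
    {ρ ρ' : ℝ} (h : H.IsApproxSolution ρ A) (hρ : ρ' ≤ ρ) : H.IsApproxSolution ρ' A :=
  ⟨h.1, fun t ht hB => ⟨h.1, fun j =>
    (mul_le_mul_of_nonneg_right hρ ht).trans ((h.2 t ht hB).2 j)⟩⟩

theorem IsApproxAlgorithm.mono {p : Cmd} {ρ ρ' : ℝ} {b b' : ℕ → ℕ → ℕ}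
    (h : IsApproxAlgorithm p ρ b) (hρ : ρ' ≤ ρ) (hb : ∀ m n, 0 < m → 0 < n → b m n ≤ b' m n) :
    IsApproxAlgorithm p ρ' b' := by
  intro m n hm hn H hH
  obtain ⟨T, s, A, h1, h2, h3, h4⟩ := h m n hm hn H hH
  exact ⟨T, s, A, h1, h2.trans (hb m n hm hn), h3, h4.mono hρ⟩

/-! ### The parameters -/

theorem log_ratio_ge {k : ℝ} (hk : 1 < k) : 2 / k ≤ Real.log ((k + 1) / (k - 1)) := by
  have h1 : 0 < k - 1 := by linarith
  have h := Real.le_log_one_add_of_nonneg (x := 2 / (k - 1)) (by positivity)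
  have e1 : 1 + 2 / (k - 1) = (k + 1) / (k - 1) := by field_simp; ring
  have e2 : 2 * (2 / (k - 1)) / (2 / (k - 1) + 2) = 2 / k := by
    have : k ≠ 0 := by linarith
    have : 2 / (k - 1) + 2 ≠ 0 := by positivity
    field_simp
    ring
  rwa [e1, e2] at h

/-- A number of thresholds that suffices. -/
theorem exists_thresholds {k : ℝ} (hk : 4 ≤ k) :
    ∃ E : ℕ, 0 < E ∧ ((k - 1) / (k + 1)) ^ E ≤ 2 / (k + 1) ∧
      2 * (E : ℝ) < k * Real.log ((k + 1) / 2) + 2 := by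
  classical
  have h0 : 0 < (k - 1) / (k + 1) := div_pos (by linarith) (by linarith)
  have h1 : (k - 1) / (k + 1) < 1 := by rw [div_lt_one (by linarith)]; linarith
  have ex : ∃ E : ℕ, ((k - 1) / (k + 1)) ^ E ≤ 2 / (k + 1) := by
    obtain ⟨E, hE⟩ := exists_pow_lt_of_lt_one (show 0 < 2 / (k + 1) by positivity) h1
    exact ⟨E, hE.le⟩
  have hE0 : Nat.find ex ≠ 0 := fun h => by
    have := Nat.find_spec ex
    rw [h, pow_zero, le_div_iff₀ (by linarith)] at this
    linarith
  obtain ⟨E, hE⟩ := Nat.exists_eq_succ_of_ne_zero hE0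
  refine ⟨Nat.find ex, Nat.pos_of_ne_zero hE0, Nat.find_spec ex, ?_⟩
  have h2 : 2 / (k + 1) < ((k - 1) / (k + 1)) ^ E :=
    not_le.1 (Nat.find_min ex (by omega))
  have h3 := Real.log_lt_log (by positivity) h2
  rw [Real.log_pow, ← neg_lt_neg_iff, ← mul_neg, ← Real.log_inv, ← Real.log_inv, inv_div,
    inv_div] at h3
  have h4 := log_ratio_ge (k := k) (by linarith)
  have h5 : (E : ℝ) * (2 / k) < Real.log ((k + 1) / 2) :=
    lt_of_le_of_lt (mul_le_mul_of_nonneg_left h4 (Nat.cast_nonneg E)) h3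
  have h6 : 2 * (E : ℝ) = k * (E * (2 / k)) := by field_simp
  rw [hE, Nat.cast_succ]
  have h7 := mul_lt_mul_of_pos_left h5 (show 0 < k by linarith)
  linarith

theorem mul_log_le {k : ℝ} (hk : 5 ≤ k) :
    k * Real.log ((k + 1) / 2) + 2 ≤ Real.log k / Real.log (1 + 1 / k) := by
  have hk0 : 0 < k := by linarith
  have h1 : Real.log (1 + 1 / k) ≤ 1 / k := by
    have := Real.log_le_sub_one_of_pos (show 0 < 1 + 1 / k by positivity)
    linarith
  have h2 : 0 < Real.log (1 + 1 / k) := Real.log_pos (by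
    have : 0 < 1 / k := by positivity
    linarith)
  have h3 : k * Real.log k ≤ Real.log k / Real.log (1 + 1 / k) := by
    rw [le_div_iff₀ h2]
    have h4 : 0 ≤ k * Real.log k := mul_nonneg hk0.le (Real.log_nonneg (by linarith))
    calc k * Real.log k * Real.log (1 + 1 / k) ≤ k * Real.log k * (1 / k) :=
          mul_le_mul_of_nonneg_left h1 h4
      _ = Real.log k := by field_simp
  refine le_trans ?_ h3
  have h4 := Real.le_log_one_add_of_nonneg (x := (k - 1) / (k + 1))
    (div_nonneg (by linarith) (by linarith))
  have e1 : 1 + (k - 1) / (k + 1) = k / ((k + 1) / 2) := by field_simp; ring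
  have e2 : 2 * ((k - 1) / (k + 1)) / ((k - 1) / (k + 1) + 2) = 2 * (k - 1) / (3 * k + 1) := by
    have : (k - 1) / (k + 1) + 2 = (3 * k + 1) / (k + 1) := by field_simp; ring
    rw [this]
    field_simp
  rw [e1, e2, Real.log_div hk0.ne' (by positivity)] at h4
  have h5 : 2 / k ≤ 2 * (k - 1) / (3 * k + 1) := by
    rw [div_le_div_iff₀ hk0 (by linarith)]
    nlinarith
  have h6 := mul_le_mul_of_nonneg_left (h5.trans h4) hk0.le
  have h7 : k * (2 / k) = 2 := by field_simp
  rw [h7, mul_sub] at h6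
  linarith

theorem mul_log_le_rpow {k : ℝ} (hk : 5 ≤ k) :
    k * Real.log ((k + 1) / 2) + 3 ≤ k ^ (1.4 : ℝ) := by
  have hk0 : 0 < k := by linarith
  set u : ℝ := k ^ (0.4 : ℝ) with hu
  have hu0 : 0 < u := Real.rpow_pos_of_pos hk0 _
  have e1 : k ^ (1.4 : ℝ) = k * u := by
    rw [hu, show (1.4 : ℝ) = 1 + 0.4 by norm_num, Real.rpow_add hk0, Real.rpow_one]
  have h1 : Real.log k = 2.5 * Real.log u := by
    rw [hu, Real.log_rpow hk0]; ring
  have h2 := Real.log_le_sub_one_of_pos (show 0 < u / 2.5 by positivity)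
  rw [Real.log_div hu0.ne' (by norm_num)] at h2
  have h3 : Real.log 2.5 ≤ Real.log 2 + 0.25 := by
    have := Real.log_le_sub_one_of_pos (show (0 : ℝ) < 1.25 by norm_num)
    have e : (2.5 : ℝ) = 2 * 1.25 := by norm_num
    rw [e, Real.log_mul (by norm_num) (by norm_num)]
    linarith
  have h4 := Real.log_two_lt_d9
  have h5 := Real.log_two_gt_d9
  have h6 : Real.log ((k + 1) / 2) ≤ Real.log k - Real.log 2 + 1 / k := by
    have h7 := Real.log_le_sub_one_of_pos (show 0 < 1 + 1 / k by positivity)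
    have e : (k + 1) / 2 = k * (1 + 1 / k) / 2 := by field_simp
    rw [e, Real.log_div (by positivity) (by norm_num), Real.log_mul hk0.ne' (by positivity)]
    linarith
  have h7 : 1 / k ≤ 1 / 5 := one_div_le_one_div_of_le (by norm_num) hk
  have h8 : Real.log ((k + 1) / 2) + 3 * (1 / k) ≤ u := by
    have e3 : u / 2.5 = 0.4 * u := by ring
    rw [e3] at h2
    have e4 : (2.5 : ℝ) * Real.log u ≤ u + 2.5 * (Real.log 2 + 0.25 - 1) := by
      have := mul_le_mul_of_nonneg_left (show Real.log u ≤ 0.4 * u + (Real.log 2 + 0.25 - 1) by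
        linarith) (show (0 : ℝ) ≤ 2.5 by norm_num)
      refine this.trans (le_of_eq ?_)
      ring
    norm_num at h1 e4 h4 h5
    linarith
  have h9 := mul_le_mul_of_nonneg_left h8 hk0.le
  have e2 : k * (Real.log ((k + 1) / 2) + 3 * (1 / k)) = k * Real.log ((k + 1) / 2) + 3 := by
    field_simp
  rw [e1, ← e2]
  exact h9

theorem exists_parameters (k : ℕ) (hk : 4 ≤ k) :
    ∃ E : ℕ, 0 < E ∧ (((k : ℝ) - 1) / (k + 1)) ^ E ≤ 2 / ((k : ℝ) + 1) ∧
      2 * E + 1 ≤ ⌈Real.log (k : ℝ) / Real.log (1 + 1 / (k : ℝ))⌉₊ ∧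
      ((2 * E + 1 : ℕ) : ℝ) ≤ (k : ℝ) ^ (1.4 : ℝ) := by
  have key : ∀ {E : ℕ}, 2 * (E : ℝ) < Real.log (k : ℝ) / Real.log (1 + 1 / (k : ℝ)) →
      2 * E + 1 ≤ ⌈Real.log (k : ℝ) / Real.log (1 + 1 / (k : ℝ))⌉₊ := fun h => by
    refine Nat.succ_le_of_lt (Nat.lt_ceil.2 ?_)
    push_cast
    exact h
  rcases hk.eq_or_lt with rfl | hk
  · refine ⟨2, by norm_num, by norm_num, key ?_, ?_⟩
    · have h1 : (0 : ℝ) < Real.log (1 + 1 / (4 : ℕ)) := Real.log_pos (by norm_num)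
      rw [lt_div_iff₀ h1]
      have h2 : 2 * ((2 : ℕ) : ℝ) * Real.log (1 + 1 / (4 : ℕ)) =
          Real.log ((1 + 1 / (4 : ℕ)) ^ 4) := by
        rw [Real.log_pow]
        norm_num
      rw [h2]
      exact Real.log_lt_log (by norm_num) (by norm_num)
    · by_contra! h
      have h1 : (((4 : ℕ) : ℝ) ^ (1.4 : ℝ)) ^ 5 = 4 ^ 7 := by
        rw [← Real.rpow_natCast, ← Real.rpow_mul (by norm_num), ← Real.rpow_natCast]
        norm_num
      have h2 := pow_lt_pow_left₀ h (by positivity) (show 5 ≠ 0 by norm_num)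
      rw [h1] at h2
      norm_num at h2
  · have hk5 : (5 : ℝ) ≤ k := by exact_mod_cast hk
    obtain ⟨E, h1, h2, h3⟩ := exists_thresholds (k := k) (by linarith)
    refine ⟨E, h1, h2, key (h3.trans_le (mul_log_le hk5)), ?_⟩
    have := mul_log_le_rpow hk5
    push_cast
    linarith

end SantaClaus

end

theorem theorem1 :
    (∀ k : ℕ, 4 ≤ k →
      ∃ C : ℕ, C ≤ ⌈Real.log (k : ℝ) / Real.log (1 + 1 / (k : ℝ))⌉₊ ∧
        (C : ℝ) ≤ (k : ℝ) ^ (1.4 : ℝ) ∧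
        ∃ (p : SantaClaus.Cmd) (K : ℕ),
          SantaClaus.IsApproxAlgorithm p (1 - 4 / ((k : ℝ) + 1))
            (fun m n => K * ((m + n) * n * m ^ (2 * (C + 1))))) ∧
    (∀ ε : ℝ, 0 < ε →
      ∃ (p : SantaClaus.Cmd) (K d : ℕ),
        SantaClaus.IsApproxAlgorithm p (1 - ε) (fun m n => K * (m + n) ^ d)) := by
  have ha : ∀ k : ℕ, 4 ≤ k →
      ∃ C : ℕ, C ≤ ⌈Real.log (k : ℝ) / Real.log (1 + 1 / (k : ℝ))⌉₊ ∧
        (C : ℝ) ≤ (k : ℝ) ^ (1.4 : ℝ) ∧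
        ∃ (p : SantaClaus.Cmd) (K : ℕ),
          SantaClaus.IsApproxAlgorithm p (1 - 4 / ((k : ℝ) + 1))
            (fun m n => K * ((m + n) * n * m ^ (2 * (C + 1)))) := by
    intro k hk
    obtain ⟨E, h1, h2, h3, h4⟩ := SantaClaus.exists_parameters k hk
    have hk4 : (4 : ℝ) ≤ k := by exact_mod_cast hk
    obtain ⟨p, K, h5⟩ := SantaClaus.Ram.exists_algorithm (E := E)
      (l := ((k : ℝ) - 1) / (k + 1)) (div_pos (by linarith) (by linarith))
      ((div_le_one (by linarith)).2 (by linarith)) h1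
    refine ⟨2 * E + 1, h3, h4, p, K, h5.mono ?_ fun _ _ _ _ => le_rfl⟩
    have : 1 - 4 / ((k : ℝ) + 1) = ((k : ℝ) - 1) / (k + 1) - 2 / (k + 1) := by
      field_simp
      ring
    linarith
  refine ⟨ha, fun ε hε => ?_⟩
  obtain ⟨k, hk⟩ := exists_nat_ge (4 / ε)
  obtain ⟨C, -, -, p, K, h⟩ := ha (k + 4) (by omega)
  refine ⟨p, K, 2 * (C + 1) + 2, h.mono ?_ fun m n _ _ => ?_⟩
  · have h1 : 4 ≤ ε * k := by
      rw [div_le_iff₀ hε] at hk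
      linarith
    have h2 : 4 / (((k + 4 : ℕ) : ℝ) + 1) ≤ ε := by
      rw [div_le_iff₀ (by positivity)]
      push_cast
      nlinarith
    linarith
  · refine Nat.mul_le_mul_left _ ?_
    calc (m + n) * n * m ^ (2 * (C + 1)) ≤ (m + n) * (m + n) * (m + n) ^ (2 * (C + 1)) :=
          Nat.mul_le_mul (Nat.mul_le_mul_left _ (by omega)) (Nat.pow_le_pow_left (by omega) _)
      _ = (m + n) ^ (2 * (C + 1) + 2) := by ring
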